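/- Let $\mathfrak J$ be the exceptional Jordan algebra of Hermitian $3\times3$ octonionic matrices with $x\circ y=\frac12(xy+yx)$, $\langle x,y\rangle={\rm tr}(x\circ y)$, $\mathfrak J'=\ker{\rm tr}$ and $x\star y=x\circ y-\frac13\langle x,y\rangle I_3$. Let $\mathbb H$ be the quaternions with $\langle h,h'\rangle={\rm Re}(\bar h h')$, imaginary units $h_1,h_2,h_3$ and $\mathbb H'={\rm span}(h_1,h_2,h_3)$; $D(\cdot)$ denotes the Lie algebra of linear derivations. (0) Tits algebra. On $\mathfrak g=D(\mathbb H)\oplus D(\mathfrak J)\oplus(\mathbb H'\otimes\mathfrak J')$ the commutators of $D(\mathbb H)$ and $D(\mathfrak J)$, their natural action on $\mathbb H'\otimes\mathfrak J'$, and $$[h\otimes x,h'\otimes y]=\tfrac1{12}\langle x,y\rangle D_{h,h'}-\langle h,h'\rangle[L_x,L_y]+\tfrac12[h,h']\otimes(x\star y),\qquad D_{h,h'}=[L_h,L_{h'}]+[R_h,R_{h'}],$$ define a Lie bracket. There is a basis $(j_a)_{a\le26}$ of $\mathfrak J'$ with $\langle j_a,j_b\rangle=2\delta_{ab}$ and a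 basis $(D_I)_{I\le52}$ of $D(\mathfrak J)$ with ${\rm Tr}_{\mathfrak J}(D_ID_K)=-6\delta_{IK}$. For a real $\tau>0$, any basis $(j_a)$ of $\mathfrak J'$ with $\langle j_a,j_b\rangle=\tau\delta_{ab}$ and any basis $(D_I)$ of $D(\mathfrak J)$, put $j_{27}=\sqrt{\tau/3}\,I_3$. Then $(j_\mu)_{\mu\le27}$ is a basis of $\mathfrak J$ with dual basis $\hat j^\mu=\tau^{-1}\langle j_\mu,\cdot\rangle$, and the 133 elements $\Psi_A$ given by $H_L={\rm ad}_{h_L}$ ($A=L\le3$), $D_I$ ($A=I+3$), $h_1\otimes j_a$, $h_2\otimes j_a$, $h_3\otimes j_a$ ($A=a+55,\ a+81,\ a+107$) form a basis of $\mathfrak g$. Let $M_A$ be the adjoint matrices, $[\Psi_A,\Psi_B]=\sum_C(M_A)^C{}_B\Psi_C$. (1) Cubic form. The trilinear form $$Det(x,y,z)=\tfrac13{\rm tr}(x\circ y\circ z)-\tfrac16\big({\rm tr}x\,{\rm tr}(y\circ z)+{\rm tr}y\,{\rm tr}(x\circ z)+{\rm tr}z\,{\rm tr}(x\circ y)\big)+\tfrac16{\rm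 tr}x\,{\rm tr}y\,{\rm tr}z$$ is totally symmetric and annihilated by every $\delta+R_s$ ($\delta\in D(\mathfrak J)$, $s\in\mathfrak J'$). The relation $Det(x,y,z)=\frac13{\rm tr}((x\rhd y)\circ z)$ determines the Freudenthal product $x\rhd y=x\circ y-\frac12{\rm tr}(x)y-\frac12{\rm tr}(y)x+\frac12{\rm tr}(x){\rm tr}(y)I_3-\frac12{\rm tr}(x\circ y)I_3$. (2) Yokota action. On $V_{56}=(\mathfrak J_{\mathbb C}\oplus\mathbb C)^2$, for $\delta\in D(\mathfrak J)$, $s\in\mathfrak J'$, $\nu\in\mathbb R$, $p,q\in\mathfrak J$, put $\phi=\delta-iR_s$ (with transpose $\phi^t=-\delta-iR_s$ for the trace form), $z=q+ip$, $w=-q+ip$, and let $(\delta,s,\nu,p,q)$ act by $$\begin{pmatrix}x\\\mu_1\\y\\\mu_2\end{pmatrix}\mapsto\begin{pmatrix}\phi x+\frac i2\sqrt{\frac\tau3}\,\nu x+w\rhd y+\frac12\mu_2z\\ \frac12\langle z,y\rangle-\frac i2\sqrt{3\tau}\,\nu\mu_1\\ -\phi^ty-\frac i2\sqrt{\frac\tau3}\,\nu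 y+z\rhd x+\frac12\mu_1w\\ \frac12\langle w,x\rangle+\frac i2\sqrt{3\tau}\,\nu\mu_2\end{pmatrix}.$$ Let $Y_1,Y_2,Y_3$ be the operators with only $\nu=1$, resp. $p=j_{27}$, resp. $q=j_{27}$ nonzero; $Y_{I+3}$ ($I\le52$) the one with only $\delta=D_I$ nonzero; $Y_{a+55},Y_{a+81},Y_{a+107}$ those with only $s=j_a$, $p=j_a$, $q=j_a$ nonzero. Put $k_A=2\sqrt{3/\tau}$ for $A\le3$ and $k_A=1$ for $A>3$. Then the $k_AY_A$ satisfy exactly the commutation relations of the $M_A$: $$[M_A,M_B]=\sum_C(M_A)^C{}_B\,M_C,\qquad[k_AY_A,k_BY_B]=\sum_C(M_A)^C{}_B\,k_CY_C .$$ (3) Matrices. Let $\tau=2$ (so $k_A=\sqrt6$ for $A\le3$) and put $(C_I)^\mu{}_\nu=\hat j^\mu(D_Ij_\nu)$, $(\tilde C_\alpha)^\mu{}_\nu=-i\,\hat j^\mu(j_\nu\circ j_\alpha)$, $(A_\alpha)_{\mu\nu}=\hat j^\mu(j_\alpha\rhd j_\nu)$, $\tilde I={\rm diag}(1,\dots,1,-2)$.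 Write $[P,Q,R,S;v,w;c,d]$ for the $56\times56$ matrix with block rows $(P,0,Q,v)$, $(0,c,v^t,0)$, $(R,w,S,0)$, $(w^t,0,0,d)$, block sizes $27,1,27,1$. In the coordinates of $V_{56}$ given by the $j_\mu$ on both copies of $\mathfrak J_{\mathbb C}$ and by the vector $\sqrt2$ on both copies of $\mathbb C$, the operators $Y_A$ are the matrices $$\begin{aligned}&Y_1=[\tfrac i{\sqrt6}I_{27},0,0,-\tfrac i{\sqrt6}I_{27};0,0;-i\sqrt{\tfrac32},i\sqrt{\tfrac32}],\\ &Y_2=\tfrac12[0,-i\sqrt{\tfrac23}\tilde I,-i\sqrt{\tfrac23}\tilde I,0;i\sqrt2e_{27},i\sqrt2e_{27};0,0],\\ &Y_3=\tfrac12[0,\sqrt{\tfrac23}\tilde I,-\sqrt{\tfrac23}\tilde I,0;\sqrt2e_{27},-\sqrt2e_{27};0,0],\\ &Y_{I+3}=[C_I,0,0,-C_I^t;0,0;0,0],\qquad Y_{a+55}=[\tilde C_a,0,0,-\tilde C_a^t;0,0;0,0],\\ &Y_{a+81}=\tfrac12[0,2iA_a,2iA_a,0;i\sqrt2e_a,i\sqrt2e_a;0,0],\\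 &Y_{a+107}=\tfrac12[0,-2A_a,2A_a,0;\sqrt2e_a,-\sqrt2e_a;0,0].\end{aligned}$$ The 133 matrices $M_A$, and the 133 matrices $Y_A$, are linearly independent over $\mathbb R$. The real span of the $M_A$ is a simple Lie algebra of dimension 133 with negative definite Killing form (compact $E_7$), and $M_A\mapsto k_AY_A$ is a faithful representation of it, irreducible on $\mathbb C^{56}$. If ${\rm Tr}_{\mathfrak J}(D_ID_K)=-6\delta_{IK}$, then $-\frac1{12}{\rm Tr}(Y_AY_B)=\delta_{AB}$ for all $A,B$. (4) Symmetry ($\tau=2$). With $D_{\alpha\beta\gamma}=Det(j_\alpha,j_\beta,j_\gamma)$, for all $\alpha,\beta,\gamma\le27$ $$(A_\alpha)_{\beta\gamma}=\tfrac12{\rm tr}((j_\alpha\rhd j_\gamma)\circ j_\beta)=\tfrac32D_{\alpha\gamma\beta},$$ which is totally symmetric in $\alpha,\beta,\gamma$; for $a\le26$, $j_a\rhd x=j_a\circ x-\frac12{\rm tr}(x)j_a-\frac12\langle x,j_a\rangle I_3$. For $a,b,c\le26$, $(A_c)_{ab}=\frac12{\rm tr}(j_c\circ j_b\circ j_a)=i(\tilde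 C_c)^a{}_b$, so the $\tilde C_c$ without 27th row and column are totally symmetric; also $(\tilde C_a)^\mu{}_b=(\tilde C_b)^\mu{}_a$ for all $\mu\le27$. Moreover $$0=(A_a)_{27,27}=(A_{27})_{a,27}=(\tilde C_a)^{27}{}_{27}=(\tilde C_{27})^a{}_{27},$$ $$-\tfrac12\sqrt{\tfrac23}\,\delta_{ab}=(A_a)_{b,27}=(A_{27})_{ab}=-\tfrac i2(\tilde C_a)^b{}_{27}=-\tfrac i2(\tilde C_{27})^b{}_a,$$ $$\sqrt{\tfrac23}=(A_{27})_{27,27}=i(\tilde C_{27})^{27}{}_{27}.$$ -/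

import Mathlib

open scoped Quaternion TensorProduct

attribute [local instance 100] LieRing.ofAssociativeRing

namespace E7Rep

/-- The real octonions, as the Cayley–Dickson double of the quaternions. -/
def Octonion : Type := ℍ[ℝ] × ℍ[ℝ]

namespace Octonion

noncomputable instance : AddCommGroup Octonion := inferInstanceAs (AddCommGroup (ℍ[ℝ] × ℍ[ℝ]))
noncomputable instance : Module ℝ Octonion := inferInstanceAs (Module ℝ (ℍ[ℝ] × ℍ[ℝ]))

@[ext] theorem ext' {x y : Octonion} (h1 : x.1 = y.1) (h2 : x.2 = y.2) : x = y := Prod.ext h1 h2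
@[simp] theorem add_fst (x y : Octonion) : (x + y).1 = x.1 + y.1 := rfl
@[simp] theorem add_snd (x y : Octonion) : (x + y).2 = x.2 + y.2 := rfl
@[simp] theorem zero_fst : (0 : Octonion).1 = 0 := rfl
@[simp] theorem zero_snd : (0 : Octonion).2 = 0 := rfl
@[simp] theorem smul_fst (c : ℝ) (x : Octonion) : (c • x).1 = c • x.1 := rfl
@[simp] theorem smul_snd (c : ℝ) (x : Octonion) : (c • x).2 = c • x.2 := rfl

noncomputable instance : Mul Octonion :=
  ⟨fun x y => (x.1 * y.1 - star y.2 * x.2, y.2 * x.1 + x.2 * star y.1)⟩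
noncomputable instance : One Octonion := ⟨((1 : ℍ[ℝ]), (0 : ℍ[ℝ]))⟩

@[simp] theorem mul_fst (x y : Octonion) : (x * y).1 = x.1 * y.1 - star y.2 * x.2 := rfl
@[simp] theorem mul_snd (x y : Octonion) : (x * y).2 = y.2 * x.1 + x.2 * star y.1 := rfl
@[simp] theorem one_fst : (1 : Octonion).1 = 1 := rfl
@[simp] theorem one_snd : (1 : Octonion).2 = 0 := rfl

noncomputable instance : NonAssocRing Octonion :=
  { (inferInstance : AddCommGroup Octonion), (inferInstance : Mul Octonion),
    (inferInstance : One Octonion) with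
    left_distrib := fun x y z => by ext1 <;> simp [mul_add, add_mul] <;> abel
    right_distrib := fun x y z => by ext1 <;> simp [mul_add, add_mul] <;> abel
    zero_mul := fun x => by ext1 <;> simp
    mul_zero := fun x => by ext1 <;> simp
    one_mul := fun x => by ext1 <;> simp
    mul_one := fun x => by ext1 <;> simp }

noncomputable instance : StarRing Octonion where
  star x := (star x.1, -x.2)
  star_involutive x := by ext1 <;> simp
  star_mul x y := by
    apply ext'
    · show star (x.1 * y.1 - star y.2 * x.2) = star y.1 * star x.1 - star (-x.2) * (-y.2)
      simp
    · show -(y.2 * x.1 + x.2 * star y.1) = -x.2 * star y.1 + -y.2 * star (star x.1)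
      simp
  star_add x y := by
    apply ext'
    · show star (x.1 + y.1) = star x.1 + star y.1
      simp
    · show -(x.2 + y.2) = -x.2 + -y.2
      abel

@[simp] theorem star_fst (x : Octonion) : (star x).1 = star x.1 := rfl
@[simp] theorem star_snd (x : Octonion) : (star x).2 = -x.2 := rfl

noncomputable instance : IsScalarTower ℝ Octonion Octonion :=
  ⟨fun c x y => by ext1 <;> simp [smul_sub]⟩
noncomputable instance : SMulCommClass ℝ Octonion Octonion :=
  ⟨fun c x y => by ext1 <;> simp [smul_sub]⟩
noncomputable instance : StarModule ℝ Octonion :=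
  ⟨fun c x => by ext1 <;> simp⟩

/-- The real part. -/
noncomputable def re : Octonion →ₗ[ℝ] ℝ where
  toFun x := x.1.re
  map_add' x y := by simp
  map_smul' c x := by simp

end Octonion

/-- Hermitian octonionic `3 × 3` matrices. -/
noncomputable def hermitian : Submodule ℝ (Matrix (Fin 3) (Fin 3) Octonion) where
  carrier := {X | X.conjTranspose = X}
  add_mem' := by
    intro X Y hX hY
    simp only [Set.mem_ofPred_eq, Matrix.conjTranspose_add] at *
    rw [hX, hY]
  zero_mem' := by simp
  smul_mem' := by
    intro c X hX
    simp only [Set.mem_ofPred_eq, Matrix.conjTranspose_smul] at *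
    rw [hX]; simp

/-- The exceptional Jordan algebra `𝔍 = 𝔍₃(𝕆)`. -/
def Albert : Type := hermitian

namespace Albert
noncomputable instance : AddCommGroup Albert := inferInstanceAs (AddCommGroup hermitian)
noncomputable instance : Module ℝ Albert := inferInstanceAs (Module ℝ hermitian)

/-- The underlying matrix. -/
noncomputable def toMatrix : Albert →ₗ[ℝ] Matrix (Fin 3) (Fin 3) Octonion := hermitian.subtype

theorem toMatrix_injective : Function.Injective toMatrix := Subtype.val_injective

theorem conjTranspose_toMatrix (x : Albert) : (toMatrix x).conjTranspose = toMatrix x := x.2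

/-- The Jordan product `(XY + YX) / 2`. -/
noncomputable instance : Mul Albert :=
  ⟨fun x y => ⟨(1 / 2 : ℝ) • (toMatrix x * toMatrix y + toMatrix y * toMatrix x), by
    show Matrix.conjTranspose _ = _
    rw [Matrix.conjTranspose_smul, Matrix.conjTranspose_add, Matrix.conjTranspose_mul,
      Matrix.conjTranspose_mul, conjTranspose_toMatrix, conjTranspose_toMatrix]
    simp [add_comm]⟩⟩

theorem toMatrix_mul (x y : Albert) : toMatrix (x * y) =
    (1 / 2 : ℝ) • (toMatrix x * toMatrix y + toMatrix y * toMatrix x) := rfl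

noncomputable instance : NonUnitalNonAssocCommRing Albert :=
  { (inferInstance : AddCommGroup Albert), (inferInstance : Mul Albert) with
    left_distrib := fun x y z => toMatrix_injective (by
      simp only [toMatrix_mul, map_add, mul_add, add_mul, smul_add]; abel)
    right_distrib := fun x y z => toMatrix_injective (by
      simp only [toMatrix_mul, map_add, mul_add, add_mul, smul_add]; abel)
    zero_mul := fun x => toMatrix_injective (by simp [toMatrix_mul])
    mul_zero := fun x => toMatrix_injective (by simp [toMatrix_mul])
    mul_comm := fun x y => toMatrix_injective (by simp [toMatrix_mul, add_comm]) }

noncomputable instance : IsScalarTower ℝ Albert Albert :=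
  ⟨fun c x y => toMatrix_injective (by
    simp only [smul_eq_mul, toMatrix_mul, map_smul, smul_mul_assoc, mul_smul_comm, ← smul_add,
      smul_comm c])⟩
noncomputable instance : SMulCommClass ℝ Albert Albert :=
  ⟨fun c x y => toMatrix_injective (by
    simp only [smul_eq_mul, toMatrix_mul, map_smul, smul_mul_assoc, mul_smul_comm, ← smul_add,
      smul_comm c])⟩

/-- The identity matrix `I₃`. -/
noncomputable def idMat : Albert := ⟨1, Matrix.conjTranspose_one⟩

/-- The trace; the diagonal entries of a Hermitian matrix are real. -/
noncomputable def tr : Albert →ₗ[ℝ] ℝ where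
  toFun x := ∑ i, Octonion.re (toMatrix x i i)
  map_add' x y := by simp [Finset.sum_add_distrib]
  map_smul' c x := by simp [Finset.mul_sum]

/-- The inner product `⟨x, y⟩ = tr (x ∘ y)`. -/
noncomputable def inn : LinearMap.BilinForm ℝ Albert := (LinearMap.mul ℝ Albert).compr₂ tr

/-- The product `x ⋆ y = x ∘ y - (1/3) ⟨x, y⟩ I₃`. -/
noncomputable def starMul : Albert →ₗ[ℝ] Albert →ₗ[ℝ] Albert :=
  LinearMap.mk₂ ℝ (fun x y => x * y - (1 / 3 : ℝ) • inn x y • idMat)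
    (fun x x' y => by simp only [add_mul, map_add, LinearMap.add_apply]; module)
    (fun c x y => by
      simp only [smul_mul_assoc, map_smul, LinearMap.smul_apply, smul_eq_mul]; module)
    (fun x y y' => by simp only [mul_add, map_add]; module)
    (fun c x y => by simp only [mul_smul_comm, map_smul, smul_eq_mul]; module)

/-- The trilinear determinant form. -/
noncomputable def det (x y z : Albert) : ℝ :=
  1 / 3 * tr (x * y * z)
    - 1 / 6 * (tr x * tr (y * z) + tr y * tr (x * z) + tr z * tr (x * y))
    + 1 / 6 * (tr x * tr y * tr z)

/-- The Freudenthal product `x ▷ y`. -/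
noncomputable def freud : Albert →ₗ[ℝ] Albert →ₗ[ℝ] Albert :=
  LinearMap.mk₂ ℝ (fun x y => x * y - (1 / 2 : ℝ) • tr x • y - (1 / 2 : ℝ) • tr y • x
      + (1 / 2 : ℝ) • (tr x * tr y) • idMat - (1 / 2 : ℝ) • tr (x * y) • idMat)
    (fun x x' y => by simp only [add_mul, map_add]; module)
    (fun c x y => by simp only [smul_mul_assoc, map_smul, smul_eq_mul]; module)
    (fun x y y' => by simp only [mul_add, map_add]; module)
    (fun c x y => by simp only [mul_smul_comm, map_smul, smul_eq_mul]; module)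

/-- The traceless part `𝔍'`. -/
noncomputable def traceless : Submodule ℝ Albert := LinearMap.ker tr

end Albert

open Albert

/-- The Lie algebra `D(A)` of linear derivations of a (possibly non-associative) real algebra. -/
def Der (A : Type*) [NonUnitalNonAssocRing A] [Module ℝ A] [IsScalarTower ℝ A A]
    [SMulCommClass ℝ A A] : LieSubalgebra ℝ (Module.End ℝ A) where
  carrier := {D | ∀ x y, D (x * y) = D x * y + x * D y}
  add_mem' := by
    intro D E hD hE x y
    simp only [LinearMap.add_apply, hD x y, hE x y, add_mul, mul_add]
    abel
  zero_mem' := by intro x y; simp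
  smul_mem' := by
    intro c D hD x y
    simp only [LinearMap.smul_apply, hD x y, smul_add, smul_mul_assoc, mul_smul_comm]
  lie_mem' := by
    intro D E hD hE x y
    simp only [Ring.lie_def, LinearMap.sub_apply, Module.End.mul_apply, hE x y, hD x y, map_add,
      hD _ _, hE _ _, sub_mul, mul_sub]
    abel

/-! ### The Tits construction -/

/-- The imaginary units `h₁ = i`, `h₂ = j`, `h₃ = k`. -/
def imUnit : Fin 3 → ℍ[ℝ] := ![⟨0, 1, 0, 0⟩, ⟨0, 0, 1, 0⟩, ⟨0, 0, 0, 1⟩]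

/-- `[h, h']` in the quaternions. -/
noncomputable def quatComm : ℍ[ℝ] →ₗ[ℝ] ℍ[ℝ] →ₗ[ℝ] ℍ[ℝ] :=
  LinearMap.mul ℝ ℍ[ℝ] - (LinearMap.mul ℝ ℍ[ℝ]).flip

/-- `⟨h, h'⟩ = Re (h̄ h')`. -/
noncomputable def quatInn : ℍ[ℝ] →ₗ[ℝ] ℍ[ℝ] →ₗ[ℝ] ℝ :=
  LinearMap.mk₂ ℝ (fun h h' => (star h * h').re)
    (fun h g h' => by simp [add_mul]) (fun c h h' => by simp)
    (fun h h' g => by simp [mul_add]) (fun c h h' => by simp)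

/-- `D_{h,h'} = [L_h, L_{h'}] + [R_h, R_{h'}]`. -/
noncomputable def quatDer : ℍ[ℝ] →ₗ[ℝ] ℍ[ℝ] →ₗ[ℝ] Module.End ℝ ℍ[ℝ] :=
  LinearMap.mk₂ ℝ (fun h h' => ⁅LinearMap.mulLeft ℝ h, LinearMap.mulLeft ℝ h'⁆
      + ⁅LinearMap.mulRight ℝ h, LinearMap.mulRight ℝ h'⁆)
    (fun h g h' => by
      apply LinearMap.ext; intro x
      simp only [Ring.lie_def, LinearMap.add_apply, LinearMap.sub_apply, Module.End.mul_apply,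
        LinearMap.mulLeft_apply, LinearMap.mulRight_apply]
      noncomm_ring)
    (fun c h h' => by
      apply LinearMap.ext; intro x
      simp only [Ring.lie_def, LinearMap.add_apply, LinearMap.sub_apply, Module.End.mul_apply,
        LinearMap.mulLeft_apply, LinearMap.mulRight_apply, LinearMap.smul_apply,
        smul_mul_assoc, mul_smul_comm]
      module)
    (fun h h' g => by
      apply LinearMap.ext; intro x
      simp only [Ring.lie_def, LinearMap.add_apply, LinearMap.sub_apply, Module.End.mul_apply,
        LinearMap.mulLeft_apply, LinearMap.mulRight_apply]
      noncomm_ring)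
    (fun c h h' => by
      apply LinearMap.ext; intro x
      simp only [Ring.lie_def, LinearMap.add_apply, LinearMap.sub_apply, Module.End.mul_apply,
        LinearMap.mulLeft_apply, LinearMap.mulRight_apply, LinearMap.smul_apply,
        smul_mul_assoc, mul_smul_comm]
      module)

/-- `[L_x, L_y]` on the Jordan algebra. -/
noncomputable def jordanComm : Albert →ₗ[ℝ] Albert →ₗ[ℝ] Module.End ℝ Albert :=
  (LinearMap.mul ℝ (Module.End ℝ Albert) - (LinearMap.mul ℝ (Module.End ℝ Albert)).flip).compl₁₂
    (LinearMap.mul ℝ Albert) (LinearMap.mul ℝ Albert)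

/-- An ambient vector space for the Tits algebra. -/
abbrev TitsAmbient : Type := Module.End ℝ ℍ[ℝ] × Module.End ℝ Albert × (ℍ[ℝ] ⊗[ℝ] Albert)

/-- The subspace `D(ℍ) ⊕ D(𝔍) ⊕ (ℍ' ⊗ 𝔍')` of the ambient space. -/
noncomputable def titsSpace : Submodule ℝ TitsAmbient :=
  (Der ℍ[ℝ]).toSubmodule.prod ((Der Albert).toSubmodule.prod
    (Submodule.span ℝ {t | ∃ (h : ℍ[ℝ]) (x : Albert), h.re = 0 ∧ tr x = 0 ∧ t = h ⊗ₜ[ℝ] x}))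

/-- `(H, J) (h ⊗ x) = H h ⊗ x + h ⊗ J x`. -/
noncomputable def titsAct (H : Module.End ℝ ℍ[ℝ]) (J : Module.End ℝ Albert) :
    (ℍ[ℝ] ⊗[ℝ] Albert) →ₗ[ℝ] (ℍ[ℝ] ⊗[ℝ] Albert) :=
  LinearMap.rTensor Albert H + LinearMap.lTensor ℍ[ℝ] J

/-- The Tits product, determined by the commutators in `D(ℍ)` and `D(𝔍)`, the natural action of
`D(ℍ) ⊕ D(𝔍)` on `ℍ' ⊗ 𝔍'`, and
`[h ⊗ x, h' ⊗ y] = (1/12) ⟨x, y⟩ D_{h,h'} - ⟨h, h'⟩ [L_x, L_y] + (1/2) [h, h'] ⊗ (x ⋆ y)`.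
It is meant on `titsSpace`; the formula is written on the ambient space. -/
noncomputable def titsBracket (X Y : TitsAmbient) : TitsAmbient :=
  (⁅X.1, Y.1⁆ + (1 / 12 : ℝ) •
      TensorProduct.rid ℝ (Module.End ℝ ℍ[ℝ]) (TensorProduct.map₂ quatDer inn X.2.2 Y.2.2),
    ⁅X.2.1, Y.2.1⁆ -
      TensorProduct.lid ℝ (Module.End ℝ Albert)
        (TensorProduct.map₂ quatInn jordanComm X.2.2 Y.2.2),
    titsAct X.1 X.2.1 Y.2.2 - titsAct Y.1 Y.2.1 X.2.2
      + (1 / 2 : ℝ) • TensorProduct.map₂ quatComm starMul X.2.2 Y.2.2)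

/-- The 133 labels: `inl L` for `H_L`, `inr (inl I)` for the derivation `D_I` of `𝔍`,
`inr (inr (i, a))` for `h_{i+1} ⊗ j_a`. -/
abbrev Idx133 : Type := Fin 3 ⊕ (Fin 52 ⊕ (Fin 3 × Fin 26))

/-- The basis `Ψ_A` of the Tits algebra, for a basis `j` of `𝔍'` and a basis `D` of `D(𝔍)`;
`H_L = ad h_L`. -/
noncomputable def Psi (j : Module.Basis (Fin 26) ℝ traceless)
    (D : Module.Basis (Fin 52) ℝ (Der Albert)) : Idx133 → TitsAmbient
  | .inl L => (quatComm (imUnit L), 0, 0)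
  | .inr (.inl I) => (0, (D I : Module.End ℝ Albert), 0)
  | .inr (.inr (i, a)) => (0, 0, imUnit i ⊗ₜ[ℝ] (j a : Albert))

/-- `M` is the family of matrices of the adjoint action in the basis `Ψ`:
`[Ψ_A, Ψ_B] = ∑_C (M_A)^C_B Ψ_C`. -/
def IsAdjointFamily (j : Module.Basis (Fin 26) ℝ traceless)
    (D : Module.Basis (Fin 52) ℝ (Der Albert)) (M : Idx133 → Matrix Idx133 Idx133 ℝ) : Prop :=
  ∀ A B, titsBracket (Psi j D A) (Psi j D B) = ∑ C, M A C B • Psi j D C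

/-! ### The Yokota action -/

/-- `j₁, …, j₂₆` completed by `j₂₇ = √(τ/3) I₃`. -/
noncomputable def jAll (τ : ℝ) (j : Module.Basis (Fin 26) ℝ traceless) : Fin 27 → Albert :=
  Fin.snoc (α := fun _ => Albert) (fun a => (j a : Albert)) (√(τ / 3) • idMat)

/-- The dual basis `ĵ^μ = τ⁻¹ ⟨j_μ, ·⟩` of the `j_μ`, when `⟨j_a, j_b⟩ = τ δ_{ab}`. -/
noncomputable def jDual (τ : ℝ) (j : Module.Basis (Fin 26) ℝ traceless) (μ : Fin 27)
    (x : Albert) : ℝ :=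
  τ⁻¹ * inn (jAll τ j μ) x

/-- The complexified Jordan algebra. -/
abbrev AlbertC : Type := ℂ ⊗[ℝ] Albert

/-- `φ_X = δ - i R_s`, the image of `X = δ + i ⊗ s` (`δ ∈ D(𝔍)`, `s ∈ 𝔍'`) in the
representation **27** of `E₆`. -/
noncomputable def phi (δ : Der Albert) (s : traceless) : AlbertC →ₗ[ℂ] AlbertC :=
  (δ : Module.End ℝ Albert).baseChange ℂ
    - Complex.I • (LinearMap.mulRight ℝ (s : Albert)).baseChange ℂ

/-- The transpose of `φ_X` for the complex bilinear extension of the trace form. -/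
noncomputable def phiT (δ : Der Albert) (s : traceless) : AlbertC →ₗ[ℂ] AlbertC :=
  - (δ : Module.End ℝ Albert).baseChange ℂ
    - Complex.I • (LinearMap.mulRight ℝ (s : Albert)).baseChange ℂ

/-- Complex bilinear extension of the trace form. -/
noncomputable def innC : LinearMap.BilinForm ℂ AlbertC := LinearMap.BilinForm.baseChange ℂ inn

/-- Complex bilinear extension of the Freudenthal product. -/
noncomputable def freudC : AlbertC →ₗ[ℂ] AlbertC →ₗ[ℂ] AlbertC :=
  LinearMap.BilinMap.baseChange ℂ freud

/-- `V₅₆ = (𝔍 ⊕ ℂ)²` (with `𝔍` complexified); a vector is `((x, μ₁), (y, μ₂))`. -/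
abbrev V56 : Type := (AlbertC × ℂ) × (AlbertC × ℂ)

/-- The Yokota action of `X + i ⊗ ν + j ⊗ p + k ⊗ q`, `X = δ + i ⊗ s`, on `V₅₆`; with
`z = q + i p` and `w = -q + i p`,
`x ↦ φ_X x + (i/2)√(τ/3) ν x + w ▷ y + (μ₂/2) z`, `μ₁ ↦ ⟨z, y⟩/2 - (i/2)√(3τ) ν μ₁`,
`y ↦ -φ_Xᵗ y - (i/2)√(τ/3) ν y + z ▷ x + (μ₁/2) w`, `μ₂ ↦ ⟨w, x⟩/2 + (i/2)√(3τ) ν μ₂`. -/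
noncomputable def yokota (τ : ℝ) (δ : Der Albert) (s : traceless) (ν : ℝ) (p q : Albert) :
    V56 →ₗ[ℂ] V56 :=
  let z : AlbertC := 1 ⊗ₜ[ℝ] q + Complex.I ⊗ₜ[ℝ] p
  let w : AlbertC := -(1 ⊗ₜ[ℝ] q) + Complex.I ⊗ₜ[ℝ] p
  let c : ℂ := Complex.I / 2 * (√(τ / 3) : ℝ) * (ν : ℝ)
  let d : ℂ := Complex.I / 2 * (√(3 * τ) : ℝ) * (ν : ℝ)
  { toFun := fun v =>
      ((phi δ s v.1.1 + c • v.1.1 + freudC w v.2.1 + (v.2.2 / 2) • z,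
        1 / 2 * innC z v.2.1 - d * v.1.2),
       (-(phiT δ s v.2.1) - c • v.2.1 + freudC z v.1.1 + (v.1.2 / 2) • w,
        1 / 2 * innC w v.1.1 + d * v.2.2))
    map_add' := fun u v => by
      refine Prod.ext (Prod.ext ?_ ?_) (Prod.ext ?_ ?_)
      · simp only [Prod.fst_add, Prod.snd_add, map_add]; module
      · simp only [Prod.fst_add, Prod.snd_add, map_add]; ring
      · simp only [Prod.fst_add, Prod.snd_add, map_add]; module
      · simp only [Prod.fst_add, Prod.snd_add, map_add]; ring
    map_smul' := fun a v => by
      refine Prod.ext (Prod.ext ?_ ?_) (Prod.ext ?_ ?_)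
      · simp only [Prod.smul_fst, Prod.smul_snd, map_smul, smul_eq_mul, RingHom.id_apply]; module
      · simp only [Prod.smul_fst, Prod.smul_snd, map_smul, smul_eq_mul, RingHom.id_apply]; ring
      · simp only [Prod.smul_fst, Prod.smul_snd, map_smul, smul_eq_mul, RingHom.id_apply]; module
      · simp only [Prod.smul_fst, Prod.smul_snd, map_smul, smul_eq_mul, RingHom.id_apply]; ring }

/-- The operators `Y_A` on `V₅₆` for a basis `j` of `𝔍'` with `⟨j_a, j_b⟩ = τ δ_{ab}`. -/
noncomputable def YOp (τ : ℝ) (j : Module.Basis (Fin 26) ℝ traceless)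
    (D : Module.Basis (Fin 52) ℝ (Der Albert)) : Idx133 → (V56 →ₗ[ℂ] V56)
  | .inl L => ![yokota τ 0 0 1 0 0,
      yokota τ 0 0 0 (jAll τ j (Fin.last 26)) 0, yokota τ 0 0 0 0 (jAll τ j (Fin.last 26))] L
  | .inr (.inl I) => yokota τ (D I) 0 0 0 0
  | .inr (.inr (i, a)) => ![yokota τ 0 (j a) 0 0 0,
      yokota τ 0 0 0 (j a : Albert) 0, yokota τ 0 0 0 0 (j a : Albert)] i

/-! ### The explicit matrices, in the normalization `τ = 2` -/

/-- Labels of the coordinates of `V₅₆`: blocks of sizes 27, 1, 27, 1. -/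
abbrev Idx56 : Type := (Fin 27 ⊕ Unit) ⊕ (Fin 27 ⊕ Unit)

/-- `(C_I)^μ_ν = ĵ^μ (D_I j_ν)`. -/
noncomputable def CMat (j : Module.Basis (Fin 26) ℝ traceless)
    (D : Module.Basis (Fin 52) ℝ (Der Albert)) (I : Fin 52) : Matrix (Fin 27) (Fin 27) ℂ :=
  Matrix.of fun μ ν => (jDual 2 j μ ((D I : Module.End ℝ Albert) (jAll 2 j ν)) : ℂ)

/-- `(C̃_α)^μ_ν = -i ĵ^μ (R_{j_α} j_ν)`. -/
noncomputable def CtMat (j : Module.Basis (Fin 26) ℝ traceless) (α : Fin 27) :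
    Matrix (Fin 27) (Fin 27) ℂ :=
  Matrix.of fun μ ν => -Complex.I * (jDual 2 j μ (jAll 2 j ν * jAll 2 j α) : ℂ)

/-- `A_α`, the matrix of `x ↦ j_α ▷ x` in the basis `j_μ`. -/
noncomputable def AMat (j : Module.Basis (Fin 26) ℝ traceless) (α : Fin 27) :
    Matrix (Fin 27) (Fin 27) ℂ :=
  Matrix.of fun μ ν => (jDual 2 j μ (freud (jAll 2 j α) (jAll 2 j ν)) : ℂ)

/-- `Ĩ = diag (1, …, 1, -2)`. -/
def ITilde : Matrix (Fin 27) (Fin 27) ℂ :=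
  Matrix.diagonal fun μ => if μ = Fin.last 26 then -2 else 1

/-- The canonical basis vector `e_μ` of the 27-dimensional coordinate space. -/
def eVec (μ : Fin 27) : Fin 27 → ℂ := Pi.single μ 1

/-- The block matrix with rows `(P, 0, Q, v)`, `(0, c, vᵗ, 0)`, `(R, w, S, 0)`, `(wᵗ, 0, 0, d)`. -/
def block56 (P Q R S : Matrix (Fin 27) (Fin 27) ℂ) (v w : Fin 27 → ℂ) (c d : ℂ) :
    Matrix Idx56 Idx56 ℂ :=
  Matrix.fromBlocks
    (Matrix.fromBlocks P 0 0 (Matrix.of fun _ _ => c))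
    (Matrix.fromBlocks Q (Matrix.replicateCol Unit v) (Matrix.replicateRow Unit v) 0)
    (Matrix.fromBlocks R (Matrix.replicateCol Unit w) (Matrix.replicateRow Unit w) 0)
    (Matrix.fromBlocks S 0 0 (Matrix.of fun _ _ => d))

/-- `√r` as a complex number. -/
noncomputable def csqrt (r : ℝ) : ℂ := (√r : ℝ)

/-- The 133 matrices `Y_A`. -/
noncomputable def Y (j : Module.Basis (Fin 26) ℝ traceless)
    (D : Module.Basis (Fin 52) ℝ (Der Albert)) : Idx133 → Matrix Idx56 Idx56 ℂ
  | .inl L =>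
    ![block56 ((Complex.I / csqrt 6) • 1) 0 0 (-(Complex.I / csqrt 6) • 1) 0 0
        (-Complex.I * csqrt (3 / 2)) (Complex.I * csqrt (3 / 2)),
      (1 / 2 : ℂ) • block56 0 (-(Complex.I * csqrt (2 / 3)) • ITilde)
        (-(Complex.I * csqrt (2 / 3)) • ITilde) 0
        ((Complex.I * csqrt 2) • eVec (Fin.last 26)) ((Complex.I * csqrt 2) • eVec (Fin.last 26))
        0 0,
      (1 / 2 : ℂ) • block56 0 (csqrt (2 / 3) • ITilde) (-csqrt (2 / 3) • ITilde) 0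
        (csqrt 2 • eVec (Fin.last 26)) (-csqrt 2 • eVec (Fin.last 26)) 0 0] L
  | .inr (.inl I) => block56 (CMat j D I) 0 0 (-(CMat j D I).transpose) 0 0 0 0
  | .inr (.inr (i, a)) =>
    ![block56 (CtMat j a.castSucc) 0 0 (-(CtMat j a.castSucc).transpose) 0 0 0 0,
      (1 / 2 : ℂ) • block56 0 ((2 * Complex.I) • AMat j a.castSucc)
        ((2 * Complex.I) • AMat j a.castSucc) 0
        ((Complex.I * csqrt 2) • eVec a.castSucc) ((Complex.I * csqrt 2) • eVec a.castSucc) 0 0,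
      (1 / 2 : ℂ) • block56 0 ((-2 : ℂ) • AMat j a.castSucc) ((2 : ℂ) • AMat j a.castSucc) 0
        (csqrt 2 • eVec a.castSucc) (-csqrt 2 • eVec a.castSucc) 0 0] i

/-- The vector of `V₅₆` with given coordinates: `x = ∑ x^μ j_μ` and `y = ∑ y^μ j_μ` in the two
copies of `𝔍`, and `√2 μ₁`, `√2 μ₂` in the two copies of `ℂ`. -/
noncomputable def toV56 (j : Module.Basis (Fin 26) ℝ traceless) (v : Idx56 → ℂ) : V56 :=
  ((∑ μ, v (.inl (.inl μ)) ⊗ₜ[ℝ] jAll 2 j μ, csqrt 2 * v (.inl (.inr ()))),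
   (∑ μ, v (.inr (.inl μ)) ⊗ₜ[ℝ] jAll 2 j μ, csqrt 2 * v (.inr (.inr ()))))

end E7Rep

open E7Rep E7Rep.Albert

/-! The identity element of `𝔍` absorbs `D(ℍ)`. Since `D(ℍ) = ad ℍ'`, letting `h ⊗ I₃` stand for `ad
h / 2` identifies the Tits algebra with `TKK = D(𝔍) ⊕ (ℍ' ⊗ 𝔍)`, whose bracket is `[h ⊗ x, h' ⊗ y] =
½ [h, h'] ⊗ (x ∘ y) - ⟨h, h'⟩ [L_x, L_y]`. There the Jacobi identity needs only commutativity of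
`∘`, the fact that `[L_x, L_y]` is a derivation, and the cyclic relation for `[L_x, L_{y ∘ z}]`. The
last two are forms of the linearized Jordan identity.

The Jordan identity itself comes from the cubic norm. Alternativity and the Moufang law for
octonions give `x ∘ (x ▷ x) = det(x) I₃` (`mul_freud_self`) and the adjoint identity for `▷`
(`freud_self_freud_self`). Their polarizations show that `L_x` commutes with `L_{x ▷ x}`. The
resulting formula `freud_freud` for `w ▷ (z ▷ x)` also governs the trace forms and the
56-dimensional module.

Compactness and simplicity of `TKK`: minus the trace form on `D(𝔍)` plus three times `⟨·,·⟩` is an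
invariant inner product, so every `ad X` is skew. The centre is zero, hence the Killing form is
negative definite. Simplicity reduces to that of `𝔍` together with the fact that derivations are
inner. The dimension is `52 + 3 · 27`, where 52 is obtained from the Peirce decomposition.

On `V₅₆` there are operators `derOp`, `mulOp`, `raise` and `lower` with a closed commutator table,
the key entry being `[raise z, lower w] = ½ (mulOp (z ∘ w) + derOp [L_z, L_w])`. Then `h₁ ⊗ x ↦ -i
mulOp x`, `h₂ ⊗ x ↦ i (raise x + lower x)`, `h₃ ⊗ x ↦ raise x - lower x` is a representation, and
Yokota's action is exactly this one (`yokota_eq_rep`). Both commutation tables are images of one set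
of structure constants (`map_lie_eq_sum_adMatrix`). Irreducibility holds because `mulOp I₃`
separates the four summands of `V₅₆`, which `raise` and `lower` connect. The explicit matrices and
their components are the same operators in the coordinates `j_μ`. -/

set_option linter.unusedSimpArgs false

namespace E7Rep

/-! ### Octonion identities in real coordinates -/

namespace Octonion

theorem ext_coords {x y : Octonion} (h0 : x.1.re = y.1.re) (h1 : x.1.imI = y.1.imI)
    (h2 : x.1.imJ = y.1.imJ) (h3 : x.1.imK = y.1.imK) (h4 : x.2.re = y.2.re)
    (h5 : x.2.imI = y.2.imI) (h6 : x.2.imJ = y.2.imJ) (h7 : x.2.imK = y.2.imK) : x = y :=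
  ext' (Quaternion.ext _ _ h0 h1 h2 h3) (Quaternion.ext _ _ h4 h5 h6 h7)

@[simp] theorem sub_fst (x y : Octonion) : (x - y).1 = x.1 - y.1 := rfl
@[simp] theorem sub_snd (x y : Octonion) : (x - y).2 = x.2 - y.2 := rfl
@[simp] theorem neg_fst (x : Octonion) : (-x).1 = -x.1 := rfl
@[simp] theorem neg_snd (x : Octonion) : (-x).2 = -x.2 := rfl

theorem re_apply (x : Octonion) : re x = x.1.re := rfl

/-- The inner product `Re (x ȳ)`. -/
noncomputable def dot : LinearMap.BilinForm ℝ Octonion :=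
  LinearMap.mk₂ ℝ (fun x y => re (x * star y))
    (fun x y z => by simp [add_mul]) (fun c x y => by rw [smul_mul_assoc, map_smul])
    (fun x y z => by simp [mul_add])
    (fun c x y => by rw [star_smul, star_trivial, mul_smul_comm, map_smul])

theorem dot_apply (x y : Octonion) : dot x y = re (x * star y) := rfl

theorem dot_eq (x y : Octonion) : dot x y =
    x.1.re * y.1.re + x.1.imI * y.1.imI + x.1.imJ * y.1.imJ + x.1.imK * y.1.imK
    + x.2.re * y.2.re + x.2.imI * y.2.imI + x.2.imJ * y.2.imJ + x.2.imK * y.2.imK := by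
  simp only [dot_apply, re_apply, mul_fst, star_fst, star_snd, star_neg, Quaternion.re_sub,
    Quaternion.re_mul, Quaternion.re_neg, Quaternion.imI_neg, Quaternion.imJ_neg,
    Quaternion.imK_neg, Quaternion.re_star, Quaternion.imI_star, Quaternion.imJ_star,
    Quaternion.imK_star]
  ring

theorem dot_comm (x y : Octonion) : dot x y = dot y x := by
  simp only [dot_eq]; ring

theorem dot_star_star (x y : Octonion) : dot (star x) (star y) = dot x y := by
  simp only [dot_eq, star_fst, star_snd, Quaternion.re_neg, Quaternion.imI_neg, Quaternion.imJ_neg,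
    Quaternion.imK_neg, Quaternion.re_star, Quaternion.imI_star, Quaternion.imJ_star,
    Quaternion.imK_star]
  ring

theorem dot_self_nonneg (x : Octonion) : 0 ≤ dot x x := by
  rw [dot_eq]
  nlinarith [sq_nonneg x.1.re, sq_nonneg x.1.imI, sq_nonneg x.1.imJ, sq_nonneg x.1.imK,
    sq_nonneg x.2.re, sq_nonneg x.2.imI, sq_nonneg x.2.imJ, sq_nonneg x.2.imK]

theorem dot_self_eq_zero {x : Octonion} (h : dot x x = 0) : x = 0 := by
  rw [dot_eq] at h
  apply ext_coords <;> simp only [zero_fst, zero_snd, Quaternion.re_zero, Quaternion.imI_zero,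
    Quaternion.imJ_zero, Quaternion.imK_zero] <;>
  nlinarith [sq_nonneg x.1.re, sq_nonneg x.1.imI, sq_nonneg x.1.imJ, sq_nonneg x.1.imK,
    sq_nonneg x.2.re, sq_nonneg x.2.imI, sq_nonneg x.2.imJ, sq_nonneg x.2.imK]

/-- Both sides are values of the cyclically invariant form `Re (c (a b)) = Re (a (b c))`. This is
what makes the octonionic part of the cubic norm independent of the index that is singled out. -/
theorem dot_star_mul (a b c : Octonion) : dot (star (a * b)) c = dot (star (b * c)) a := by
  simp only [dot_eq, mul_fst, mul_snd, star_fst, star_snd, Quaternion.re_sub,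
    Quaternion.re_mul, Quaternion.re_neg, Quaternion.imI_neg, Quaternion.imJ_neg,
    Quaternion.imK_neg, Quaternion.re_star, Quaternion.imI_star, Quaternion.imJ_star,
    Quaternion.imK_star, Quaternion.imI_sub, Quaternion.imJ_sub, Quaternion.imK_sub,
    Quaternion.imI_mul, Quaternion.imJ_mul, Quaternion.imK_mul, Quaternion.re_add,
    Quaternion.imI_add, Quaternion.imJ_add, Quaternion.imK_add]
  ring

theorem dot_mul_self (a b : Octonion) : dot (a * b) (a * b) = dot a a * dot b b := by
  simp only [dot_eq, mul_fst, mul_snd, star_fst, star_snd, Quaternion.re_sub,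
    Quaternion.re_mul, Quaternion.re_neg, Quaternion.imI_neg, Quaternion.imJ_neg,
    Quaternion.imK_neg, Quaternion.re_star, Quaternion.imI_star, Quaternion.imJ_star,
    Quaternion.imK_star, Quaternion.imI_sub, Quaternion.imJ_sub, Quaternion.imK_sub,
    Quaternion.imI_mul, Quaternion.imJ_mul, Quaternion.imK_mul, Quaternion.re_add,
    Quaternion.imI_add, Quaternion.imJ_add, Quaternion.imK_add]
  ring

/-- The alternative law `ā (a b) = |a|² b`. The outer conjugation matches the shape of the
off-diagonal entries of a Jordan product; the next lemma is the right-hand version. -/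
theorem star_star_mul_mul (a b : Octonion) : star (star (a * b) * a) = dot a a • b := by
  apply ext_coords <;>
  simp only [dot_eq, mul_fst, mul_snd, star_fst, star_snd, Quaternion.re_sub,
    Quaternion.re_mul, Quaternion.re_neg, Quaternion.imI_neg, Quaternion.imJ_neg,
    Quaternion.imK_neg, Quaternion.re_star, Quaternion.imI_star, Quaternion.imJ_star,
    Quaternion.imK_star, Quaternion.imI_sub, Quaternion.imJ_sub, Quaternion.imK_sub,
    Quaternion.imI_mul, Quaternion.imJ_mul, Quaternion.imK_mul, Quaternion.re_add,
    Quaternion.imI_add, Quaternion.imJ_add, Quaternion.imK_add, smul_fst, smul_snd,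
    Quaternion.re_smul, Quaternion.imI_smul, Quaternion.imJ_smul, Quaternion.imK_smul,
    smul_eq_mul] <;>
  ring

theorem star_mul_star_mul (a b : Octonion) : star (b * star (a * b)) = dot b b • a := by
  apply ext_coords <;>
  simp only [dot_eq, mul_fst, mul_snd, star_fst, star_snd, Quaternion.re_sub,
    Quaternion.re_mul, Quaternion.re_neg, Quaternion.imI_neg, Quaternion.imJ_neg,
    Quaternion.imK_neg, Quaternion.re_star, Quaternion.imI_star, Quaternion.imJ_star,
    Quaternion.imK_star, Quaternion.imI_sub, Quaternion.imJ_sub, Quaternion.imK_sub,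
    Quaternion.imI_mul, Quaternion.imJ_mul, Quaternion.imK_mul, Quaternion.re_add,
    Quaternion.imI_add, Quaternion.imJ_add, Quaternion.imK_add, smul_fst, smul_snd,
    Quaternion.re_smul, Quaternion.imI_smul, Quaternion.imJ_smul, Quaternion.imK_smul,
    smul_eq_mul] <;>
  ring

/-- A form of the middle Moufang identity. -/
theorem moufang (a b c : Octonion) :
    star (star (c * a) * star (a * b)) =
      (2 * dot (star (b * c)) a) • a - dot a a • star (b * c) := by
  apply ext_coords <;>
  simp only [dot_eq, mul_fst, mul_snd, star_fst, star_snd, Quaternion.re_sub,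
    Quaternion.re_mul, Quaternion.re_neg, Quaternion.imI_neg, Quaternion.imJ_neg,
    Quaternion.imK_neg, Quaternion.re_star, Quaternion.imI_star, Quaternion.imJ_star,
    Quaternion.imK_star, Quaternion.imI_sub, Quaternion.imJ_sub, Quaternion.imK_sub,
    Quaternion.imI_mul, Quaternion.imJ_mul, Quaternion.imK_mul, Quaternion.re_add,
    Quaternion.imI_add, Quaternion.imJ_add, Quaternion.imK_add, smul_fst, smul_snd,
    Quaternion.re_smul, Quaternion.imI_smul, Quaternion.imJ_smul, Quaternion.imK_smul,
    smul_eq_mul, sub_fst, sub_snd] <;>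
  ring

end Octonion


/-! ### Cyclic indices modulo 3 -/

theorem fin3_add11 (i : Fin 3) : i + 1 + 1 = i + 2 := by revert i; decide
theorem fin3_add12 (i : Fin 3) : i + 1 + 2 = i := by revert i; decide
theorem fin3_add21 (i : Fin 3) : i + 2 + 1 = i := by revert i; decide
theorem fin3_add22 (i : Fin 3) : i + 2 + 2 = i + 1 := by revert i; decide
theorem fin3_ne_add1 (i : Fin 3) : i ≠ i + 1 := by revert i; decide
theorem fin3_ne_add2 (i : Fin 3) : i ≠ i + 2 := by revert i; decide
theorem fin3_add1_ne_add2 (i : Fin 3) : i + 1 ≠ i + 2 := by revert i; decide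
theorem fin3_cases (i k : Fin 3) : k = i ∨ k = i + 1 ∨ k = i + 2 := by revert i k; decide

/-- Rotating the summation to start at an arbitrary `i` lets each entrywise identity be proved once,
for a symbolic index. -/
theorem fin3_sum {M : Type*} [AddCommMonoid M] (f : Fin 3 → M) (i : Fin 3) :
    ∑ k, f k = f i + f (i + 1) + f (i + 2) := by
  fin_cases i
  · simp [Fin.sum_univ_three]
  · rw [Fin.sum_univ_three]
    show f 0 + f 1 + f 2 = f 1 + f 2 + f 0
    abel
  · rw [Fin.sum_univ_three]
    show f 0 + f 1 + f 2 = f 2 + f 0 + f 1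
    abel

namespace Octonion

theorem dot_smul_one_left (r : ℝ) (x : Octonion) : re (r • (1 : Octonion) * x) = r * re x := by
  rw [smul_mul_assoc, one_mul, map_smul, smul_eq_mul]

theorem re_star (x : Octonion) : re (star x) = re x := by simp [re_apply]

theorem re_one : re 1 = 1 := by simp [re_apply]

theorem eq_re_of_star_eq {x : Octonion} (h : star x = x) : x = re x • (1 : Octonion) := by
  have e (f : Octonion → ℝ) : f (star x) = f x := by rw [h]
  have h1 := e fun x => x.1.imI
  have h2 := e fun x => x.1.imJ
  have h3 := e fun x => x.1.imK
  have h4 := e fun x => x.2.re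
  have h5 := e fun x => x.2.imI
  have h6 := e fun x => x.2.imJ
  have h7 := e fun x => x.2.imK
  simp only [star_fst, star_snd, Quaternion.re_neg, Quaternion.imI_neg, Quaternion.imJ_neg,
    Quaternion.imK_neg, Quaternion.imI_star, Quaternion.imJ_star, Quaternion.imK_star]
    at h1 h2 h3 h4 h5 h6 h7
  apply ext_coords <;> simp [re_apply] <;> linarith

end Octonion

open Octonion

/-! ### Entries, trace form and Freudenthal product -/

namespace Albert

/-- The `i`-th diagonal entry. -/
noncomputable def dg (i : Fin 3) : Albert →ₗ[ℝ] ℝ where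
  toFun x := re (toMatrix x i i)
  map_add' x y := by simp
  map_smul' c x := by simp

/-- The off-diagonal entry opposite to the `i`-th diagonal entry. -/
noncomputable def od (i : Fin 3) : Albert →ₗ[ℝ] Octonion where
  toFun x := toMatrix x (i + 1) (i + 2)
  map_add' x y := by simp
  map_smul' c x := by simp

theorem toMatrix_star (x : Albert) (p q : Fin 3) : star (toMatrix x q p) = toMatrix x p q := by
  conv_rhs => rw [← conjTranspose_toMatrix]
  rfl

theorem toMatrix_self (x : Albert) (i : Fin 3) : toMatrix x i i = dg i x • (1 : Octonion) :=
  eq_re_of_star_eq (toMatrix_star x i i)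

theorem toMatrix_add1_add2 (x : Albert) (i : Fin 3) : toMatrix x (i + 1) (i + 2) = od i x := rfl

theorem toMatrix_add2_add1 (x : Albert) (i : Fin 3) :
    toMatrix x (i + 2) (i + 1) = star (od i x) := (toMatrix_star x _ _).symm

theorem toMatrix_add1 (x : Albert) (i : Fin 3) : toMatrix x i (i + 1) = od (i + 2) x := by
  rw [← toMatrix_add1_add2, fin3_add21, fin3_add22]

theorem toMatrix_add2 (x : Albert) (i : Fin 3) : toMatrix x i (i + 2) = star (od (i + 1) x) := by
  rw [← toMatrix_add2_add1, fin3_add11, fin3_add12]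

theorem toMatrix_add1' (x : Albert) (i : Fin 3) : toMatrix x (i + 1) i = star (od (i + 2) x) := by
  rw [← toMatrix_add1, toMatrix_star]

theorem toMatrix_add2' (x : Albert) (i : Fin 3) : toMatrix x (i + 2) i = od (i + 1) x := by
  rw [← toMatrix_star, toMatrix_add2, star_star]

theorem ext_coords {x y : Albert} (hd : ∀ i, dg i x = dg i y) (ho : ∀ i, od i x = od i y) :
    x = y := by
  apply toMatrix_injective
  ext1 p q
  rcases fin3_cases p q with rfl | rfl | rfl
  · rw [toMatrix_self, toMatrix_self, hd]
  · rw [toMatrix_add1, toMatrix_add1, ho]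
  · rw [toMatrix_add2, toMatrix_add2, ho]

/-- The Hermitian matrix with given diagonal and off-diagonal entries. -/
noncomputable def mk (α : Fin 3 → ℝ) (a : Fin 3 → Octonion) : Albert :=
  ⟨Matrix.of fun p q => if q = p then α p • (1 : Octonion) else
    if q = p + 1 then a (p + 2) else star (a (p + 1)), by
    show Matrix.conjTranspose _ = _
    ext1 p q
    rw [Matrix.conjTranspose_apply, Matrix.of_apply, Matrix.of_apply]
    rcases fin3_cases p q with rfl | rfl | rfl
    · simp
    · rw [if_neg (fin3_ne_add1 p), if_neg (fin3_ne_add1 p).symm, if_pos rfl, fin3_add11,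
        if_neg (fin3_ne_add2 p), star_star]
    · rw [if_neg (fin3_ne_add2 p), if_neg (fin3_ne_add2 p).symm, if_neg (fin3_add1_ne_add2 p).symm,
        fin3_add21, if_pos rfl, fin3_add22]⟩

@[simp] theorem dg_mk (α : Fin 3 → ℝ) (a : Fin 3 → Octonion) (i : Fin 3) :
    dg i (mk α a) = α i := by
  show re (if i = i then _ else _) = _
  rw [if_pos rfl, map_smul, re_one, smul_eq_mul, mul_one]

@[simp] theorem od_mk (α : Fin 3 → ℝ) (a : Fin 3 → Octonion) (i : Fin 3) :
    od i (mk α a) = a i := by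
  show (if i + 2 = i + 1 then _ else if i + 2 = i + 1 + 1 then _ else _) = _
  rw [if_neg (fin3_add1_ne_add2 i).symm, fin3_add11, if_pos rfl, fin3_add12]

theorem dg_mul (i : Fin 3) (x y : Albert) : dg i (x * y) =
    dg i x * dg i y + dot (od (i + 1) x) (od (i + 1) y) + dot (od (i + 2) x) (od (i + 2) y) := by
  show re (toMatrix (x * y) i i) = _
  rw [toMatrix_mul, Matrix.smul_apply, Matrix.add_apply, Matrix.mul_apply, Matrix.mul_apply,
    fin3_sum _ i, fin3_sum _ i]
  simp only [toMatrix_self, toMatrix_add1, toMatrix_add2, toMatrix_add1', toMatrix_add2',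
    map_smul, map_add, ← dot_apply, dot_smul_one_left, re_one, smul_eq_mul]
  have h (a b : Octonion) : re (star a * b) = dot a b := by
    rw [← dot_star_star, dot_apply, star_star]
  rw [h, h, dot_comm (od (i + 2) y), dot_comm (od (i + 1) y)]
  ring

/-- The entry labelled `i` sits in position `(i + 1, i + 2)`, and the path through the index `i`
meets the other two entries conjugated; hence the outer `star` on their products. -/
theorem od_mul (i : Fin 3) (x y : Albert) : od i (x * y) =
    (1 / 2 : ℝ) • ((dg (i + 1) x + dg (i + 2) x) • od i y + (dg (i + 1) y + dg (i + 2) y) • od i x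
      + star (od (i + 1) x * od (i + 2) y) + star (od (i + 1) y * od (i + 2) x)) := by
  show toMatrix (x * y) (i + 1) (i + 2) = _
  rw [toMatrix_mul, Matrix.smul_apply, Matrix.add_apply, Matrix.mul_apply, Matrix.mul_apply,
    fin3_sum _ i, fin3_sum _ i]
  simp only [toMatrix_self, toMatrix_add1, toMatrix_add2, toMatrix_add1', toMatrix_add2',
    toMatrix_add1_add2, smul_mul_assoc, mul_smul_comm, one_mul, mul_one, ← star_mul]
  module

theorem tr_eq (x : Albert) (i : Fin 3) : tr x = dg i x + dg (i + 1) x + dg (i + 2) x := by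
  show ∑ k, re (toMatrix x k k) = _
  exact fin3_sum (fun k => dg k x) i

@[simp] theorem dg_idMat (i : Fin 3) : dg i idMat = 1 := by
  show re ((1 : Matrix (Fin 3) (Fin 3) Octonion) i i) = 1
  rw [Matrix.one_apply_eq, re_one]

@[simp] theorem od_idMat (i : Fin 3) : od i idMat = 0 := by
  show (1 : Matrix (Fin 3) (Fin 3) Octonion) (i + 1) (i + 2) = 0
  rw [Matrix.one_apply_ne (fin3_add1_ne_add2 i)]

theorem idMat_mul (x : Albert) : idMat * x = x := by
  apply ext_coords <;> intro i
  · rw [dg_mul]; simp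
  · rw [od_mul]; simp only [dg_idMat, od_idMat, zero_mul, mul_zero, star_zero]; module

theorem mul_idMat (x : Albert) : x * idMat = x := by rw [mul_comm, idMat_mul]

@[simp] theorem tr_idMat : tr idMat = 3 := by
  rw [tr_eq _ 0]; simp; norm_num

theorem inn_apply (x y : Albert) : inn x y = tr (x * y) := rfl

theorem inn_eq (x y : Albert) :
    inn x y = ∑ i, (dg i x * dg i y + 2 * dot (od i x) (od i y)) := by
  rw [inn_apply, tr_eq _ 0, fin3_sum _ 0]
  simp only [dg_mul, fin3_add11, fin3_add12, fin3_add21, fin3_add22]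
  ring

theorem inn_comm (x y : Albert) : inn x y = inn y x := by
  rw [inn_apply, inn_apply, mul_comm]

theorem inn_idMat_left (x : Albert) : inn idMat x = tr x := by rw [inn_apply, idMat_mul]
theorem inn_idMat_right (x : Albert) : inn x idMat = tr x := by rw [inn_apply, mul_idMat]

theorem inn_self_nonneg (x : Albert) : 0 ≤ inn x x := by
  rw [inn_eq]
  exact Finset.sum_nonneg fun i _ => add_nonneg (mul_self_nonneg _)
    (mul_nonneg zero_le_two (dot_self_nonneg _))

theorem inn_self_eq_zero {x : Albert} (h : inn x x = 0) : x = 0 := by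
  rw [inn_eq, Finset.sum_eq_zero_iff_of_nonneg (fun i _ => add_nonneg (mul_self_nonneg _)
    (mul_nonneg zero_le_two (dot_self_nonneg _)))] at h
  apply ext_coords <;> intro i
  · have := h i (Finset.mem_univ i)
    rw [map_zero]
    nlinarith [dot_self_nonneg (od i x), mul_self_nonneg (dg i x)]
  · have := h i (Finset.mem_univ i)
    rw [map_zero]
    exact dot_self_eq_zero (by nlinarith [dot_self_nonneg (od i x), mul_self_nonneg (dg i x)])

theorem inn_self_pos {x : Albert} (h : x ≠ 0) : 0 < inn x x :=
  lt_of_le_of_ne (inn_self_nonneg x) fun h' => h (inn_self_eq_zero h'.symm)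

theorem eq_of_inn {x y : Albert} (h : ∀ z, inn x z = inn y z) : x = y := by
  rw [← sub_eq_zero]
  apply inn_self_eq_zero
  rw [LinearMap.map_sub₂, h, sub_self]

/-- Terms with a diagonal factor match by symmetry of `dot`; the purely octonionic terms match by
cyclicity of `Re (a b c)`. -/
theorem inn_mul (x y z : Albert) : inn (x * y) z = inn x (y * z) := by
  have key (i : Fin 3) : ∑ i, (dg i (x * y) * dg i z + 2 * dot (od i (x * y)) (od i z)) =
      ∑ i, (dg i x * dg i (y * z) + 2 * dot (od i x) (od i (y * z))) := by
    rw [fin3_sum _ i, fin3_sum _ i]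
    simp only [dg_mul, od_mul, fin3_add11, fin3_add12, fin3_add21, fin3_add22, map_add, map_smul,
      LinearMap.add_apply, LinearMap.smul_apply, smul_eq_mul]
    have e (i : Fin 3) : dot (od i x) (star (od (i + 1) y * od (i + 2) z)) =
        dot (star (od i x * od (i + 1) y)) (od (i + 2) z) := by
      rw [dot_comm, dot_star_mul (od i x)]
    have e' (i : Fin 3) : dot (od i x) (star (od (i + 1) z * od (i + 2) y)) =
        dot (star (od (i + 2) y * od i x)) (od (i + 1) z) := by
      rw [dot_comm, ← dot_star_mul, ← dot_star_mul]
    have h0 := e i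
    have h1 := e (i + 1)
    have h2 := e (i + 2)
    have h0' := e' i
    have h1' := e' (i + 1)
    have h2' := e' (i + 2)
    simp only [fin3_add11, fin3_add12, fin3_add21, fin3_add22] at h0 h1 h2 h0' h1' h2'
    rw [h0, h1, h2, h0', h1', h2']
    ring
  rw [inn_eq, inn_eq, key 0]

theorem tr_mul_mul (x y z : Albert) : tr (x * y * z) = tr (x * (y * z)) := inn_mul x y z

theorem freud_apply (x y : Albert) : freud x y = x * y - (1 / 2 : ℝ) • tr x • y
    - (1 / 2 : ℝ) • tr y • x + (1 / 2 : ℝ) • (tr x * tr y) • idMat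
    - (1 / 2 : ℝ) • tr (x * y) • idMat := rfl

theorem freud_comm (x y : Albert) : freud x y = freud y x := by
  rw [freud_apply, freud_apply, mul_comm y x]; module

theorem inn_freud (x y z : Albert) : inn (freud x y) z = 3 * det x y z := by
  simp only [freud_apply, map_sub, map_add, map_smul, LinearMap.sub_apply, LinearMap.add_apply,
    LinearMap.smul_apply, inn_idMat_left, smul_eq_mul, det]
  simp only [inn_apply]
  ring

theorem det_comm12 (x y z : Albert) : det x y z = det y x z := by
  simp only [det, mul_comm y x]; ring

theorem det_comm23 (x y z : Albert) : det x y z = det x z y := by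
  simp only [det, tr_mul_mul, mul_comm z y]; ring

theorem inn_freud_right (x y z : Albert) : inn (freud x y) z = inn y (freud x z) := by
  rw [inn_comm y, inn_freud, inn_freud, det_comm23]

theorem dg_freud_self (i : Fin 3) (x : Albert) : dg i (freud x x) =
    dg (i + 1) x * dg (i + 2) x - dot (od i x) (od i x) := by
  simp only [freud_apply, map_sub, map_add, map_smul, dg_idMat, smul_eq_mul, tr_eq _ i, dg_mul,
    fin3_add11, fin3_add12, fin3_add21, fin3_add22]
  ring

theorem od_freud_self (i : Fin 3) (x : Albert) : od i (freud x x) =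
    star (od (i + 1) x * od (i + 2) x) - dg i x • od i x := by
  simp only [freud_apply, map_sub, map_add, map_smul, od_idMat, tr_eq _ i, od_mul]
  module

end Albert


open Octonion

/-! ### Cubic norm, adjoint identities and the Jordan identity -/

namespace Albert

theorem det_self_eq (i : Fin 3) (x : Albert) : det x x x =
    dg i x * dg (i + 1) x * dg (i + 2) x - dg i x * dot (od i x) (od i x)
    - dg (i + 1) x * dot (od (i + 1) x) (od (i + 1) x)
    - dg (i + 2) x * dot (od (i + 2) x) (od (i + 2) x)
    + 2 * dot (star (od (i + 1) x * od (i + 2) x)) (od i x) := by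
  have h := inn_freud x x x
  rw [inn_eq, fin3_sum _ i] at h
  simp only [dg_freud_self, od_freud_self, fin3_add11, fin3_add12, fin3_add21, fin3_add22, map_sub,
    LinearMap.sub_apply, map_smul, LinearMap.smul_apply, smul_eq_mul] at h
  have h1 := dot_star_mul (od (i + 1) x) (od (i + 2) x) (od i x)
  have h2 := dot_star_mul (od (i + 2) x) (od i x) (od (i + 1) x)
  linarith

/-- The entries of `x ▷ x` are the cofactors of `x`, so this is the Cayley–Hamilton identity. The
diagonal uses cyclicity of `Re (a b c)`, the off-diagonal part the alternative laws. -/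
theorem mul_freud_self (x : Albert) : x * freud x x = det x x x • idMat := by
  apply ext_coords <;> intro i
  · rw [dg_mul, map_smul, dg_idMat, det_self_eq i]
    simp only [dg_freud_self, od_freud_self, fin3_add11, fin3_add12, fin3_add21, fin3_add22,
      map_sub, map_smul, smul_eq_mul]
    have h1 := dot_star_mul (od (i + 1) x) (od (i + 2) x) (od i x)
    have h2 := dot_star_mul (od (i + 2) x) (od i x) (od (i + 1) x)
    rw [dot_comm (od (i + 1) x) (star _), dot_comm (od (i + 2) x) (star _)]
    linarith
  · rw [od_mul, map_smul, od_idMat, smul_zero]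
    simp only [dg_freud_self, od_freud_self, fin3_add11, fin3_add12, fin3_add21, fin3_add22,
      mul_sub, sub_mul, star_sub, star_star_mul_mul, star_mul_star_mul, mul_smul_comm,
      smul_mul_assoc, star_smul, star_trivial]
    module

/-- The adjoint identity: taking cofactors twice multiplies by the norm. The diagonal needs `|a b| =
|a| |b|`, and the off-diagonal entries need the Moufang identity. -/
theorem freud_self_freud_self (x : Albert) :
    freud (freud x x) (freud x x) = det x x x • x := by
  apply ext_coords <;> intro i
  · rw [dg_freud_self, map_smul, det_self_eq i]
    simp only [dg_freud_self, od_freud_self, fin3_add11, fin3_add12, fin3_add21, fin3_add22,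
      map_sub, map_smul, smul_eq_mul, LinearMap.sub_apply, LinearMap.smul_apply]
    rw [dot_star_star, dot_mul_self, dot_comm (od i x) (star _)]
    ring
  · rw [od_freud_self, map_smul, det_self_eq i]
    simp only [dg_freud_self, od_freud_self, fin3_add11, fin3_add12, fin3_add21, fin3_add22,
      mul_sub, sub_mul, star_sub, star_star_mul_mul, star_mul_star_mul, mul_smul_comm,
      smul_mul_assoc, star_smul, star_trivial, moufang]
    module

/-- The linear coefficient of a vanishing quartic polynomial vanishes. -/
theorem eq_zero_of_quartic {W : Type*} [AddCommGroup W] [Module ℝ W] (c0 c1 c2 c3 c4 : W)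
    (h : ∀ t : ℝ, c0 + t • c1 + t ^ 2 • c2 + t ^ 3 • c3 + t ^ 4 • c4 = 0) : c1 = 0 := by
  have h1 := h 1
  have h2 := h (-1)
  have h3 := h 2
  have h4 := h (-2)
  -- The five-point central difference formula for the derivative at 0, exact on quartics.
  linear_combination (norm := module) (2 / 3 : ℝ) • h1 - (2 / 3 : ℝ) • h2 - (1 / 12 : ℝ) • h3
    + (1 / 12 : ℝ) • h4

theorem inn_freud_rotate (x y z : Albert) : inn (freud x y) z = inn (freud y z) x := by
  rw [inn_freud_right, inn_comm, freud_comm x z, inn_freud_right, inn_comm, freud_comm z y]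

theorem inn_freud_left_self (x y : Albert) : inn (freud x y) x = inn (freud x x) y :=
  (inn_freud_rotate x x y).symm

theorem inn_freud_right_self (x y : Albert) : inn (freud x y) y = inn (freud y y) x :=
  inn_freud_rotate x y y

/-- The polarized Cayley–Hamilton identity. -/
theorem mul_freud_cyclic (x y z : Albert) :
    x * freud y z + y * freud z x + z * freud x y = inn (freud x y) z • idMat := by
  have h (x : Albert) : x * freud x x = (1 / 3 * inn (freud x x) x) • idMat := by
    rw [mul_freud_self, inn_freud]; module
  have e1 := h (x + y + z)
  have e2 := h (x + y)
  have e3 := h (y + z)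
  have e4 := h (x + z)
  simp only [map_add, LinearMap.add_apply, mul_add, add_mul] at e1 e2 e3 e4
  simp only [freud_comm y x, freud_comm z y, freud_comm z x,
    inn_freud_left_self x y, inn_freud_left_self x z, inn_freud_left_self y z,
    inn_freud_right_self x y, inn_freud_right_self x z, inn_freud_right_self y z,
    ← inn_freud_rotate x y z, show inn (freud x z) y = inn (freud x y) z by
      rw [← inn_freud_rotate, freud_comm]] at e1 e2 e3 e4 ⊢
  have e5 := h x
  have e6 := h y
  have e7 := h z
  -- Inclusion–exclusion isolates the part linear in each of `x, y, z`; every product occurs twice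
  -- there because `▷` is symmetric.
  linear_combination (norm := module) (1 / 2 : ℝ) • (e1 - e2 - e3 - e4 + e5 + e6 + e7)

/-- The polarized Cayley–Hamilton identity with `▷` expanded: it trades the cyclic sum of triple
Jordan products for terms of lower degree. -/
theorem mul_mul_cyclic (x y z : Albert) :
    x * (y * z) + y * (x * z) + z * (x * y) =
      tr x • (y * z) + tr y • (x * z) + tr z • (x * y)
      + (1 / 2 : ℝ) • ((tr (y * z) - tr y * tr z) • x + (tr (x * z) - tr x * tr z) • y
        + (tr (x * y) - tr x * tr y) • z) + (3 * det x y z) • idMat := by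
  have h := mul_freud_cyclic x y z
  rw [inn_freud] at h
  simp only [freud_apply, mul_add, mul_sub, mul_smul_comm, mul_idMat] at h
  rw [mul_comm z x, mul_comm z y, mul_comm y x] at h
  linear_combination (norm := module) h

/-- Multiplications are derivations of the Freudenthal product up to the trace. -/
theorem mul_freud (a x y : Albert) :
    a * freud x y + freud (a * x) y + freud x (a * y) = tr a • freud x y := by
  have h := mul_mul_cyclic a x y
  have t1 : tr (x * (a * y)) = tr (a * x * y) := by rw [← tr_mul_mul, mul_comm x a]
  simp only [freud_apply, mul_add, mul_sub, mul_smul_comm, mul_idMat, t1]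
  rw [mul_comm (a * x) y] at *
  rw [det, mul_comm (a * x) y] at h
  linear_combination (norm := module) h

/-- Expanding `▷` leaves `w ∘ (z ∘ x)`, which Cayley–Hamilton splits into the commutator `[L_w,
L_z]`, the multiplication `L_{w ∘ z}` and trace terms. This single formula yields the Jordan
identity, the trace forms and the commutator of raising with lowering operators. -/
theorem freud_freud (w z x : Albert) :
    freud w (freud z x) = (1 / 4 : ℝ) • inn w x • z + (1 / 2 : ℝ) • (w * (z * x) - z * (w * x))
      - (1 / 2 : ℝ) • (w * z * x) + (1 / 4 : ℝ) • inn w z • x := by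
  have h := mul_mul_cyclic w z x
  rw [det] at h
  have t1 : tr (w * (z * x)) = tr (w * z * x) := by rw [← tr_mul_mul]
  simp only [freud_apply, mul_add, mul_sub, mul_smul_comm, mul_idMat, t1, inn_apply, map_add,
    map_sub, map_smul, smul_eq_mul, tr_idMat]
  rw [mul_comm (w * z) x] at *
  linear_combination (norm := module) (1 / 2 : ℝ) • h

/-- The coefficient of `t` in the adjoint identity at `x + t y`. -/
theorem freud_freud_self_left (x y : Albert) :
    (4 : ℝ) • freud (freud x x) (freud x y) = inn (freud x x) y • x + det x x x • y := by
  have hN (x : Albert) : freud (freud x x) (freud x x) = (1 / 3 * inn (freud x x) x) • x := by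
    rw [freud_self_freud_self, inn_freud]; module
  have key := eq_zero_of_quartic
    (freud (freud x x) (freud x x) - (1 / 3 * inn (freud x x) x) • x)
    ((4 : ℝ) • freud (freud x x) (freud x y) - inn (freud x x) y • x
      - (1 / 3 * inn (freud x x) x) • y)
    ((4 : ℝ) • freud (freud x y) (freud x y) + (2 : ℝ) • freud (freud x x) (freud y y)
      - inn (freud x x) y • y - inn (freud y y) x • x)
    ((4 : ℝ) • freud (freud x y) (freud y y) - inn (freud y y) x • y
      - (1 / 3 * inn (freud y y) y) • x)
    (freud (freud y y) (freud y y) - (1 / 3 * inn (freud y y) y) • y) (fun t => by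
      have e := hN (x + t • y)
      simp only [map_add, LinearMap.add_apply, map_smul, LinearMap.smul_apply, smul_add] at e
      simp only [freud_comm y x, freud_comm (freud x y) (freud x x),
        freud_comm (freud y y) (freud x x), freud_comm (freud y y) (freud x y),
        inn_freud_left_self x y, inn_freud_right_self x y] at e
      linear_combination (norm := module) e)
  rw [inn_freud x x x] at key
  linear_combination (norm := module) key

/-- The transpose of the preceding identity, since `x ▷ ·` is self-adjoint for the trace form. -/
theorem freud_freud_self_right (x y : Albert) :
    (4 : ℝ) • freud x (freud (freud x x) y) = inn x y • freud x x + det x x x • y := by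
  apply eq_of_inn
  intro z
  have h := congrArg (fun u => inn u y) (freud_freud_self_left x z)
  simp only [map_add, map_smul, LinearMap.add_apply, LinearMap.smul_apply, smul_eq_mul] at h ⊢
  rw [inn_freud_right, inn_comm, ← inn_freud_right] at h
  rw [inn_comm z y] at h
  linear_combination h

/-- By `freud_freud`, the commutator of `w ▷ ·` and `z ▷ ·` is `[L_w, L_z]` up to two rank-one
terms. For `w = x` and `z = x ▷ x` the two preceding identities evaluate this commutator, and it
equals exactly those rank-one terms. -/
theorem jordan_freud_self (x y : Albert) : x * (freud x x * y) = freud x x * (x * y) := by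
  have h1 := freud_freud x (freud x x) y
  have h2 := freud_freud (freud x x) x y
  have h3 := freud_freud_self_left x y
  have h4 := freud_freud_self_right x y
  rw [mul_comm (freud x x) x] at h2
  rw [inn_comm (freud x x) x] at h2
  linear_combination (norm := module) h2 - h1 + (1 / 4 : ℝ) • (h4 - h3)

/-- Since `a ∘ a` is a combination of `a ▷ a`, `a` and `I₃`, and `L_a` commutes with the
multiplication by each of these, the Jordan identity follows. -/
instance : IsCommJordan Albert where
  lmul_comm_rmul_rmul a b := by
    have h : a * a = freud a a + tr a • a
        + (1 / 2 : ℝ) • (tr (a * a) - tr a * tr a) • idMat := by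
      rw [freud_apply]; module
    have h1 := jordan_freud_self a b
    rw [h]
    simp only [mul_add, mul_smul_comm, mul_idMat]
    rw [mul_comm (a * b) (freud a a), mul_comm b (freud a a), mul_comm b a, mul_comm (a * b) a, h1]

/-- The linearized Jordan identity, saying that the cyclic sum of `[L_a, L_{b ∘ c}]` vanishes,
evaluated at `d`. -/
theorem mul_mul_mul_sum (a b c d : Albert) :
    a * (b * c * d) + b * (c * a * d) + c * (a * b * d) =
      b * c * (a * d) + c * a * (b * d) + a * b * (c * d) := by
  have h := congrArg (fun f : AddMonoid.End Albert => f d)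
    (two_nsmul_lie_lmul_lmul_add_add_eq_zero a b c)
  have h' : (2 : ℝ) • ((a * (b * c * d) - b * c * (a * d)) + (b * (c * a * d) - c * a * (b * d))
      + (c * (a * b * d) - a * b * (c * d))) = 0 := by
    rw [two_smul, ← two_nsmul]; exact h
  rw [smul_eq_zero_iff_right two_ne_zero] at h'
  linear_combination (norm := module) h'

/-- Commutators of multiplications are derivations. -/
theorem comm_mul_mul (a b c d : Albert) :
    a * (b * (c * d)) - b * (a * (c * d)) =
      (a * (b * c) - b * (a * c)) * d + c * (a * (b * d) - b * (a * d)) := by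
  -- In these two instances the right-hand sides coincide by commutativity; equating the left-hand
  -- sides gives the derivation rule.
  have h1 := mul_mul_mul_sum b c d a
  have h2 := mul_mul_mul_sum a c d b
  simp only [sub_mul, mul_sub]
  rw [mul_comm (c * d) a, mul_comm (d * b) a, mul_comm (b * c) a, mul_comm d b] at h1
  rw [mul_comm (c * d) b, mul_comm (d * a) b, mul_comm (a * c) b, mul_comm d a] at h2
  rw [mul_comm (a * (b * c)) d, mul_comm (b * (a * c)) d]
  rw [mul_comm (c * d) (b * a), mul_comm b a, mul_comm (b * d)] at h1
  rw [mul_comm (c * d) (a * b)] at h2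
  have q1 : a * d * (c * b) = b * c * (d * a) := by
    rw [mul_comm (a * d), mul_comm c b, mul_comm a d]
  have q2 : a * c * (d * b) = c * a * (b * d) := by rw [mul_comm a c, mul_comm d b]
  linear_combination (norm := module) h2 - h1 + q1 + q2

end Albert


open Octonion

/-! ### Positive definite forms and traces -/

section PositiveDefinite

variable {V : Type*} [AddCommGroup V] [Module ℝ V] [FiniteDimensional ℝ V]

/-- A positive definite form has an orthogonal basis of prescribed length. -/
theorem exists_basis_of_posDef (B : LinearMap.BilinForm ℝ V) (hs : ∀ x y, B x y = B y x)
    (hp : ∀ x, x ≠ 0 → 0 < B x x) {n : ℕ} (hn : Module.finrank ℝ V = n) {c : ℝ} (hc : 0 < c) :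
    ∃ b : Module.Basis (Fin n) ℝ V, ∀ i j, B (b i) (b j) = if i = j then c else 0 := by
  subst hn
  obtain ⟨v, hv⟩ := LinearMap.BilinForm.exists_orthogonal_basis (B := B) ⟨hs⟩
  have hpos (i) : 0 < B (v i) (v i) := hp _ (v.ne_zero i)
  have hu (i) : IsUnit (√(c / B (v i) (v i))) :=
    (Real.sqrt_pos.2 (div_pos hc (hpos i))).ne'.isUnit
  refine ⟨v.isUnitSMul hu, fun i k => ?_⟩
  rw [Module.Basis.isUnitSMul_apply, Module.Basis.isUnitSMul_apply, map_smul, LinearMap.map_smul₂,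
    smul_eq_mul, smul_eq_mul]
  split_ifs with h
  · subst h
    rw [← mul_assoc, Real.mul_self_sqrt (div_pos hc (hpos i)).le, div_mul_cancel₀ _ (hpos i).ne']
  · rw [hv h, mul_zero, mul_zero]

omit [FiniteDimensional ℝ V] in
theorem trace_eq_sum_of_orthonormal {ι : Type*} [Fintype ι] [DecidableEq ι]
    (B : LinearMap.BilinForm ℝ V) (b : Module.Basis ι ℝ V) {c : ℝ} (hc : c ≠ 0)
    (hb : ∀ i j, B (b i) (b j) = if i = j then c else 0) (f : Module.End ℝ V) :
    LinearMap.trace ℝ V f = ∑ i, c⁻¹ * B (b i) (f (b i)) := by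
  rw [LinearMap.trace_eq_matrix_trace ℝ b, Matrix.trace]
  refine Finset.sum_congr rfl fun i _ => ?_
  rw [Matrix.diag_apply, LinearMap.toMatrix_apply]
  have h : B (b i) (f (b i)) = ∑ k, b.repr (f (b i)) k * B (b i) (b k) := by
    conv_lhs => rw [← b.sum_repr (f (b i)), map_sum]
    simp
  simp only [h, hb, mul_ite, mul_zero, Finset.sum_ite_eq, Finset.mem_univ, if_true]
  field_simp

/-- In an orthonormal basis `tr f² = -∑ |f b_i|²`. This gives definiteness both of the trace form on
derivations and of the Killing form. -/
theorem trace_mul_self_neg_of_skew (B : LinearMap.BilinForm ℝ V) (hs : ∀ x y, B x y = B y x)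
    (hp : ∀ x, x ≠ 0 → 0 < B x x) (f : Module.End ℝ V) (hf : ∀ x y, B (f x) y = -B x (f y))
    (h0 : f ≠ 0) : LinearMap.trace ℝ V (f * f) < 0 := by
  obtain ⟨b, hb⟩ := exists_basis_of_posDef B hs hp rfl one_pos
  rw [trace_eq_sum_of_orthonormal B b one_ne_zero hb]
  have hn (x : V) : 0 ≤ B x x := by
    rcases eq_or_ne x 0 with rfl | hx
    · simp
    · exact (hp x hx).le
  have e (i) : (1 : ℝ)⁻¹ * B (b i) ((f * f) (b i)) = -B (f (b i)) (f (b i)) := by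
    rw [Module.End.mul_apply, hf, inv_one, one_mul, neg_neg]
  simp only [e, Finset.sum_neg_distrib, neg_lt_zero]
  obtain ⟨i, hi⟩ : ∃ i, f (b i) ≠ 0 := by
    by_contra! h
    exact h0 (b.ext h)
  exact Finset.sum_pos' (fun i _ => hn _) ⟨i, Finset.mem_univ i, hp _ hi⟩

end PositiveDefinite

/-! ### Traces on the Jordan algebra and inner derivations -/

namespace Octonion

instance : Module.Finite ℝ Octonion := inferInstanceAs (Module.Finite ℝ (ℍ[ℝ] × ℍ[ℝ]))

theorem finrank_eq : Module.finrank ℝ Octonion = 8 := by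
  have : Module.finrank ℝ (ℍ[ℝ] × ℍ[ℝ]) = 8 := by
    rw [Module.finrank_prod, Quaternion.finrank_eq_four]
  exact this

theorem exists_orthonormal : ∃ u : Module.Basis (Fin 8) ℝ Octonion,
    ∀ i j, dot (u i) (u j) = if i = j then 1 else 0 :=
  exists_basis_of_posDef dot dot_comm
    (fun x hx => lt_of_le_of_ne (dot_self_nonneg x) fun h => hx (dot_self_eq_zero h.symm))
    finrank_eq one_pos

end Octonion

namespace Albert

/-- Coordinates on the Jordan algebra. -/
noncomputable def coords : Albert ≃ₗ[ℝ] (Fin 3 → ℝ) × (Fin 3 → Octonion) where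
  toFun x := (fun i => dg i x, fun i => od i x)
  invFun v := mk v.1 v.2
  map_add' x y := by ext1 <;> ext1 i <;> simp
  map_smul' c x := by ext1 <;> ext1 i <;> simp
  left_inv x := ext_coords (fun i => by simp) (fun i => by simp)
  right_inv v := by ext1 <;> ext1 i <;> simp

instance : Module.Finite ℝ Albert := Module.Finite.equiv coords.symm

theorem finrank_eq : Module.finrank ℝ Albert = 27 := by
  rw [coords.finrank_eq, Module.finrank_prod, Module.finrank_fin_fun, Module.finrank_pi_fintype]
  simp [Octonion.finrank_eq]

/-- The diagonal idempotents. -/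
noncomputable def E (i : Fin 3) : Albert := mk (Pi.single i 1) 0

/-- The off-diagonal elements. -/
noncomputable def F (i : Fin 3) (a : Octonion) : Albert := mk 0 (Pi.single i a)

@[simp] theorem dg_E (i k : Fin 3) : dg k (E i) = (Pi.single i 1 : Fin 3 → ℝ) k := dg_mk _ _ _
@[simp] theorem od_E (i k : Fin 3) : od k (E i) = 0 := od_mk _ _ _
@[simp] theorem dg_F (i k : Fin 3) (a : Octonion) : dg k (F i a) = 0 := dg_mk _ _ _
@[simp] theorem od_F (i k : Fin 3) (a : Octonion) :
    od k (F i a) = (Pi.single i a : Fin 3 → Octonion) k := od_mk _ _ _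

/-- Each diagonal entry contributes 1 on its own idempotent and `8 · ½` on each of the two adjacent
octonionic blocks, in total 9. -/
theorem trace_mulLeft (x : Albert) :
    LinearMap.trace ℝ Albert (LinearMap.mulLeft ℝ x) = 9 * tr x := by
  obtain ⟨u, -⟩ := exists_orthonormal
  let b := ((Pi.basisFun ℝ (Fin 3)).prod (Pi.basis fun _ : Fin 3 => u)).map coords.symm
  have hbl (i : Fin 3) : b (.inl i) = E i := by
    apply ext_coords <;> intro k
    · simp [b, coords]
    · simp [b, coords]
  have hbr (p : (_ : Fin 3) × Fin 8) : b (.inr p) = F p.1 (u p.2) := by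
    apply ext_coords <;> intro k
    · simp [b, coords]
    · simp [b, coords, Pi.single_apply]
  have hrl (x : Albert) (i : Fin 3) : b.repr x (.inl i) = dg i x := by
    simp [b, coords]
  have hrr (x : Albert) (p : (_ : Fin 3) × Fin 8) : b.repr x (.inr p) = u.repr (od p.1 x) p.2 := by
    simp [b, coords]
  rw [LinearMap.trace_eq_matrix_trace ℝ b, Matrix.trace, Fintype.sum_sum_type, Fintype.sum_sigma]
  have h1 (i : Fin 3) : (LinearMap.toMatrix b b (LinearMap.mulLeft ℝ x)).diag (.inl i)
      = dg i x := by
    rw [Matrix.diag_apply, LinearMap.toMatrix_apply, LinearMap.mulLeft_apply, hbl, hrl, dg_mul]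
    simp
  have h2 (i : Fin 3) (k : Fin 8) :
      (LinearMap.toMatrix b b (LinearMap.mulLeft ℝ x)).diag (.inr ⟨i, k⟩)
      = 1 / 2 * (dg (i + 1) x + dg (i + 2) x) := by
    rw [Matrix.diag_apply, LinearMap.toMatrix_apply, LinearMap.mulLeft_apply, hbr, hrr, od_mul]
    have e1 : (Pi.single i (u k) : Fin 3 → Octonion) (i + 1) = 0 :=
      Pi.single_eq_of_ne (fin3_ne_add1 i).symm _
    have e2 : (Pi.single i (u k) : Fin 3 → Octonion) (i + 2) = 0 :=
      Pi.single_eq_of_ne (fin3_ne_add2 i).symm _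
    simp [e1, e2, mul_add]
  simp only [h1, h2, Finset.sum_const, Finset.card_univ, Fintype.card_fin]
  rw [tr_eq x 0, fin3_sum _ 0, fin3_sum _ 0]
  simp only [fin3_add11, fin3_add12, fin3_add21, fin3_add22]
  simp only [nsmul_eq_mul]
  push_cast
  ring

theorem der_mul (δ : Der Albert) (x y : Albert) :
    (δ : Module.End ℝ Albert) (x * y) =
      (δ : Module.End ℝ Albert) x * y + x * (δ : Module.End ℝ Albert) y := δ.2 x y

theorem lie_der_mulLeft (δ : Der Albert) (x : Albert) :
    ⁅(δ : Module.End ℝ Albert), LinearMap.mulLeft ℝ x⁆ =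
      LinearMap.mulLeft ℝ ((δ : Module.End ℝ Albert) x) := by
  ext1 y
  simp only [Ring.lie_def, LinearMap.sub_apply, Module.End.mul_apply, LinearMap.mulLeft_apply,
    der_mul]
  abel

/-- `L_{δ x} = [δ, L_x]` is a commutator, so `9 tr (δ x) = 0`. Skewness of derivations for the trace
form follows. -/
theorem tr_der (δ : Der Albert) (x : Albert) : tr ((δ : Module.End ℝ Albert) x) = 0 := by
  have h := trace_mulLeft ((δ : Module.End ℝ Albert) x)
  rw [← lie_der_mulLeft, LinearMap.trace_lie] at h
  linarith

theorem inn_der (δ : Der Albert) (x y : Albert) :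
    inn ((δ : Module.End ℝ Albert) x) y = -inn x ((δ : Module.End ℝ Albert) y) := by
  have h := tr_der δ (x * y)
  rw [der_mul, map_add] at h
  rw [inn_apply, inn_apply]
  linarith

theorem der_idMat (δ : Der Albert) : (δ : Module.End ℝ Albert) idMat = 0 := by
  have h := der_mul δ idMat idMat
  rw [mul_idMat, mul_idMat, idMat_mul] at h
  simpa using h

theorem der_freud (δ : Der Albert) (x y : Albert) :
    (δ : Module.End ℝ Albert) (freud x y) =
      freud ((δ : Module.End ℝ Albert) x) y + freud x ((δ : Module.End ℝ Albert) y) := by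
  have h := tr_der δ (x * y)
  rw [der_mul, map_add] at h
  simp only [freud_apply, map_sub, map_add, map_smul, der_mul, tr_der, der_idMat]
  linear_combination (norm := module) (1 / 2 : ℝ) • congrArg (fun r : ℝ => r • idMat) h

theorem trace_der_mul_self_neg (δ : Der Albert) (h : δ ≠ 0) :
    LinearMap.trace ℝ Albert ((δ : Module.End ℝ Albert) * (δ : Module.End ℝ Albert)) < 0 :=
  trace_mul_self_neg_of_skew inn inn_comm (fun _ => inn_self_pos) _ (inn_der δ)
    (fun h' => h (Subtype.ext h'))

/-- The trace of `freud_freud`: the rank-one term, `L_{w ∘ z}` and the identity contribute `1/4 -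
9/2 + 27/4 = 5/2`; the commutator contributes nothing. -/
theorem trace_freud_mul_freud (w z : Albert) :
    LinearMap.trace ℝ Albert (freud w * freud z) = 5 / 2 * inn w z := by
  have h : freud w * freud z = (1 / 4 : ℝ) • (inn w).smulRight z
      + (1 / 2 : ℝ) • ⁅LinearMap.mulLeft ℝ w, LinearMap.mulLeft ℝ z⁆
      - (1 / 2 : ℝ) • LinearMap.mulLeft ℝ (w * z) + (1 / 4 * inn w z : ℝ) • LinearMap.id := by
    ext1 x
    simp only [Module.End.mul_apply, freud_freud, LinearMap.add_apply, LinearMap.sub_apply,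
      LinearMap.smul_apply, LinearMap.smulRight_apply, Ring.lie_def, LinearMap.mulLeft_apply,
      LinearMap.id_apply]
    module
  rw [h, map_add, map_sub, map_add, map_smul, map_smul, map_smul, map_smul,
    LinearMap.trace_smulRight, LinearMap.trace_lie, trace_mulLeft, LinearMap.trace_id, finrank_eq,
    ← inn_apply]
  simp only [smul_eq_mul]
  push_cast
  ring

/-- For traceless `x` and `y` the operators `L_x L_y` and `x ▷ (y ▷ ·)` differ by rank-one terms
only, whose traces raise `5/2` to 3. -/
theorem trace_mulLeft_mul_mulLeft_of_tr_eq_zero {x y : Albert} (hx : tr x = 0) (hy : tr y = 0) :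
    LinearMap.trace ℝ Albert (LinearMap.mulLeft ℝ x * LinearMap.mulLeft ℝ y) = 3 * inn x y := by
  have h : LinearMap.mulLeft ℝ x * LinearMap.mulLeft ℝ y = freud x * freud y
      + (1 / 2 : ℝ) • tr.smulRight (x * y) + (1 / 4 : ℝ) • (inn y).smulRight x
      + (1 / 2 : ℝ) • (inn x ∘ₗ LinearMap.mulLeft ℝ y).smulRight idMat
      - (1 / 4 * inn x y : ℝ) • tr.smulRight idMat := by
    ext1 z
    simp only [Module.End.mul_apply, LinearMap.add_apply, LinearMap.sub_apply,
      LinearMap.smul_apply, LinearMap.smulRight_apply, LinearMap.mulLeft_apply,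
      LinearMap.comp_apply, freud_apply, hx, hy, mul_add, mul_sub, mul_smul_comm, mul_idMat,
      map_add, map_sub, map_smul, tr_idMat, inn_apply, smul_eq_mul]
    module
  rw [h, map_sub, map_add, map_add, map_add, map_smul, map_smul, map_smul, map_smul,
    LinearMap.trace_smulRight, LinearMap.trace_smulRight, LinearMap.trace_smulRight,
    LinearMap.trace_smulRight, trace_freud_mul_freud, LinearMap.comp_apply,
    LinearMap.mulLeft_apply, mul_idMat, ← inn_apply, tr_idMat, inn_comm y x]
  simp only [smul_eq_mul]
  ring

theorem trace_mulLeft_mul_mulLeft {x y : Albert} (hy : tr y = 0) :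
    LinearMap.trace ℝ Albert (LinearMap.mulLeft ℝ x * LinearMap.mulLeft ℝ y) = 3 * inn x y := by
  have hx : tr (x - (1 / 3 * tr x) • idMat) = 0 := by
    rw [map_sub, map_smul, tr_idMat, smul_eq_mul]; ring
  have h := trace_mulLeft_mul_mulLeft_of_tr_eq_zero hx hy
  have e : LinearMap.mulLeft ℝ (x - (1 / 3 * tr x) • idMat) * LinearMap.mulLeft ℝ y
      = LinearMap.mulLeft ℝ x * LinearMap.mulLeft ℝ y
        - (1 / 3 * tr x) • LinearMap.mulLeft ℝ y := by
    ext1 z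
    simp only [Module.End.mul_apply, LinearMap.sub_apply, LinearMap.smul_apply,
      LinearMap.mulLeft_apply, sub_mul, smul_mul_assoc, idMat_mul]
  rw [e, map_sub, map_smul, trace_mulLeft, hy, LinearMap.map_sub₂, LinearMap.map_smul₂,
    inn_idMat_left, hy] at h
  simpa using h

/-- The inner derivation `[L_x, L_y]`. -/
noncomputable def innerDer : Albert →ₗ[ℝ] Albert →ₗ[ℝ] Der Albert :=
  LinearMap.mk₂ ℝ (fun x y => ⟨jordanComm x y, fun c d => comm_mul_mul x y c d⟩)
    (fun x x' y => Subtype.ext (by simp)) (fun c x y => Subtype.ext (by simp))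
    (fun x y y' => Subtype.ext (by simp)) (fun c x y => Subtype.ext (by simp))

theorem innerDer_coe (x y : Albert) : (innerDer x y : Module.End ℝ Albert) = jordanComm x y := rfl

theorem innerDer_apply (x y z : Albert) :
    (innerDer x y : Module.End ℝ Albert) z = x * (y * z) - y * (x * z) := rfl

theorem innerDer_coe_eq_lie (x y : Albert) : (innerDer x y : Module.End ℝ Albert) =
    ⁅LinearMap.mulLeft ℝ x, LinearMap.mulLeft ℝ y⁆ := rfl

theorem der_ext {δ ε : Der Albert}
    (h : ∀ x, (δ : Module.End ℝ Albert) x = (ε : Module.End ℝ Albert) x) : δ = ε :=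
  Subtype.ext (LinearMap.ext h)

theorem innerDer_skew (x y : Albert) : innerDer x y = -innerDer y x := by
  apply der_ext; intro z
  show (innerDer x y : Module.End ℝ Albert) z = -((innerDer y x : Module.End ℝ Albert) z)
  rw [innerDer_apply, innerDer_apply]; abel

theorem lie_innerDer (δ : Der Albert) (x y : Albert) : ⁅δ, innerDer x y⁆ =
    innerDer ((δ : Module.End ℝ Albert) x) y + innerDer x ((δ : Module.End ℝ Albert) y) := by
  apply der_ext; intro z
  show (δ : Module.End ℝ Albert) ((innerDer x y : Module.End ℝ Albert) z)
    - (innerDer x y : Module.End ℝ Albert) ((δ : Module.End ℝ Albert) z) =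
    (innerDer ((δ : Module.End ℝ Albert) x) y : Module.End ℝ Albert) z
    + (innerDer x ((δ : Module.End ℝ Albert) y) : Module.End ℝ Albert) z
  simp only [innerDer_apply, map_sub, der_mul, mul_add]
  abel

theorem innerDer_cyclic (x y z : Albert) :
    innerDer x (y * z) + innerDer y (z * x) + innerDer z (x * y) = 0 := by
  apply der_ext; intro w
  show (innerDer x (y * z) : Module.End ℝ Albert) w
    + (innerDer y (z * x) : Module.End ℝ Albert) w
    + (innerDer z (x * y) : Module.End ℝ Albert) w = 0
  have h := mul_mul_mul_sum x y z w
  simp only [innerDer_apply]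
  linear_combination (norm := module) h

/-- Invariance of the trace moves the commutator onto `δ`: `tr ([L_x, L_y] δ) = tr (L_x [L_y, δ]) =
-tr (L_x L_{δ y})`, and `δ y` is traceless. -/
theorem trace_innerDer_mul (x y : Albert) (δ : Der Albert) :
    LinearMap.trace ℝ Albert ((innerDer x y : Module.End ℝ Albert) * (δ : Module.End ℝ Albert)) =
      -(3 * inn x ((δ : Module.End ℝ Albert) y)) := by
  rw [innerDer_coe_eq_lie, LinearMap.trace_lie_mul_eq,
    ← lie_skew (LinearMap.mulLeft ℝ y) (δ : Module.End ℝ Albert), lie_der_mulLeft, mul_neg,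
    map_neg, trace_mulLeft_mul_mulLeft (tr_der δ y)]

end Albert


open Octonion

/-! ### Peirce decomposition, simplicity of the Jordan algebra and the dimension of its derivations
-/

namespace Octonion

theorem exists_coords (r0 r1 r2 r3 r4 r5 r6 r7 : ℝ) : ∃ x : Octonion,
    x.1.re = r0 ∧ x.1.imI = r1 ∧ x.1.imJ = r2 ∧ x.1.imK = r3 ∧
    x.2.re = r4 ∧ x.2.imI = r5 ∧ x.2.imJ = r6 ∧ x.2.imK = r7 :=
  ⟨((⟨r0, r1, r2, r3⟩ : ℍ[ℝ]), (⟨r4, r5, r6, r7⟩ : ℍ[ℝ])), rfl, rfl, rfl, rfl, rfl, rfl, rfl, rfl⟩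

/-- The nucleus of the octonions is the real line. -/
theorem eq_re_of_nucleus {c : Octonion} (h : ∀ a b : Octonion, a * b * c = a * (b * c)) :
    c = re c • (1 : Octonion) := by
  -- The units `i`, `j` (here `k`) and `l` generate the octonions; the vanishing of their
  -- associators with `c` kills each of the seven imaginary coordinates of `c`.
  obtain ⟨i, i0, i1, i2, i3, i4, i5, i6, i7⟩ := exists_coords 0 1 0 0 0 0 0 0
  obtain ⟨k, k0, k1, k2, k3, k4, k5, k6, k7⟩ := exists_coords 0 0 1 0 0 0 0 0
  obtain ⟨l, l0, l1, l2, l3, l4, l5, l6, l7⟩ := exists_coords 0 0 0 0 1 0 0 0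
  have e (a b : Octonion) (f : Octonion → ℝ) : f (a * b * c) = f (a * (b * c)) := by rw [h]
  have h1 := e i k (fun x => x.2.re)
  have h2 := e i k (fun x => x.2.imI)
  have h3 := e i k (fun x => x.2.imJ)
  have h4 := e i k (fun x => x.2.imK)
  have h5 := e l i (fun x => x.2.imJ)
  have h6 := e l i (fun x => x.2.imK)
  have h7 := e l k (fun x => x.2.imK)
  simp only [mul_fst, mul_snd, Quaternion.re_sub, Quaternion.re_mul, Quaternion.re_star,
    Quaternion.imI_star, Quaternion.imJ_star, Quaternion.imK_star, Quaternion.imI_sub,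
    Quaternion.imJ_sub, Quaternion.imK_sub, Quaternion.imI_mul, Quaternion.imJ_mul,
    Quaternion.imK_mul, Quaternion.re_add, Quaternion.imI_add, Quaternion.imJ_add,
    Quaternion.imK_add, i0, i1, i2, i3, i4, i5, i6, i7, k0, k1, k2, k3, k4, k5, k6, k7,
    l0, l1, l2, l3, l4, l5, l6, l7] at h1 h2 h3 h4 h5 h6 h7
  ring_nf at h1 h2 h3 h4 h5 h6 h7
  apply ext_coords <;> simp [re_apply] <;> linarith

theorem eq_zero_of_dot_basis {ι : Type*} (u : Module.Basis ι ℝ Octonion) {x : Octonion}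
    (h : ∀ i, dot (u i) x = 0) : x = 0 := by
  apply dot_self_eq_zero
  have : dot.flip x = 0 := u.ext fun i => by simp [h]
  exact congrArg (fun f => f x) this

end Octonion

namespace Albert

theorem dg_E_mul (i k : Fin 3) (x : Albert) : dg k (E i * x) = if k = i then dg k x else 0 := by
  rw [dg_mul]; simp [Pi.single_apply]

theorem od_E_mul (i k : Fin 3) (x : Albert) :
    od k (E i * x) = if k = i then 0 else (1 / 2 : ℝ) • od k x := by
  rw [od_mul]
  rcases fin3_cases k i with rfl | rfl | rfl
  · simp [Pi.single_apply]
  · rw [if_neg (fin3_ne_add1 k)]; simp [Pi.single_apply]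
  · rw [if_neg (fin3_ne_add2 k)]; simp [Pi.single_apply]

theorem E_mul_E (i : Fin 3) : E i * E i = E i := by
  apply ext_coords <;> intro k
  · rw [dg_E_mul]; simp [Pi.single_apply]
  · rw [od_E_mul]; simp

theorem E_mul_E_of_ne {i k : Fin 3} (h : i ≠ k) : E i * E k = 0 := by
  apply ext_coords <;> intro l
  · rw [dg_E_mul]; simp [Pi.single_apply]; intro h1 h2; exact h (h1.symm.trans h2)
  · rw [od_E_mul]; simp

theorem E_mul_F_self (i : Fin 3) (a : Octonion) : E i * F i a = 0 := by
  apply ext_coords <;> intro l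
  · rw [dg_E_mul]; simp
  · rw [od_E_mul]; simp [Pi.single_apply]; tauto

theorem E_mul_F_of_ne {i k : Fin 3} (h : i ≠ k) (a : Octonion) :
    E i * F k a = (1 / 2 : ℝ) • F k a := by
  apply ext_coords <;> intro l
  · rw [dg_E_mul]; simp
  · rw [od_E_mul, map_smul]; simp [Pi.single_apply]
    intro h1 h2; exact absurd (h1.symm.trans h2) h

theorem F_add (i : Fin 3) (a b : Octonion) : F i (a + b) = F i a + F i b := by
  apply ext_coords <;> intro l
  · simp
  · simp [Pi.single_add]

theorem F_smul (i : Fin 3) (c : ℝ) (a : Octonion) : F i (c • a) = c • F i a := by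
  apply ext_coords <;> intro l
  · simp
  · simp [Pi.single_smul]

theorem F_mul_F_self (i : Fin 3) (a b : Octonion) :
    F i a * F i b = dot a b • (E (i + 1) + E (i + 2)) := by
  apply ext_coords <;> intro k
  · rw [dg_mul]
    rcases fin3_cases i k with rfl | rfl | rfl
    · simp [Pi.single_apply]
    · simp [Pi.single_apply, fin3_add11, fin3_add12]
    · simp [Pi.single_apply, fin3_add21, fin3_add22]
  · rw [od_mul]
    rcases fin3_cases i k with rfl | rfl | rfl <;>
    simp [Pi.single_apply, fin3_add11, fin3_add12, fin3_add21, fin3_add22]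

theorem F_mul_F_add1 (i : Fin 3) (a b : Octonion) :
    F i a * F (i + 1) b = (1 / 2 : ℝ) • F (i + 2) (star (a * b)) := by
  apply ext_coords <;> intro k
  · rw [dg_mul]
    rcases fin3_cases i k with rfl | rfl | rfl <;>
    simp [Pi.single_apply, fin3_add11, fin3_add12, fin3_add21, fin3_add22]
  · rw [od_mul]
    rcases fin3_cases i k with rfl | rfl | rfl <;>
    simp [Pi.single_apply, fin3_add11, fin3_add12, fin3_add21, fin3_add22]

theorem inn_F_left (i : Fin 3) (a : Octonion) (x : Albert) :
    inn (F i a) x = 2 * dot a (od i x) := by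
  rw [inn_eq, fin3_sum _ i]
  simp [Pi.single_apply]

theorem eq_sum_E_F (x : Albert) : x = ∑ i, (dg i x • E i + F i (od i x)) := by
  apply ext_coords <;> intro k
  · simp [map_sum, Pi.single_apply]
  · simp [map_sum, Pi.single_apply]

theorem idMat_eq : idMat = ∑ i, E i := by
  apply ext_coords <;> intro k
  · simp [map_sum, Pi.single_apply]
  · simp [map_sum, Pi.single_apply]

/-- The Jordan algebra is simple. -/
theorem ideal_eq_top (N : Submodule ℝ Albert) (hN : ∀ x, ∀ y ∈ N, x * y ∈ N) (h0 : N ≠ ⊥) :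
    N = ⊤ := by
  -- `F i a ∘ F i a` is a nonzero multiple of `E (i + 1) + E (i + 2)`, and multiplying by one of
  -- these idempotents separates them.
  have hF (i : Fin 3) (a : Octonion) (ha : a ≠ 0) (h : F i a ∈ N) (k : Fin 3) (hk : k ≠ i) :
      E k ∈ N := by
    have h1 := hN (E k) _ (hN (F i a) _ h)
    have hne : dot a a ≠ 0 := fun h => ha (dot_self_eq_zero h)
    rw [F_mul_F_self, mul_smul_comm, N.smul_mem_iff hne, mul_add] at h1
    rcases fin3_cases i k with rfl | rfl | rfl
    · exact absurd rfl hk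
    · rwa [E_mul_E, E_mul_E_of_ne (fin3_add1_ne_add2 i), add_zero] at h1
    · rwa [E_mul_E, E_mul_E_of_ne (fin3_add1_ne_add2 i).symm, zero_add] at h1
  have hE (i k : Fin 3) (h : E i ∈ N) (hk : k ≠ i) : F k 1 ∈ N := by
    have h1 := hN (F k 1) _ h
    rwa [mul_comm, E_mul_F_of_ne hk.symm, N.smul_mem_iff (by norm_num)] at h1
  have h1 : (1 : Octonion) ≠ 0 := fun h => by
    have := congrArg re h
    rw [re_one, map_zero] at this
    exact one_ne_zero this
  have hall (i : Fin 3) (h : E i ∈ N) (k : Fin 3) : E k ∈ N := by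
    rcases fin3_cases i k with rfl | rfl | rfl
    · exact h
    · exact hF (i + 2) 1 h1 (hE i _ h (fin3_ne_add2 i).symm) _ (fin3_add1_ne_add2 i)
    · exact hF (i + 1) 1 h1 (hE i _ h (fin3_ne_add1 i).symm) _ (fin3_add1_ne_add2 i).symm
  obtain ⟨x, hx, hx0⟩ := N.ne_bot_iff.1 h0
  have hex : ∃ i, E i ∈ N := by
    by_cases ho : ∃ i, od i x ≠ 0
    · obtain ⟨i, hi⟩ := ho
      -- Two idempotent multiplications project onto the Peirce space of the entry `i`, up to the
      -- factor `1/4`.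
      have h2 := hN (E (i + 1)) _ (hN (E (i + 2)) _ hx)
      have e : E (i + 1) * (E (i + 2) * x) = (1 / 4 : ℝ) • F i (od i x) := by
        apply ext_coords <;> intro k
        · rw [dg_E_mul, dg_E_mul]
          rcases fin3_cases i k with rfl | rfl | rfl <;> simp
        · rw [od_E_mul, od_E_mul]
          rcases fin3_cases i k with rfl | rfl | rfl
          · simp [smul_smul]; norm_num
          · simp
          · simp
      rw [e, N.smul_mem_iff (by norm_num)] at h2
      exact ⟨i + 1, hF i _ hi h2 _ (fin3_ne_add1 i).symm⟩
    · push Not at ho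
      obtain ⟨i, hi⟩ : ∃ i, dg i x ≠ 0 := by
        by_contra! h
        exact hx0 (ext_coords (fun i => by rw [h, map_zero]) (fun i => by rw [ho, map_zero]))
      have h2 := hN (E i) _ hx
      have e : E i * x = dg i x • E i := by
        apply ext_coords <;> intro k
        · rw [dg_E_mul, map_smul, dg_E]
          rcases eq_or_ne k i with rfl | hk
          · simp
          · simp [hk]
        · rw [od_E_mul, map_smul, od_E, ho]; simp
      rw [e, N.smul_mem_iff hi] at h2
      exact ⟨i, h2⟩
  obtain ⟨i, hi⟩ := hex
  rw [eq_top_iff]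
  intro y _
  rw [← mul_idMat y, idMat_eq]
  exact hN _ _ (N.sum_mem fun k _ => hall i hi k)

/-- Differentiating `E i ∘ E i = E i` gives `2 E i ∘ δ (E i) = δ (E i)`: the image lies in the
Peirce ½-space of `E i`, where these entries vanish. -/
theorem der_E_of_mul_self (δ : Der Albert) (i k : Fin 3) :
    dg k ((δ : Module.End ℝ Albert) (E i)) = 0 ∧ od i ((δ : Module.End ℝ Albert) (E i)) = 0 := by
  have h := der_mul δ (E i) (E i)
  rw [E_mul_E, mul_comm _ (E i)] at h
  have hd := congrArg (dg k) h
  have ho := congrArg (od i) h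
  rw [map_add, dg_E_mul] at hd
  rw [map_add, od_E_mul, if_pos rfl, add_zero] at ho
  refine ⟨?_, ho⟩
  split_ifs at hd <;> linarith

/-- A derivation killing the idempotents commutes with their multiplications, hence preserves each
Peirce space. -/
theorem der_F_of_der_E {δ : Der Albert} (h : ∀ i, (δ : Module.End ℝ Albert) (E i) = 0) (i : Fin 3)
    (a : Octonion) : (δ : Module.End ℝ Albert) (F i a) =
      F i (od i ((δ : Module.End ℝ Albert) (F i a))) := by
  have h1 := der_mul δ (E i) (F i a)
  have h2 := der_mul δ (E (i + 1)) (F i a)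
  rw [h, zero_mul, zero_add, E_mul_F_self, map_zero] at h1
  rw [h, zero_mul, zero_add, E_mul_F_of_ne (fin3_ne_add1 i).symm, map_smul] at h2
  apply ext_coords <;> intro k
  · have e1 := congrArg (dg k) h1
    have e2 := congrArg (dg k) h2
    rw [dg_E_mul, map_zero] at e1
    rw [dg_E_mul, map_smul, smul_eq_mul] at e2
    rw [dg_F]
    split_ifs at e1 e2 <;> linarith
  · have e1 := congrArg (od k) h1
    rw [od_E_mul, map_zero] at e1
    rw [od_F]
    rcases eq_or_ne k i with rfl | hk
    · simp
    · rw [if_neg hk, eq_comm, smul_eq_zero_iff_right (by norm_num)] at e1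
      rw [e1, Pi.single_eq_of_ne hk]

/-- Strictly increasing pairs of indices of octonionic coordinates. -/
abbrev IncPair : Type := {p : Fin 8 × Fin 8 // p.1 < p.2}

/-- Parameters of a derivation: off-diagonal entries of the images of two diagonal idempotents, and
the action on an off-diagonal Peirce space. -/
noncomputable def derParam (u : Module.Basis (Fin 8) ℝ Octonion) :
    Der Albert →ₗ[ℝ] Octonion × Octonion × Octonion × (IncPair → ℝ) where
  toFun δ := (od 1 ((δ : Module.End ℝ Albert) (E 0)), od 2 ((δ : Module.End ℝ Albert) (E 0)),
    od 0 ((δ : Module.End ℝ Albert) (E 1)),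
    fun p => dot (u p.1.1) (od 0 ((δ : Module.End ℝ Albert) (F 0 (u p.1.2)))))
  map_add' δ ε := by
    refine Prod.ext ?_ (Prod.ext ?_ (Prod.ext ?_ ?_)) <;> [skip; skip; skip; ext1 p] <;> simp
  map_smul' c δ := by
    refine Prod.ext ?_ (Prod.ext ?_ (Prod.ext ?_ ?_)) <;> [skip; skip; skip; ext1 p] <;> simp

/-- With all parameters zero, `δ` kills the idempotents, so it preserves the three octonionic Peirce
spaces and is skew on each. Skewness makes the entries above the diagonal suffice to kill the block
`F 0`. The product `F 0 × F 1 → F 2` then forces `δ` to act on `F 1` as right multiplication by some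
`c` in the nucleus. Such a `c` is real, and skewness gives `c = 0`; finally `F 2` is reached from `F
0` and `F 1`. -/
theorem derParam_injective (u : Module.Basis (Fin 8) ℝ Octonion) :
    Function.Injective (derParam u) := by
  rw [← LinearMap.ker_eq_bot, LinearMap.ker_eq_bot']
  intro δ hδ
  set d : Module.End ℝ Albert := (δ : Module.End ℝ Albert) with hd
  have p1 : od 1 (d (E 0)) = 0 := congrArg Prod.fst hδ
  have p2 : od 2 (d (E 0)) = 0 := congrArg (fun v => v.2.1) hδ
  have p3 : od 0 (d (E 1)) = 0 := congrArg (fun v => v.2.2.1) hδ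
  have p4 (p : IncPair) : dot (u p.1.1) (od 0 (d (F 0 (u p.1.2)))) = 0 :=
    congrArg (fun v => v.2.2.2 p) hδ
  have hE0 : d (E 0) = 0 := ext_coords (fun k => by rw [(der_E_of_mul_self δ 0 k).1, map_zero])
    (fun k => by
      rw [map_zero]
      fin_cases k
      · exact (der_E_of_mul_self δ 0 0).2
      · exact p1
      · exact p2)
  have hE1 : d (E 1) = 0 := ext_coords (fun k => by rw [(der_E_of_mul_self δ 1 k).1, map_zero])
    (fun k => by
      rw [map_zero]
      fin_cases k
      · exact p3
      · exact (der_E_of_mul_self δ 1 0).2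
      -- The third entry of `δ (E 1)` is not a parameter; it is determined by differentiating `E 0 ∘
      -- E 1 = 0`.
      · have h := der_mul δ (E 0) (E 1)
        rw [E_mul_E_of_ne (by decide), ← hd, hE0, map_zero, zero_mul, zero_add] at h
        have h' := congrArg (od 2) h
        rw [od_E_mul, map_zero, if_neg (by decide), eq_comm,
          smul_eq_zero_iff_right (by norm_num)] at h'
        exact h')
  have hE : ∀ i, d (E i) = 0 := by
    have h := der_idMat δ
    rw [idMat_eq, Fin.sum_univ_three, map_add, map_add, ← hd, hE0, hE1, zero_add, zero_add] at h
    intro i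
    fin_cases i
    · exact hE0
    · exact hE1
    · exact h
  have hF := der_F_of_der_E hE
  rw [← hd] at hF
  have hskew (i : Fin 3) (a b : Octonion) :
      dot a (od i (d (F i b))) = -dot b (od i (d (F i a))) := by
    have h := inn_der δ (F i a) (F i b)
    rw [inn_comm, inn_F_left, inn_F_left] at h
    linarith
  have hF0 (a : Octonion) : d (F 0 a) = 0 := by
    have hu (k : Fin 8) : od 0 (d (F 0 (u k))) = 0 := by
      apply eq_zero_of_dot_basis u
      intro i
      rcases lt_trichotomy i k with h | h | h
      · exact p4 ⟨(i, k), h⟩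
      · subst h; linarith [hskew 0 (u i) (u i)]
      · rw [hskew, p4 ⟨(k, i), h⟩, neg_zero]
    let f : Octonion →ₗ[ℝ] Octonion :=
      { toFun := fun a => od 0 (d (F 0 a))
        map_add' := fun a b => by simp [F_add]
        map_smul' := fun c a => by simp [F_smul] }
    have hf : f = 0 := u.ext fun k => hu k
    have : od 0 (d (F 0 a)) = 0 := congrArg (fun g => g a) hf
    rw [hF, this]
    apply ext_coords <;> intro k <;> simp
  have hF12 (a b : Octonion) : d (F 2 (star (a * b))) = F 2 (star (a * od 1 (d (F 1 b)))) := by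
    have h := der_mul δ (F 0 a) (F (0 + 1) b)
    rw [F_mul_F_add1, ← hd, hF0, zero_mul, map_smul] at h
    have h' : (1 / 2 : ℝ) • d (F 2 (star (a * b))) = 0 + F 0 a * d (F 1 b) := h
    rw [zero_add, hF 1 b] at h'
    replace h' := h'.trans (F_mul_F_add1 0 a (od 1 (d (F 1 b))))
    exact smul_right_injective Albert (by norm_num : (1 / 2 : ℝ) ≠ 0) h'
  -- The products `F 0 a ∘ F 1 b` and `F 0 1 ∘ F 1 (a b)` are equal, so their derivatives can be
  -- compared.
  have hB (a b : Octonion) : od 1 (d (F 1 (a * b))) = a * od 1 (d (F 1 b)) := by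
    have h1 := hF12 a b
    have h2 := hF12 1 (a * b)
    rw [one_mul, one_mul] at h2
    have h3 := congrArg (od 2) (h2.symm.trans h1)
    rw [od_F, od_F, Pi.single_eq_same, Pi.single_eq_same] at h3
    exact star_injective h3
  have hB1 (a : Octonion) : od 1 (d (F 1 a)) = a * od 1 (d (F 1 1)) := by
    rw [← hB, mul_one]
  have hc : od 1 (d (F 1 1)) = 0 := by
    have h1 := eq_re_of_nucleus (c := od 1 (d (F 1 1))) (fun a b => by
      rw [← hB1, hB, hB1 b])
    have h2 := hskew 1 1 1
    have h3 : dot 1 (od 1 (d (F 1 1))) = re (od 1 (d (F 1 1))) := by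
      rw [dot_apply, one_mul, Octonion.re_star]
    rw [h1, show re (od 1 (d (F 1 1))) = 0 by linarith, zero_smul]
  have hF1 (a : Octonion) : d (F 1 a) = 0 := by
    rw [hF, hB1, hc, mul_zero]
    apply ext_coords <;> intro k <;> simp
  have hF2 (a : Octonion) : d (F 2 a) = 0 := by
    have h := hF12 1 (star a)
    rw [one_mul, star_star, hF1, map_zero, mul_zero, star_zero] at h
    rw [h]
    apply ext_coords <;> intro k <;> simp
  apply der_ext
  intro x
  rw [← hd, eq_sum_E_F x, Fin.sum_univ_three]
  simp [hE, hF0, hF1, hF2]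

/-- The inner derivations `[L_{E i}, L_{F k a}]` realize the 24 octonionic coordinates. The
derivations `[L_{F 0 a}, L_{F 0 b}]` kill the idempotents and act on the block `F 0` as
infinitesimal rotations in the plane of `a, b`, which adjusts the remaining 28 parameters. -/
theorem derParam_surjective (u : Module.Basis (Fin 8) ℝ Octonion)
    (hu : ∀ i j, dot (u i) (u j) = if i = j then 1 else 0) :
    Function.Surjective (derParam u) := by
  have hrot (a b c : Octonion) : (innerDer (F 0 a) (F 0 b) : Module.End ℝ Albert) (F 0 c) =
      F 0 (dot b c • a - dot a c • b) := by
    rw [innerDer_apply, F_mul_F_self, F_mul_F_self, mul_smul_comm, mul_smul_comm, mul_add, mul_add,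
      mul_comm (F 0 a), mul_comm (F 0 a), mul_comm (F 0 b), mul_comm (F 0 b),
      E_mul_F_of_ne (by decide), E_mul_F_of_ne (by decide), E_mul_F_of_ne (by decide),
      E_mul_F_of_ne (by decide), sub_eq_add_neg (dot b c • a), F_add, ← neg_smul, F_smul, F_smul]
    module
  have hrotE (a b : Octonion) (i : Fin 3) :
      (innerDer (F 0 a) (F 0 b) : Module.End ℝ Albert) (E i) = 0 := by
    rw [innerDer_apply, mul_comm _ (E i), mul_comm _ (E i)]
    rcases eq_or_ne i 0 with rfl | hi
    · rw [E_mul_F_self, E_mul_F_self]; simp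
    · rw [E_mul_F_of_ne hi, E_mul_F_of_ne hi, mul_smul_comm, mul_smul_comm, mul_comm (F 0 a),
        sub_self]
  have hself {i k : Fin 3} (hik : i ≠ k) (a : Octonion) :
      (innerDer (E i) (F k a) : Module.End ℝ Albert) (E i) = (-(1 / 4) : ℝ) • F k a := by
    rw [innerDer_apply, E_mul_E, mul_comm (F k a), E_mul_F_of_ne hik, mul_smul_comm,
      E_mul_F_of_ne hik]
    module
  have hne₀ {i k : Fin 3} (hik : i ≠ k) (a : Octonion) :
      (innerDer (E i) (F k a) : Module.End ℝ Albert) (E k) = 0 := by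
    rw [innerDer_apply, E_mul_E_of_ne hik, mul_comm (F k a), E_mul_F_self, mul_zero, mul_zero,
      sub_zero]
  have hne {i k l : Fin 3} (hik : i ≠ k) (hil : i ≠ l) (hlk : l ≠ k) (a : Octonion) :
      (innerDer (E i) (F k a) : Module.End ℝ Albert) (E l) = (1 / 4 : ℝ) • F k a := by
    rw [innerDer_apply, E_mul_E_of_ne hil, mul_comm (F k a), E_mul_F_of_ne hlk, mul_smul_comm,
      E_mul_F_of_ne hik, mul_zero, sub_zero]
    module
  rintro ⟨a, b, c, m⟩
  -- The factor `-4` cancels the `-1/4` by which `[L_{E i}, L_{F k a}]` sends `E i` to `F k a`.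
  let δ₁ : Der Albert :=
    (-4 : ℝ) • (innerDer (E 0) (F 1 a) + innerDer (E 0) (F 2 b) + innerDer (E 1) (F 0 c))
  let m₁ := (derParam u δ₁).2.2.2
  -- The rotations also correct the parameters `m₁` that `δ₁` may already have.
  let δ₂ : Der Albert := ∑ p : IncPair, (m p - m₁ p) • innerDer (F 0 (u p.1.1)) (F 0 (u p.1.2))
  have h1 : derParam u δ₁ = (a, b, c, m₁) := by
    refine Prod.ext ?_ (Prod.ext ?_ (Prod.ext ?_ rfl))
    · show od 1 ((-4 : ℝ) • ((innerDer (E 0) (F 1 a) : Module.End ℝ Albert) (E 0)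
        + (innerDer (E 0) (F 2 b) : Module.End ℝ Albert) (E 0)
        + (innerDer (E 1) (F 0 c) : Module.End ℝ Albert) (E 0))) = a
      rw [hself (by decide), hself (by decide), hne₀ (by decide)]
      simp [od_F, smul_smul]
    · show od 2 ((-4 : ℝ) • ((innerDer (E 0) (F 1 a) : Module.End ℝ Albert) (E 0)
        + (innerDer (E 0) (F 2 b) : Module.End ℝ Albert) (E 0)
        + (innerDer (E 1) (F 0 c) : Module.End ℝ Albert) (E 0))) = b
      rw [hself (by decide), hself (by decide), hne₀ (by decide)]
      simp [od_F, smul_smul]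
    · show od 0 ((-4 : ℝ) • ((innerDer (E 0) (F 1 a) : Module.End ℝ Albert) (E 1)
        + (innerDer (E 0) (F 2 b) : Module.End ℝ Albert) (E 1)
        + (innerDer (E 1) (F 0 c) : Module.End ℝ Albert) (E 1))) = c
      rw [hself (by decide), hne₀ (by decide), hne (by decide) (by decide) (by decide)]
      simp [od_F, smul_smul]
  have h2 : derParam u δ₂ = (0, 0, 0, fun p => m p - m₁ p) := by
    have hp (p : IncPair) : derParam u (innerDer (F 0 (u p.1.1)) (F 0 (u p.1.2))) =
        (0, 0, 0, Pi.single p 1) := by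
      refine Prod.ext ?_ (Prod.ext ?_ (Prod.ext ?_ ?_))
      · exact congrArg (od 1) (hrotE _ _ _) |>.trans (map_zero _)
      · exact congrArg (od 2) (hrotE _ _ _) |>.trans (map_zero _)
      · exact congrArg (od 0) (hrotE _ _ _) |>.trans (map_zero _)
      · ext1 q
        show dot (u q.1.1) (od 0 ((innerDer (F 0 (u p.1.1)) (F 0 (u p.1.2)) :
          Module.End ℝ Albert) (F 0 (u q.1.2)))) = (Pi.single p 1 : IncPair → ℝ) q
        rw [hrot, od_F, Pi.single_eq_same]
        simp only [map_sub, map_smul, smul_eq_mul, hu, Pi.single_apply]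
        obtain ⟨⟨p1, p2⟩, hp⟩ := p
        obtain ⟨⟨q1, q2⟩, hq⟩ := q
        simp only [Subtype.mk.injEq, Prod.mk.injEq] at hp hq ⊢
        split_ifs <;> first | omega | norm_num
    rw [map_sum]
    simp only [map_smul, hp]
    refine Prod.ext ?_ (Prod.ext ?_ (Prod.ext ?_ ?_)) <;> [skip; skip; skip; ext1 q] <;>
    simp [Prod.fst_sum, Prod.snd_sum, Finset.sum_apply, Pi.single_apply]
  refine ⟨δ₁ + δ₂, ?_⟩
  rw [map_add, h1, h2]
  refine Prod.ext ?_ (Prod.ext ?_ (Prod.ext ?_ ?_)) <;> [skip; skip; skip; ext1 p] <;> simp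

theorem finrank_der : Module.finrank ℝ (Der Albert) = 52 := by
  obtain ⟨u, hu⟩ := exists_orthonormal
  have e := LinearEquiv.ofBijective (derParam u)
    ⟨derParam_injective u, derParam_surjective u hu⟩
  have hc : Fintype.card IncPair = 28 := by decide
  have h := e.finrank_eq
  rw [Module.finrank_prod, Module.finrank_prod, Module.finrank_prod, Octonion.finrank_eq,
    Module.finrank_fintype_fun_eq_card, hc] at h
  exact h

theorem finrank_traceless : Module.finrank ℝ traceless = 26 := by
  have h := LinearMap.finrank_range_add_finrank_ker tr
  have hr : LinearMap.range tr = ⊤ := LinearMap.range_eq_top.2 fun r =>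
    ⟨(r / 3) • idMat, by rw [map_smul, tr_idMat, smul_eq_mul]; ring⟩
  rw [hr, finrank_top, Module.finrank_self, finrank_eq] at h
  have : Module.finrank ℝ (LinearMap.ker tr) = 26 := by omega
  exact this

end Albert


/-! ### The Lie algebra `D(𝔍) ⊕ (ℍ' ⊗ 𝔍)` -/

/-- The Lie algebra `D(𝔍) ⊕ (ℍ' ⊗ 𝔍)`; the pair `(δ, x)` stands for `δ + ∑ hᵢ ⊗ xᵢ`. -/
def TKK : Type := Der Albert × (Fin 3 → Albert)

namespace TKK

noncomputable instance : AddCommGroup TKK :=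
  inferInstanceAs (AddCommGroup (Der Albert × (Fin 3 → Albert)))
noncomputable instance : Module ℝ TKK :=
  inferInstanceAs (Module ℝ (Der Albert × (Fin 3 → Albert)))
instance : Module.Finite ℝ TKK :=
  inferInstanceAs (Module.Finite ℝ (Der Albert × (Fin 3 → Albert)))

@[ext] theorem ext' {X Y : TKK} (h1 : X.1 = Y.1) (h2 : ∀ i, X.2 i = Y.2 i) : X = Y :=
  Prod.ext h1 (funext h2)

@[simp] theorem add_fst (X Y : TKK) : (X + Y).1 = X.1 + Y.1 := rfl
@[simp] theorem add_snd (X Y : TKK) (i : Fin 3) : (X + Y).2 i = X.2 i + Y.2 i := rfl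
@[simp] theorem zero_fst : (0 : TKK).1 = 0 := rfl
@[simp] theorem zero_snd (i : Fin 3) : (0 : TKK).2 i = 0 := rfl
@[simp] theorem smul_fst (c : ℝ) (X : TKK) : (c • X).1 = c • X.1 := rfl
@[simp] theorem smul_snd (c : ℝ) (X : TKK) (i : Fin 3) : (c • X).2 i = c • X.2 i := rfl

/-- The value of a derivation. -/
noncomputable abbrev app (δ : Der Albert) (x : Albert) : Albert := (δ : Module.End ℝ Albert) x

theorem app_add (δ ε : Der Albert) (x : Albert) : app (δ + ε) x = app δ x + app ε x := rfl
theorem app_sub (δ ε : Der Albert) (x : Albert) : app (δ - ε) x = app δ x - app ε x := rfl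
theorem app_zero (x : Albert) : app 0 x = 0 := rfl
theorem app_smul (c : ℝ) (δ : Der Albert) (x : Albert) : app (c • δ) x = c • app δ x := rfl
theorem app_lie (δ ε : Der Albert) (x : Albert) :
    app ⁅δ, ε⁆ x = app δ (app ε x) - app ε (app δ x) := rfl
theorem app_innerDer (x y z : Albert) : app (innerDer x y) z = x * (y * z) - y * (x * z) := rfl

/-- The Tits formula with `D(ℍ)` absorbed: `½ [h, h'] ⊗ (x ∘ y)` is the cross product in the index
`i`, because `[hᵢ, hᵢ₊₁] = 2 hᵢ₊₂`, and `-⟨h, h'⟩ [L_x, L_y]` is the sum of inner derivations. -/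
noncomputable instance : Bracket TKK TKK where
  bracket X Y := (⁅X.1, Y.1⁆ - ∑ i, innerDer (X.2 i) (Y.2 i),
    fun i => app X.1 (Y.2 i) - app Y.1 (X.2 i)
      + X.2 (i + 1) * Y.2 (i + 2) - X.2 (i + 2) * Y.2 (i + 1))

theorem lie_fst (X Y : TKK) : ⁅X, Y⁆.1 = ⁅X.1, Y.1⁆ - ∑ i, innerDer (X.2 i) (Y.2 i) := rfl
theorem lie_snd (X Y : TKK) (i : Fin 3) : ⁅X, Y⁆.2 i = app X.1 (Y.2 i) - app Y.1 (X.2 i)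
      + X.2 (i + 1) * Y.2 (i + 2) - X.2 (i + 2) * Y.2 (i + 1) := rfl

section Leibniz

variable {A G : Type*} [NonUnitalNonAssocCommRing A] [AddCommGroup G]

/-- The `D(𝔍)`-component of the Jacobi identity, with `T` in the role of `[L_x, L_y]` and `q1`, `q2`
double commutators of derivations. Skewness and the cyclic relation rewrite `T (a b) c` as `T a (b
c) + T b (a c)`, after which all terms cancel. -/
theorem leibniz_fst_aux (T : A →+ A →+ G) (hs : ∀ a b, T a b = -T b a)
    (hc : ∀ a b c, T a (b * c) + T b (c * a) + T c (a * b) = 0) (dx dy dz : A →+ A) (q1 q2 : G)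
    (a0 a1 a2 b0 b1 b2 c0 c1 c2 : A) :
    q1 - (T (dx b0) c0 + T b0 (dx c0) + (T (dx b1) c1 + T b1 (dx c1))
        + (T (dx b2) c2 + T b2 (dx c2)))
      - (T a0 (dy c0 - dz b0 + b1 * c2 - b2 * c1) + T a1 (dy c1 - dz b1 + b2 * c0 - b0 * c2)
        + T a2 (dy c2 - dz b2 + b0 * c1 - b1 * c0)) =
    q1 - q2 - (-(T (dz a0) b0 + T a0 (dz b0)) + -(T (dz a1) b1 + T a1 (dz b1))
        + -(T (dz a2) b2 + T a2 (dz b2)))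
      - (T (dx b0 - dy a0 + a1 * b2 - a2 * b1) c0 + T (dx b1 - dy a1 + a2 * b0 - a0 * b2) c1
        + T (dx b2 - dy a2 + a0 * b1 - a1 * b0) c2)
      + (q2 - (T (dy a0) c0 + T a0 (dy c0) + (T (dy a1) c1 + T a1 (dy c1))
        + (T (dy a2) c2 + T a2 (dy c2)))
      - (T b0 (dx c0 - dz a0 + a1 * c2 - a2 * c1) + T b1 (dx c1 - dz a1 + a2 * c0 - a0 * c2)
        + T b2 (dx c2 - dz a2 + a0 * c1 - a1 * c0))) := by
  have h (a b c : A) : T (a * b) c = T a (b * c) + T b (a * c) := by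
    have h1 := hc a b c
    rw [hs (a * b) c, mul_comm a c]
    rw [add_eq_zero_iff_eq_neg] at h1
    exact h1.symm
  simp only [map_add, map_sub, AddMonoidHom.add_apply, AddMonoidHom.sub_apply, h, hs (dz _) _]
  abel

/-- The `ℍ' ⊗ 𝔍`-component needs only commutativity and the Leibniz rule; the Jordan identity plays
no role here. -/
theorem leibniz_snd_aux (dx dy dz : A →+ A) (hx : ∀ a b, dx (a * b) = dx a * b + a * dx b)
    (hy : ∀ a b, dy (a * b) = dy a * b + a * dy b) (hz : ∀ a b, dz (a * b) = dz a * b + a * dz b)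
    (a0 a1 a2 b0 b1 b2 c0 c1 c2 : A) :
    dx (dy c0 - dz b0 + b1 * c2 - b2 * c1)
      - (dy (dz a0) - dz (dy a0) - (b0 * (c0 * a0) - c0 * (b0 * a0) + (b1 * (c1 * a0)
        - c1 * (b1 * a0)) + (b2 * (c2 * a0) - c2 * (b2 * a0))))
      + a1 * (dy c2 - dz b2 + b0 * c1 - b1 * c0) - a2 * (dy c1 - dz b1 + b2 * c0 - b0 * c2) =
    (dx (dy c0) - dy (dx c0) - (a0 * (b0 * c0) - b0 * (a0 * c0) + (a1 * (b1 * c0)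
        - b1 * (a1 * c0)) + (a2 * (b2 * c0) - b2 * (a2 * c0)))
      - dz (dx b0 - dy a0 + a1 * b2 - a2 * b1)
      + (dx b1 - dy a1 + a2 * b0 - a0 * b2) * c2 - (dx b2 - dy a2 + a0 * b1 - a1 * b0) * c1)
    + (dy (dx c0 - dz a0 + a1 * c2 - a2 * c1)
      - (dx (dz b0) - dz (dx b0) - (a0 * (c0 * b0) - c0 * (a0 * b0) + (a1 * (c1 * b0)
        - c1 * (a1 * b0)) + (a2 * (c2 * b0) - c2 * (a2 * b0))))
      + b1 * (dx c2 - dz a2 + a0 * c1 - a1 * c0) - b2 * (dx c1 - dz a1 + a2 * c0 - a0 * c2)) := by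
  simp only [map_add, map_sub, hx, hy, hz, mul_add, mul_sub, add_mul, sub_mul]
  simp only [mul_comm]
  abel

end Leibniz

theorem leibniz_fst (X Y Z : TKK) : ⁅X, ⁅Y, Z⁆⁆.1 = ⁅⁅X, Y⁆, Z⁆.1 + ⁅Y, ⁅X, Z⁆⁆.1 := by
  let T : Albert →+ Albert →+ Der Albert :=
    AddMonoidHom.mk' (fun x => (innerDer x).toAddMonoidHom) (fun x y => by ext1 z; simp)
  have h := leibniz_fst_aux T innerDer_skew innerDer_cyclic
    (X.1 : Module.End ℝ Albert).toAddMonoidHom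
    (Y.1 : Module.End ℝ Albert).toAddMonoidHom (Z.1 : Module.End ℝ Albert).toAddMonoidHom
    ⁅X.1, ⁅Y.1, Z.1⁆⁆ ⁅Y.1, ⁅X.1, Z.1⁆⁆ (X.2 0) (X.2 1) (X.2 2) (Y.2 0) (Y.2 1) (Y.2 2)
    (Z.2 0) (Z.2 1) (Z.2 2)
  have e (a b : Albert) (δ : Der Albert) : ⁅innerDer a b, δ⁆ =
      -(innerDer (app δ a) b + innerDer a (app δ b)) := by
    rw [← lie_skew, lie_innerDer]
  simp only [lie_fst, Fin.sum_univ_three, lie_sub, sub_lie, lie_add, add_lie, lie_innerDer, e,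
    lie_lie]
  exact h

theorem leibniz_snd (X Y Z : TKK) (i : Fin 3) :
    ⁅X, ⁅Y, Z⁆⁆.2 i = ⁅⁅X, Y⁆, Z⁆.2 i + ⁅Y, ⁅X, Z⁆⁆.2 i := by
  have h := leibniz_snd_aux (X.1 : Module.End ℝ Albert).toAddMonoidHom
    (Y.1 : Module.End ℝ Albert).toAddMonoidHom (Z.1 : Module.End ℝ Albert).toAddMonoidHom
    (der_mul X.1) (der_mul Y.1) (der_mul Z.1) (X.2 i) (X.2 (i + 1)) (X.2 (i + 2))
    (Y.2 i) (Y.2 (i + 1)) (Y.2 (i + 2)) (Z.2 i) (Z.2 (i + 1)) (Z.2 (i + 2))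
  simp only [lie_fst, lie_snd, fin3_sum _ i, fin3_add11, fin3_add12, fin3_add21, fin3_add22,
    app_sub, app_add, app_lie, app_innerDer]
  exact h

noncomputable instance : LieRing TKK where
  add_lie X Y Z := by
    apply ext'
    · simp only [lie_fst, add_fst, add_snd, add_lie, map_add, LinearMap.add_apply,
        Finset.sum_add_distrib]
      abel
    · intro i
      simp only [lie_snd, add_fst, add_snd, app_add, add_mul, map_add]
      abel
  lie_add X Y Z := by
    apply ext'
    · simp only [lie_fst, add_fst, add_snd, lie_add, map_add, LinearMap.add_apply,
        Finset.sum_add_distrib]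
      abel
    · intro i
      simp only [lie_snd, add_fst, add_snd, app_add, mul_add, map_add]
      abel
  lie_self X := by
    have h (a : Albert) : innerDer a a = 0 := by
      apply der_ext; intro z
      exact sub_self _
    apply ext'
    · simp only [lie_fst, lie_self, h, Finset.sum_const_zero, sub_zero, zero_fst]
    · intro i
      simp only [lie_snd, zero_snd, mul_comm (X.2 (i + 1))]
      abel
  leibniz_lie X Y Z := by
    apply ext'
    · exact leibniz_fst X Y Z
    · exact leibniz_snd X Y Z

noncomputable instance : LieAlgebra ℝ TKK where
  lie_smul c X Y := by
    apply ext'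
    · simp only [lie_fst, smul_fst, smul_snd, lie_smul, map_smul, smul_sub, Finset.smul_sum]
    · intro i
      simp only [lie_snd, smul_fst, smul_snd, app_smul, map_smul, smul_mul_assoc, mul_smul_comm,
        smul_sub, smul_add]

end TKK


/-! ### Invariant inner product, negative Killing form and simplicity -/

theorem exists_orthogonal_of_ne_top {V : Type*} [AddCommGroup V] [Module ℝ V]
    [FiniteDimensional ℝ V] (B : LinearMap.BilinForm ℝ V) (hs : ∀ x y, B x y = B y x)
    (hp : ∀ x, x ≠ 0 → 0 < B x x) (W : Submodule ℝ V) (hW : W ≠ ⊤) :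
    ∃ v, v ≠ 0 ∧ ∀ w ∈ W, B w v = 0 := by
  obtain ⟨f, hf, hWf⟩ := Submodule.exists_le_ker_of_lt_top W hW.lt_top
  have hinj : Function.Injective B := by
    rw [← LinearMap.ker_eq_bot, LinearMap.ker_eq_bot']
    intro x hx
    by_contra h
    have := hp x h
    rw [hx] at this
    exact lt_irrefl _ this
  have hsurj : Function.Surjective B :=
    (LinearMap.injective_iff_surjective_of_finrank_eq_finrank
      (Subspace.dual_finrank_eq (K := ℝ) (V := V)).symm).1 hinj
  obtain ⟨v, rfl⟩ := hsurj f
  refine ⟨v, fun h => hf (by rw [h, map_zero]), fun w hw => ?_⟩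
  rw [hs]
  exact hWf hw

namespace Albert

/-- The trace form of the derivations on the Jordan algebra, with reversed sign. -/
noncomputable def derForm : LinearMap.BilinForm ℝ (Der Albert) :=
  LinearMap.mk₂ ℝ (fun δ ε => -LinearMap.trace ℝ Albert
      ((δ : Module.End ℝ Albert) * (ε : Module.End ℝ Albert)))
    (fun δ δ' ε => by simp [add_mul]; ring) (fun c δ ε => by simp)
    (fun δ ε ε' => by simp [mul_add]; ring) (fun c δ ε => by simp)

theorem derForm_apply (δ ε : Der Albert) : derForm δ ε = -LinearMap.trace ℝ Albert
      ((δ : Module.End ℝ Albert) * (ε : Module.End ℝ Albert)) := rfl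

theorem derForm_comm (δ ε : Der Albert) : derForm δ ε = derForm ε δ := by
  rw [derForm_apply, derForm_apply, LinearMap.trace_mul_comm]

theorem derForm_self_pos (δ : Der Albert) (h : δ ≠ 0) : 0 < derForm δ δ := by
  rw [derForm_apply, Left.neg_pos_iff]
  exact trace_der_mul_self_neg δ h

theorem derForm_lie (δ ε ζ : Der Albert) : derForm ⁅δ, ε⁆ ζ = derForm δ ⁅ε, ζ⁆ :=
  congrArg Neg.neg (LinearMap.trace_lie_mul_eq (δ : Module.End ℝ Albert) ε ζ)

theorem derForm_innerDer (x y : Albert) (δ : Der Albert) :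
    derForm (innerDer x y) δ = 3 * inn x ((δ : Module.End ℝ Albert) y) := by
  rw [derForm_apply, trace_innerDer_mul, neg_neg]

/-- All derivations are inner. -/
theorem eq_top_of_innerDer_mem (W : Submodule ℝ (Der Albert)) (h : ∀ x y, innerDer x y ∈ W) :
    W = ⊤ := by
  by_contra hW
  -- A derivation `δ` orthogonal to every `[L_z, L_y]` satisfies `⟨z, δ y⟩ = 0` for all `y` and `z`.
  obtain ⟨δ, h0, hδ⟩ := exists_orthogonal_of_ne_top derForm derForm_comm derForm_self_pos W hW
  apply h0
  apply der_ext
  intro y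
  apply eq_of_inn
  intro z
  have := hδ _ (h z y)
  rw [derForm_innerDer] at this
  rw [inn_comm]
  simpa using this

end Albert

namespace TKK

@[simp] theorem neg_fst (X : TKK) : (-X).1 = -X.1 := rfl
@[simp] theorem neg_snd (X : TKK) (i : Fin 3) : (-X).2 i = -X.2 i := rfl

/-- An invariant inner product. -/
noncomputable def form : LinearMap.BilinForm ℝ TKK :=
  LinearMap.mk₂ ℝ (fun X Y => derForm X.1 Y.1 + 3 * ∑ i, inn (X.2 i) (Y.2 i))
    (fun X X' Y => by simp [Finset.sum_add_distrib]; ring)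
    (fun c X Y => by simp [← Finset.mul_sum]; ring)
    (fun X Y Y' => by simp [Finset.sum_add_distrib]; ring)
    (fun c X Y => by simp [← Finset.mul_sum]; ring)

theorem form_apply (X Y : TKK) :
    form X Y = derForm X.1 Y.1 + 3 * ∑ i, inn (X.2 i) (Y.2 i) := rfl

theorem form_comm (X Y : TKK) : form X Y = form Y X := by
  simp only [form_apply, derForm_comm X.1, inn_comm (X.2 _)]

theorem form_self_pos (X : TKK) (h : X ≠ 0) : 0 < form X X := by
  rw [form_apply]
  have hn : 0 ≤ ∑ i, inn (X.2 i) (X.2 i) := Finset.sum_nonneg fun i _ => inn_self_nonneg _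
  by_cases h1 : X.1 = 0
  · obtain ⟨i, hi⟩ : ∃ i, X.2 i ≠ 0 := by
      by_contra! h2
      exact h (ext' h1 h2)
    have : 0 < ∑ i, inn (X.2 i) (X.2 i) :=
      Finset.sum_pos' (fun i _ => inn_self_nonneg _) ⟨i, Finset.mem_univ i, inn_self_pos hi⟩
    rw [h1, map_zero]
    linarith
  · linarith [derForm_self_pos X.1 h1]

/-- The weight 3 in `form` is forced by `derForm_innerDer`, which pairs inner derivations with `3
⟨x, δ y⟩`. The triple products cancel by associativity of the trace form. -/
theorem form_lie (X Y Z : TKK) : form ⁅X, Y⁆ Z = form X ⁅Y, Z⁆ := by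
  simp only [form_apply, lie_fst, lie_snd, fin3_sum _ (0 : Fin 3), fin3_add11, fin3_add12,
    fin3_add21, fin3_add22, map_add, map_sub, LinearMap.add_apply, LinearMap.sub_apply,
    derForm_innerDer, derForm_lie, derForm_comm X.1 (innerDer _ _), inn_mul, inn_der]
  simp only [app]
  rw [mul_comm (Y.2 0), mul_comm (Y.2 0), mul_comm (Y.2 (0 + 1)) (Z.2 0)]
  ring

theorem form_lie_skew (X Y Z : TKK) : form ⁅X, Y⁆ Z = -form Y ⁅X, Z⁆ := by
  rw [← lie_skew, map_neg, LinearMap.neg_apply, form_lie]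

/-- The element `hᵢ ⊗ x`. -/
noncomputable def h (i : Fin 3) : Albert →ₗ[ℝ] TKK where
  toFun x := (0, Pi.single i x)
  map_add' x y := by
    apply ext'
    · exact (add_zero 0).symm
    · intro k
      show (Pi.single i (x + y) : Fin 3 → Albert) k = _
      rw [Pi.single_add]; rfl
  map_smul' c x := by
    apply ext'
    · exact (smul_zero c).symm
    · intro k
      show (Pi.single i (c • x) : Fin 3 → Albert) k = _
      rw [Pi.single_smul]; rfl

@[simp] theorem h_fst (i : Fin 3) (x : Albert) : (h i x).1 = 0 := rfl
theorem h_snd (i k : Fin 3) (x : Albert) : (h i x).2 k = (Pi.single i x : Fin 3 → Albert) k := rfl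
@[simp] theorem h_snd_self (i : Fin 3) (x : Albert) : (h i x).2 i = x := Pi.single_eq_same _ _
@[simp] theorem h_snd_add1 (i : Fin 3) (x : Albert) : (h i x).2 (i + 1) = 0 :=
  Pi.single_eq_of_ne (fin3_ne_add1 i).symm _
@[simp] theorem h_snd_add2 (i : Fin 3) (x : Albert) : (h i x).2 (i + 2) = 0 :=
  Pi.single_eq_of_ne (fin3_ne_add2 i).symm _
@[simp] theorem h_add1_snd (i : Fin 3) (x : Albert) : (h (i + 1) x).2 i = 0 :=
  Pi.single_eq_of_ne (fin3_ne_add1 i) _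
@[simp] theorem h_add2_snd (i : Fin 3) (x : Albert) : (h (i + 2) x).2 i = 0 :=
  Pi.single_eq_of_ne (fin3_ne_add2 i) _
@[simp] theorem h_add1_snd_add2 (i : Fin 3) (x : Albert) : (h (i + 1) x).2 (i + 2) = 0 :=
  Pi.single_eq_of_ne (fin3_add1_ne_add2 i).symm _
@[simp] theorem h_add2_snd_add1 (i : Fin 3) (x : Albert) : (h (i + 2) x).2 (i + 1) = 0 :=
  Pi.single_eq_of_ne (fin3_add1_ne_add2 i) _

/-- A derivation, as an element of the Lie algebra. -/
noncomputable def ofDer : Der Albert →ₗ[ℝ] TKK where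
  toFun δ := (δ, 0)
  map_add' x y := by
    apply ext'
    · rfl
    · exact fun k => (add_zero (0 : Albert)).symm
  map_smul' c x := by
    apply ext'
    · rfl
    · exact fun k => (smul_zero c).symm

@[simp] theorem ofDer_fst (δ : Der Albert) : (ofDer δ).1 = δ := rfl
@[simp] theorem ofDer_snd (δ : Der Albert) (i : Fin 3) : (ofDer δ).2 i = 0 := rfl

theorem ext_at (i : Fin 3) {X Y : TKK} (h1 : X.1 = Y.1) (h2 : X.2 i = Y.2 i)
    (h3 : X.2 (i + 1) = Y.2 (i + 1)) (h4 : X.2 (i + 2) = Y.2 (i + 2)) : X = Y := by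
  apply ext' h1
  intro k
  rcases fin3_cases i k with rfl | rfl | rfl <;> assumption

theorem eq_sum (X : TKK) : X = ofDer X.1 + ∑ i, h i (X.2 i) := by
  have key (i : Fin 3) : X = ofDer X.1
      + (h i (X.2 i) + h (i + 1) (X.2 (i + 1)) + h (i + 2) (X.2 (i + 2))) := by
    apply ext_at i <;> simp
  rw [fin3_sum _ (0 : Fin 3)]
  exact key 0

theorem lie_ofDer_h (δ : Der Albert) (i : Fin 3) (x : Albert) :
    ⁅ofDer δ, h i x⁆ = h i (app δ x) := by
  apply ext_at i <;> simp [lie_fst, lie_snd, app_zero, fin3_add11, fin3_add12, fin3_add21,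
    fin3_add22]

theorem lie_ofDer_ofDer (δ ε : Der Albert) : ⁅ofDer δ, ofDer ε⁆ = ofDer ⁅δ, ε⁆ := by
  apply ext' <;> [skip; intro i] <;> simp [lie_fst, lie_snd]

theorem lie_h_h_self (i : Fin 3) (x y : Albert) : ⁅h i x, h i y⁆ = -ofDer (innerDer x y) := by
  apply ext_at i <;> simp [lie_fst, lie_snd, app_zero, fin3_add11, fin3_add12, fin3_add21,
    fin3_add22, fin3_sum _ i]

theorem lie_h_h_add1 (i : Fin 3) (x y : Albert) : ⁅h i x, h (i + 1) y⁆ = h (i + 2) (x * y) := by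
  apply ext_at i <;> simp [lie_fst, lie_snd, app_zero, fin3_add11, fin3_add12, fin3_add21,
    fin3_add22, fin3_sum _ i]

theorem lie_h_h_add2 (i : Fin 3) (x y : Albert) : ⁅h i x, h (i + 2) y⁆ = -h (i + 1) (x * y) := by
  apply ext_at i <;> simp [lie_fst, lie_snd, app_zero, fin3_add11, fin3_add12, fin3_add21,
    fin3_add22, fin3_sum _ i]

theorem lie_h_ofDer (δ : Der Albert) (i : Fin 3) (x : Albert) :
    ⁅h i x, ofDer δ⁆ = -h i (app δ x) := by
  rw [← lie_skew, lie_ofDer_h]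

/-- Bracketing with `hᵢ ⊗ I₃` exposes the neighbouring components of `X`; bracketing with `h₁ ⊗ y`
exposes its derivation part. -/
theorem eq_zero_of_lie_eq_zero {X : TKK} (hX : ∀ Y : TKK, ⁅X, Y⁆ = 0) : X = 0 := by
  have h2 (i : Fin 3) : X.2 (i + 2) = 0 := by
    have e := congrArg (fun Z : TKK => Z.2 (i + 1)) (hX (h i idMat))
    simpa [lie_snd, fin3_add11, fin3_add12, mul_idMat, app_zero] using e
  apply ext'
  · apply der_ext
    intro y
    have e := congrArg (fun Z : TKK => Z.2 0) (hX (h 0 y))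
    simp only [lie_snd, h_snd_self, h_fst, h_snd_add1, h_snd_add2, mul_zero, add_zero, sub_zero,
      app_zero] at e
    exact e
  · intro i
    have e := h2 (i + 1)
    rwa [fin3_add12] at e

/-- `ad X` is skew for a positive definite form and nonzero because the centre is trivial. -/
theorem killingForm_neg (X : TKK) (hX : X ≠ 0) : killingForm ℝ TKK X X < 0 := by
  rw [killingForm_apply_apply]
  refine trace_mul_self_neg_of_skew form form_comm form_self_pos (LieAlgebra.ad ℝ TKK X)
    (form_lie_skew X) (fun h0 => hX (eq_zero_of_lie_eq_zero fun Y => ?_))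
  exact congrArg (fun f : Module.End ℝ TKK => f Y) h0

/-- A nonzero ideal contains some `hᵢ ⊗ x` with `x ≠ 0`, hence `hₖ ⊗ x` for all `k` by rotating with
`h ⊗ I₃`. Simplicity of `𝔍` then gives all of `ℍ' ⊗ 𝔍`, and brackets within it give all inner
derivations, which exhaust `D(𝔍)`. -/
theorem ideal_eq_bot_or_eq_top (I : LieIdeal ℝ TKK) : I = ⊥ ∨ I = ⊤ := by
  rw [or_iff_not_imp_left]
  intro hI
  have hl (X Y : TKK) (hY : Y ∈ I) : ⁅X, Y⁆ ∈ I := lie_mem_right ℝ TKK I X Y hY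
  have hcomp (X : TKK) (hX : X ∈ I) (i : Fin 3) : h i (X.2 i) ∈ I := by
    -- `(ad (hₖ ⊗ I₃))²` kills the derivation part and the component `k` and negates the other two
    -- components. Using it for both `k = i + 1` and `k = i + 2` leaves the component `i` with sign
    -- `+`.
    have h1 := hl (h (i + 2) idMat) _ (hl (h (i + 2) idMat) _
      (hl (h (i + 1) idMat) _ (hl (h (i + 1) idMat) _ hX)))
    convert h1 using 1
    apply ext_at i <;> simp [lie_fst, lie_snd, app_zero, fin3_add11, fin3_add12, fin3_add21,
      fin3_add22, fin3_sum _ i, der_idMat, idMat_mul]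
  have hex : ∃ i x, x ≠ 0 ∧ h i x ∈ I := by
    obtain ⟨X, hX, hX0⟩ := (LieSubmodule.eq_bot_iff I).not.1 hI |> fun h => by
      push Not at h; exact h
    by_cases h2 : ∃ i, X.2 i ≠ 0
    · obtain ⟨i, hi⟩ := h2
      exact ⟨i, _, hi, hcomp X hX i⟩
    · push Not at h2
      have h1 : X.1 ≠ 0 := fun h1 => hX0 (ext' h1 h2)
      obtain ⟨y, hy⟩ : ∃ y, app X.1 y ≠ 0 := by
        by_contra! h3
        exact h1 (der_ext h3)
      refine ⟨0, _, hy, ?_⟩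
      have e : X = ofDer X.1 := ext' rfl h2
      rw [e] at hX
      have h4 := hl (h 0 y) _ hX
      rw [lie_h_ofDer] at h4
      exact I.neg_mem_iff.1 h4
  have hrot (i : Fin 3) (x : Albert) (hx : h i x ∈ I) : h (i + 1) x ∈ I := by
    have h1 := hl (h (i + 2) idMat) _ hx
    have h2 := lie_h_h_add1 (i + 2) idMat x
    rw [fin3_add21, fin3_add22, idMat_mul] at h2
    rwa [h2] at h1
  have hrot' (i k : Fin 3) (x : Albert) (hx : h i x ∈ I) : h k x ∈ I := by
    rcases fin3_cases i k with rfl | rfl | rfl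
    · exact hx
    · exact hrot i x hx
    · rw [← fin3_add11]; exact hrot _ x (hrot i x hx)
  have hall (x : Albert) (i : Fin 3) : h i x ∈ I := by
    -- The elements `x` with `h 0 x ∈ I` form an ideal of `𝔍`, because `[h 1 x, h 2 y] = h 0 (x ∘
    -- y)`.
    let N : Submodule ℝ Albert := I.toSubmodule.comap (h 0)
    have hN : N = ⊤ := by
      apply ideal_eq_top
      · intro x y hy
        have h1 := hl (h 1 x) _ (hrot' 0 2 y hy)
        have h2 := lie_h_h_add1 1 x y
        exact (congrArg (· ∈ I) h2).mp h1
      · obtain ⟨i, x, hx0, hx⟩ := hex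
        rw [Submodule.ne_bot_iff]
        exact ⟨x, hrot' i 0 x hx, hx0⟩
    have : x ∈ N := hN ▸ Submodule.mem_top
    exact hrot' 0 i x this
  have hder (δ : Der Albert) : ofDer δ ∈ I := by
    have hW := eq_top_of_innerDer_mem (I.toSubmodule.comap ofDer) (fun x y => by
      have h1 := hl (h 0 x) _ (hall y 0)
      rw [lie_h_h_self] at h1
      exact I.neg_mem_iff.1 h1)
    have : δ ∈ I.toSubmodule.comap ofDer := hW ▸ Submodule.mem_top
    exact this
  rw [eq_top_iff]
  intro X _
  rw [eq_sum X]
  exact I.add_mem (hder _) (I.toSubmodule.sum_mem fun i _ => hall _ i)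

instance : LieAlgebra.IsSimple ℝ TKK where
  eq_bot_or_eq_top := ideal_eq_bot_or_eq_top
  non_abelian := fun hA => by
    have h1 : h 0 idMat = 0 := eq_zero_of_lie_eq_zero fun Y => hA.trivial _ _
    have h2 := congrArg (fun X : TKK => tr (X.2 0)) h1
    simp at h2

end TKK


/-! ### Quaternion derivations and the comparison with the Tits algebra -/

section Quaternions

theorem quatComm_apply (a b : ℍ[ℝ]) : quatComm a b = a * b - b * a := rfl

theorem quatComm_self (a : ℍ[ℝ]) : quatComm a a = 0 := sub_self _

theorem quatComm_skew (a b : ℍ[ℝ]) : quatComm a b = -quatComm b a := by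
  rw [quatComm_apply, quatComm_apply, neg_sub]

theorem lie_quatComm (a b : ℍ[ℝ]) : ⁅quatComm a, quatComm b⁆ = quatComm (quatComm a b) := by
  ext1 c
  simp only [Ring.lie_def, LinearMap.sub_apply, Module.End.mul_apply, quatComm_apply]
  noncomm_ring

theorem lie_smul_quatComm (r s : ℝ) (a b : ℍ[ℝ]) :
    ⁅r • quatComm a, s • quatComm b⁆ = (r * s) • quatComm (quatComm a b) := by
  rw [← map_smul, ← map_smul, lie_quatComm, LinearMap.map_smul₂, map_smul, map_smul, map_smul,
    smul_smul]

/-- By associativity `[L_h, L_{h'}] = L_{[h, h']}` and `[R_h, R_{h'}] = -R_{[h, h']}`, so `D_{h,h'}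
= ad [h, h']`. -/
theorem quatDer_eq (a b : ℍ[ℝ]) : quatDer a b = quatComm (quatComm a b) := by
  ext1 c
  show a * (b * c) - b * (a * c) + (c * b * a - c * a * b) = _
  simp only [quatComm_apply]
  noncomm_ring

theorem quatComm_mem_der (a : ℍ[ℝ]) : quatComm a ∈ Der ℍ[ℝ] := by
  intro x y
  simp only [quatComm_apply]
  noncomm_ring

theorem quatInn_apply (a b : ℍ[ℝ]) : quatInn a b = (star a * b).re := rfl

theorem quat_ext {a b : ℍ[ℝ]} (h0 : a.re = b.re) (h1 : a.imI = b.imI) (h2 : a.imJ = b.imJ)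
    (h3 : a.imK = b.imK) : a = b := Quaternion.ext _ _ h0 h1 h2 h3

theorem imUnit_re (i : Fin 3) : (imUnit i).re = 0 := by fin_cases i <;> rfl
theorem imUnit_imI (i : Fin 3) : (imUnit i).imI = if i = 0 then 1 else 0 := by
  fin_cases i <;> rfl
theorem imUnit_imJ (i : Fin 3) : (imUnit i).imJ = if i = 1 then 1 else 0 := by
  fin_cases i <;> rfl
theorem imUnit_imK (i : Fin 3) : (imUnit i).imK = if i = 2 then 1 else 0 := by
  fin_cases i <;> rfl

theorem quatInn_imUnit (i k : Fin 3) :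
    quatInn (imUnit i) (imUnit k) = if i = k then 1 else 0 := by
  rw [quatInn_apply, Quaternion.re_mul]
  simp only [Quaternion.re_star, Quaternion.imI_star, Quaternion.imJ_star, Quaternion.imK_star,
    imUnit_re, imUnit_imI, imUnit_imJ, imUnit_imK]
  fin_cases i <;> fin_cases k <;> simp

theorem quatComm_imUnit_add1 (i : Fin 3) :
    quatComm (imUnit i) (imUnit (i + 1)) = (2 : ℝ) • imUnit (i + 2) := by
  apply quat_ext <;>
  simp only [quatComm_apply, Quaternion.re_sub, Quaternion.imI_sub, Quaternion.imJ_sub,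
    Quaternion.imK_sub, Quaternion.re_mul, Quaternion.imI_mul, Quaternion.imJ_mul,
    Quaternion.imK_mul, Quaternion.re_smul, Quaternion.imI_smul, Quaternion.imJ_smul,
    Quaternion.imK_smul, imUnit_re, imUnit_imI, imUnit_imJ, imUnit_imK, smul_eq_mul] <;>
  fin_cases i <;> simp <;> norm_num

theorem eq_sum_imUnit {a : ℍ[ℝ]} (ha : a.re = 0) :
    a = a.imI • imUnit 0 + a.imJ • imUnit 1 + a.imK • imUnit 2 := by
  apply quat_ext <;> simp [ha, imUnit_re, imUnit_imI, imUnit_imJ, imUnit_imK]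

/-- The derivations of the quaternions are inner. -/
theorem exists_of_mem_der {D : Module.End ℝ ℍ[ℝ]} (hD : D ∈ Der ℍ[ℝ]) :
    ∃ c : Fin 3 → ℝ, D = ∑ i, c i • quatComm (imUnit i) := by
  have h (x y : ℍ[ℝ]) : D (x * y) = D x * y + x * D y := hD x y
  have h1 : D 1 = 0 := by simpa using h 1 1
  have m00 : imUnit 0 * imUnit 0 = -1 := by
    apply quat_ext <;> simp [imUnit_re, imUnit_imI, imUnit_imJ, imUnit_imK]
  have m11 : imUnit 1 * imUnit 1 = -1 := by
    apply quat_ext <;> simp [imUnit_re, imUnit_imI, imUnit_imJ, imUnit_imK]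
  have m01 : imUnit 0 * imUnit 1 = imUnit 2 := by
    apply quat_ext <;> simp [imUnit_re, imUnit_imI, imUnit_imJ, imUnit_imK]
  have m10 : imUnit 1 * imUnit 0 = -imUnit 2 := by
    apply quat_ext <;> simp [imUnit_re, imUnit_imI, imUnit_imJ, imUnit_imK]
  have e00 := h (imUnit 0) (imUnit 0)
  have e11 := h (imUnit 1) (imUnit 1)
  have e01 := h (imUnit 0) (imUnit 1)
  have e10 := h (imUnit 1) (imUnit 0)
  rw [m00, map_neg, h1, neg_zero] at e00
  rw [m11, map_neg, h1, neg_zero] at e11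
  rw [m01] at e01
  rw [m10, map_neg] at e10
  set u := D (imUnit 0)
  set v := D (imUnit 1)
  set w := D (imUnit 2)
  have f {a b : ℍ[ℝ]} (h : a = b) : a.re = b.re ∧ a.imI = b.imI ∧ a.imJ = b.imJ ∧
      a.imK = b.imK := by
    subst h; exact ⟨rfl, rfl, rfl, rfl⟩
  obtain ⟨a1, a2, a3, a4⟩ := f e00
  obtain ⟨b1, b2, b3, b4⟩ := f e11
  obtain ⟨c1, c2, c3, c4⟩ := f e01
  obtain ⟨d1, d2, d3, d4⟩ := f e10
  have n1 : (1 : Fin 3) ≠ 0 := by decide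
  have n2 : (0 : Fin 3) ≠ 1 := by decide
  have n3 : (0 : Fin 3) ≠ 2 := by decide
  have n4 : (1 : Fin 3) ≠ 2 := by decide
  simp only [Quaternion.re_add, Quaternion.imI_add, Quaternion.imJ_add, Quaternion.imK_add,
    Quaternion.re_mul, Quaternion.imI_mul, Quaternion.imJ_mul, Quaternion.imK_mul,
    Quaternion.re_zero, Quaternion.imI_zero, Quaternion.imJ_zero, Quaternion.imK_zero,
    Quaternion.re_neg, Quaternion.imI_neg, Quaternion.imJ_neg, Quaternion.imK_neg, imUnit_re,
    imUnit_imI, imUnit_imJ, imUnit_imK, n1, n2, n3, n4, if_true, if_false]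
    at a1 a2 a3 a4 b1 b2 b3 b4 c1 c2 c3 c4 d1 d2 d3 d4
  have u0 : u.re = 0 := by linarith
  have u1 : u.imI = 0 := by linarith
  have v0 : v.re = 0 := by linarith
  have v2 : v.imJ = 0 := by linarith
  have v1 : v.imI = -u.imJ := by linarith
  have w0 : w.re = 0 := by linarith
  have w1 : w.imI = -u.imK := by linarith
  have w2 : w.imJ = -v.imK := by linarith
  have w3 : w.imK = 0 := by linarith
  -- For `c = c₀ i + c₁ j + c₂ k` one has `[c, i] = 2 c₂ j - 2 c₁ k`, and the `k`-coordinate of `[c,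
  -- j]` is `2 c₀`.
  refine ⟨![v.imK / 2, -(u.imK / 2), u.imJ / 2], ?_⟩
  ext1 q
  have hq : q = q.re • 1 + (q.imI • imUnit 0 + q.imJ • imUnit 1 + q.imK • imUnit 2) := by
    apply quat_ext <;> simp [imUnit_re, imUnit_imI, imUnit_imJ, imUnit_imK]
  have hDq : D q = q.imI • u + q.imJ • v + q.imK • w := by
    conv_lhs => rw [hq]
    simp only [map_add, map_smul, h1, smul_zero, zero_add, u, v, w]
  rw [hDq, Fin.sum_univ_three]
  simp only [LinearMap.add_apply, LinearMap.smul_apply, quatComm_apply]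
  apply quat_ext <;> simp [imUnit_re, imUnit_imI, imUnit_imJ, imUnit_imK, u0, u1, v0, v1, v2, w0,
    w1, w2, w3] <;> ring

end Quaternions

namespace Albert

/-- The traceless part of an element. -/
noncomputable def tl : Albert →ₗ[ℝ] Albert := LinearMap.id - (1 / 3 : ℝ) • tr.smulRight idMat

theorem tl_apply (x : Albert) : tl x = x - (1 / 3 * tr x) • idMat := by
  simp [tl, smul_smul]

theorem tr_tl (x : Albert) : tr (tl x) = 0 := by
  rw [tl_apply, map_sub, map_smul, tr_idMat, smul_eq_mul]; ring

theorem tl_of_tr_eq_zero {x : Albert} (h : tr x = 0) : tl x = x := by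
  rw [tl_apply, h]; simp

theorem tl_idMat : tl idMat = 0 := by
  rw [tl_apply, tr_idMat]; norm_num

theorem starMul_apply (x y : Albert) : starMul x y = x * y - (1 / 3 : ℝ) • inn x y • idMat := rfl

theorem inn_tl_tl (x y : Albert) : inn (tl x) (tl y) = tr (x * y) - 1 / 3 * (tr x * tr y) := by
  simp only [tl_apply, map_sub, LinearMap.sub_apply, map_smul, LinearMap.smul_apply,
    inn_idMat_left, inn_idMat_right, tr_idMat, smul_eq_mul]
  rw [inn_apply]; ring

theorem jordanComm_apply (x y z : Albert) : jordanComm x y z = x * (y * z) - y * (x * z) := rfl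

theorem jordanComm_tl_tl (x y : Albert) : jordanComm (tl x) (tl y) = jordanComm x y := by
  ext1 z
  simp only [jordanComm_apply, tl_apply, sub_mul, mul_sub, smul_mul_assoc, mul_smul_comm,
    idMat_mul]
  module

theorem starMul_tl_tl (x y : Albert) : starMul (tl x) (tl y) =
    tl (x * y) - (1 / 3 * tr x) • tl y - (1 / 3 * tr y) • tl x := by
  rw [starMul_apply, inn_tl_tl]
  simp only [tl_apply, sub_mul, mul_sub, smul_mul_assoc, mul_smul_comm, idMat_mul, mul_idMat]
  module

theorem app_tl (δ : Der Albert) (x : Albert) :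
    (δ : Module.End ℝ Albert) (tl x) = tl ((δ : Module.End ℝ Albert) x) := by
  rw [tl_of_tr_eq_zero (tr_der δ x), tl_apply, map_sub, map_smul, der_idMat, smul_zero, sub_zero]

end Albert

theorem titsBracket_def (X Y : TitsAmbient) : titsBracket X Y =
  (⁅X.1, Y.1⁆ + (1 / 12 : ℝ) •
      TensorProduct.rid ℝ (Module.End ℝ ℍ[ℝ]) (TensorProduct.map₂ quatDer inn X.2.2 Y.2.2),
    ⁅X.2.1, Y.2.1⁆ -
      TensorProduct.lid ℝ (Module.End ℝ Albert)
        (TensorProduct.map₂ quatInn jordanComm X.2.2 Y.2.2),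
    titsAct X.1 X.2.1 Y.2.2 - titsAct Y.1 Y.2.1 X.2.2
      + (1 / 2 : ℝ) • TensorProduct.map₂ quatComm starMul X.2.2 Y.2.2) := rfl

theorem titsAct_apply (H : Module.End ℝ ℍ[ℝ]) (J : Module.End ℝ Albert) (t : ℍ[ℝ] ⊗[ℝ] Albert) :
    titsAct H J t = LinearMap.rTensor Albert H t + LinearMap.lTensor ℍ[ℝ] J t := rfl

theorem titsBracket_add_left (X X' Y : TitsAmbient) :
    titsBracket (X + X') Y = titsBracket X Y + titsBracket X' Y := by
  simp only [titsBracket_def, titsAct_apply]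
  refine Prod.ext ?_ (Prod.ext ?_ ?_)
  · simp only [Prod.fst_add, Prod.snd_add, add_lie, map_add, LinearMap.add_apply]; module
  · simp only [Prod.fst_add, Prod.snd_add, add_lie, map_add, LinearMap.add_apply]; module
  · simp only [Prod.fst_add, Prod.snd_add, map_add, LinearMap.add_apply, LinearMap.rTensor_add,
      LinearMap.lTensor_add]
    module

theorem titsBracket_add_right (X Y Y' : TitsAmbient) :
    titsBracket X (Y + Y') = titsBracket X Y + titsBracket X Y' := by
  simp only [titsBracket_def, titsAct_apply]
  refine Prod.ext ?_ (Prod.ext ?_ ?_)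
  · simp only [Prod.fst_add, Prod.snd_add, lie_add, map_add, LinearMap.add_apply]; module
  · simp only [Prod.fst_add, Prod.snd_add, lie_add, map_add, LinearMap.add_apply]; module
  · simp only [Prod.fst_add, Prod.snd_add, map_add, LinearMap.add_apply, LinearMap.rTensor_add,
      LinearMap.lTensor_add]
    module

namespace TKK

/-- The identification with the Tits algebra; `hᵢ ⊗ 1` corresponds to `ad hᵢ / 2`. -/
noncomputable def toTits : TKK →ₗ[ℝ] TitsAmbient where
  -- The factor is `1/3 · 1/2`: the scalar part of `x` is `(tr x / 3) I₃`, and `hᵢ ⊗ I₃` goes to `ad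
  -- hᵢ / 2`.
  toFun X := (∑ i, (1 / 6 * tr (X.2 i)) • quatComm (imUnit i), (X.1 : Module.End ℝ Albert),
    ∑ i, imUnit i ⊗ₜ[ℝ] tl (X.2 i))
  map_add' X Y := by
    refine Prod.ext ?_ (Prod.ext rfl ?_)
    · simp only [add_snd, map_add, mul_add, add_smul, Finset.sum_add_distrib, Prod.fst_add]
    · simp only [add_snd, map_add, TensorProduct.tmul_add, Finset.sum_add_distrib, Prod.snd_add]
  map_smul' c X := by
    refine Prod.ext ?_ (Prod.ext rfl ?_)
    · simp only [smul_snd, map_smul, smul_eq_mul, Finset.smul_sum, smul_smul, Prod.smul_fst,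
        RingHom.id_apply, mul_left_comm]
    · simp only [smul_snd, map_smul, TensorProduct.tmul_smul, Finset.smul_sum, Prod.smul_snd,
        RingHom.id_apply]

theorem toTits_apply (X : TKK) : toTits X = (∑ i, (1 / 6 * tr (X.2 i)) • quatComm (imUnit i),
    (X.1 : Module.End ℝ Albert), ∑ i, imUnit i ⊗ₜ[ℝ] tl (X.2 i)) := rfl

theorem toTits_ofDer (δ : Der Albert) : toTits (ofDer δ) = (0, (δ : Module.End ℝ Albert), 0) := by
  simp [toTits_apply]

theorem toTits_h (i : Fin 3) (x : Albert) : toTits (h i x) =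
    ((1 / 6 * tr x) • quatComm (imUnit i), 0, imUnit i ⊗ₜ[ℝ] tl x) := by
  rw [toTits_apply]
  refine Prod.ext ?_ (Prod.ext rfl ?_)
  · simp [fin3_sum _ i]
  · simp [fin3_sum _ i]

/-- The scalar parts contribute `1/36 tr x tr y` to the `D(ℍ)`-component, and the traceless parts
contribute `1/12 (tr (x ∘ y) - 1/3 tr x tr y)`. They add up to `1/12 tr (x ∘ y)`, which is why the
coefficient `1/12` in the Tits product is the right one. -/
theorem titsBracket_h_h (i k : Fin 3) (x y : Albert) :
    titsBracket (toTits (h i x)) (toTits (h k y)) =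
      ((1 / 12 * tr (x * y)) • quatComm (quatComm (imUnit i) (imUnit k)),
        -(quatInn (imUnit i) (imUnit k) • jordanComm x y),
        (1 / 2 : ℝ) • (quatComm (imUnit i) (imUnit k) ⊗ₜ[ℝ] tl (x * y))) := by
  rw [toTits_h, toTits_h, titsBracket_def]
  refine Prod.ext ?_ (Prod.ext ?_ ?_)
  · simp only [TensorProduct.map₂_apply_tmul, TensorProduct.map_tmul, TensorProduct.rid_tmul, quatDer_eq, inn_tl_tl,
      lie_smul_quatComm]
    module
  · simp only [TensorProduct.map₂_apply_tmul, TensorProduct.map_tmul, TensorProduct.lid_tmul, jordanComm_tl_tl, lie_self,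
      zero_sub]
  · simp only [TensorProduct.map₂_apply_tmul, TensorProduct.map_tmul, titsAct_apply, LinearMap.rTensor_tmul,
      LinearMap.lTensor_zero, LinearMap.zero_apply, add_zero, LinearMap.smul_apply, starMul_tl_tl,
      quatComm_skew (imUnit k), TensorProduct.tmul_sub, TensorProduct.tmul_smul, smul_neg,
      TensorProduct.neg_tmul, ← TensorProduct.smul_tmul']
    module

theorem titsBracket_ofDer_h (δ : Der Albert) (i : Fin 3) (x : Albert) :
    titsBracket (toTits (ofDer δ)) (toTits (h i x)) = toTits ⁅ofDer δ, h i x⁆ := by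
  rw [lie_ofDer_h, toTits_h, toTits_h, toTits_ofDer, titsBracket_def]
  refine Prod.ext ?_ (Prod.ext ?_ ?_)
  · simp [tr_der]
  · simp
  · simp [titsAct_apply, app_tl]

theorem titsBracket_h_ofDer (δ : Der Albert) (i : Fin 3) (x : Albert) :
    titsBracket (toTits (h i x)) (toTits (ofDer δ)) = toTits ⁅h i x, ofDer δ⁆ := by
  rw [lie_h_ofDer, map_neg, toTits_h, toTits_h, toTits_ofDer, titsBracket_def]
  refine Prod.ext ?_ (Prod.ext ?_ ?_)
  · simp [tr_der]
  · simp
  · simp [titsAct_apply, app_tl]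

theorem titsBracket_ofDer_ofDer (δ ε : Der Albert) :
    titsBracket (toTits (ofDer δ)) (toTits (ofDer ε)) = toTits ⁅ofDer δ, ofDer ε⁆ := by
  rw [lie_ofDer_ofDer, toTits_ofDer, toTits_ofDer, toTits_ofDer, titsBracket_def]
  refine Prod.ext ?_ (Prod.ext ?_ ?_)
  · simp
  · simp
  · simp [titsAct_apply]

theorem titsBracket_h_h_eq (i k : Fin 3) (x y : Albert) :
    titsBracket (toTits (h i x)) (toTits (h k y)) = toTits ⁅h i x, h k y⁆ := by
  rw [titsBracket_h_h]
  rcases fin3_cases i k with rfl | rfl | rfl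
  · rw [lie_h_h_self, map_neg, toTits_ofDer, quatComm_self, quatInn_imUnit, if_pos rfl, one_smul,
      innerDer_coe]
    refine Prod.ext ?_ (Prod.ext ?_ ?_) <;> simp
  · rw [lie_h_h_add1, toTits_h, quatComm_imUnit_add1, quatInn_imUnit, if_neg (fin3_ne_add1 i),
      map_smul]
    refine Prod.ext ?_ (Prod.ext ?_ ?_)
    · show (1 / 12 * tr (x * y)) • (2 : ℝ) • quatComm (imUnit (i + 2)) = _
      module
    · simp
    · simp only [TensorProduct.smul_tmul', smul_smul]
      norm_num
  · have e := quatComm_imUnit_add1 (i + 2)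
    rw [fin3_add21, fin3_add22] at e
    rw [lie_h_h_add2, map_neg, toTits_h, quatComm_skew, e, quatInn_imUnit,
      if_neg (fin3_ne_add2 i), map_neg, map_smul]
    refine Prod.ext ?_ (Prod.ext ?_ ?_)
    · show (1 / 12 * tr (x * y)) • -((2 : ℝ) • quatComm (imUnit (i + 1))) = -_
      module
    · simp
    · simp only [TensorProduct.neg_tmul, TensorProduct.smul_tmul', smul_smul, smul_neg,
        Prod.snd_neg]
      norm_num

theorem induction {P : TKK → Prop} (hadd : ∀ X Y, P X → P Y → P (X + Y))
    (hder : ∀ δ, P (ofDer δ)) (hh : ∀ i x, P (h i x)) (X : TKK) : P X := by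
  rw [eq_sum X, Fin.sum_univ_three]
  exact hadd _ _ (hder _) (hadd _ _ (hadd _ _ (hh _ _) (hh _ _)) (hh _ _))

theorem titsBracket_toTits (X Y : TKK) :
    titsBracket (toTits X) (toTits Y) = toTits ⁅X, Y⁆ := by
  induction X using TKK.induction with
  | hadd X X' h1 h2 => rw [map_add, titsBracket_add_left, h1, h2, add_lie, map_add]
  | hder δ =>
    induction Y using TKK.induction with
    | hadd Y Y' h1 h2 => rw [map_add, titsBracket_add_right, h1, h2, lie_add, map_add]
    | hder ε => exact titsBracket_ofDer_ofDer δ ε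
    | hh i x => exact titsBracket_ofDer_h δ i x
  | hh i x =>
    induction Y using TKK.induction with
    | hadd Y Y' h1 h2 => rw [map_add, titsBracket_add_right, h1, h2, lie_add, map_add]
    | hder ε => exact titsBracket_h_ofDer ε i x
    | hh k y => exact titsBracket_h_h_eq i k x y

/-- The coordinates of a tensor with respect to the imaginary units. -/
noncomputable def tensorCoord (i : Fin 3) : ℍ[ℝ] ⊗[ℝ] Albert →ₗ[ℝ] Albert :=
  (TensorProduct.lid ℝ Albert).toLinearMap ∘ₗ
    LinearMap.rTensor Albert (quatInn (imUnit i))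

theorem tensorCoord_sum (i : Fin 3) (x : Fin 3 → Albert) :
    tensorCoord i (∑ k, imUnit k ⊗ₜ[ℝ] x k) = x i := by
  simp [tensorCoord, quatInn_imUnit]

theorem toTits_injective : Function.Injective toTits := by
  rw [← LinearMap.ker_eq_bot, LinearMap.ker_eq_bot']
  intro X hX
  rw [toTits_apply] at hX
  have h1 := congrArg Prod.fst hX
  have h2 := congrArg (fun v : TitsAmbient => v.2.1) hX
  have h3 := congrArg (fun v : TitsAmbient => v.2.2) hX
  simp only [Prod.fst_zero, Prod.snd_zero] at h1 h2 h3
  apply ext' (Subtype.ext h2)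
  have htl (i : Fin 3) : tl (X.2 i) = 0 := by
    rw [← tensorCoord_sum i (fun k => tl (X.2 k)), h3, map_zero]
  have htr (i : Fin 3) : tr (X.2 i) = 0 := by
    -- Evaluating at `hᵢ₊₁` and pairing with `hᵢ₊₂` isolates the coefficient of `ad hᵢ`.
    have e := congrArg (fun f : Module.End ℝ ℍ[ℝ] =>
      quatInn (imUnit (i + 2)) (f (imUnit (i + 1)))) h1
    have e1 := quatComm_imUnit_add1 (i + 1)
    rw [fin3_add11, fin3_add12] at e1
    rw [fin3_sum _ i] at e
    simp only [LinearMap.add_apply, LinearMap.smul_apply, quatComm_imUnit_add1, quatComm_self,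
      quatComm_skew (imUnit (i + 2)), e1, map_add, map_smul, map_neg, quatInn_imUnit,
      LinearMap.zero_apply, map_zero, if_true, if_neg (fin3_ne_add2 i).symm, smul_eq_mul] at e
    linarith
  intro i
  have e := tl_apply (X.2 i)
  rw [htl, htr] at e
  simpa using e.symm

theorem toTits_mem (X : TKK) : toTits X ∈ titsSpace := by
  refine ⟨?_, ?_, ?_⟩
  · exact (Der ℍ[ℝ]).toSubmodule.sum_mem fun i _ =>
      (Der ℍ[ℝ]).toSubmodule.smul_mem _ (quatComm_mem_der _)
  · exact X.1.2
  · show ∑ i, imUnit i ⊗ₜ[ℝ] tl (X.2 i) ∈ Submodule.span ℝ _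
    refine Submodule.sum_mem _ fun i _ => Submodule.subset_span ?_
    exact ⟨imUnit i, tl (X.2 i), imUnit_re i, tr_tl _, rfl⟩

theorem exists_of_mem_titsSpace {v : TitsAmbient} (hv : v ∈ titsSpace) : ∃ X, toTits X = v := by
  obtain ⟨v₁, v₂, t⟩ := v
  obtain ⟨h1, h2, h3⟩ := hv
  change t ∈ Submodule.span ℝ _ at h3
  obtain ⟨c, hc⟩ := exists_of_mem_der h1
  have ht : ∃ x : Fin 3 → Albert, (∀ i, tr (x i) = 0) ∧ t = ∑ i, imUnit i ⊗ₜ[ℝ] x i := by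
    clear hc h1 h2
    induction h3 using Submodule.span_induction with
    | mem t ht =>
      obtain ⟨a, x, ha, hx, rfl⟩ := ht
      refine ⟨![a.imI • x, a.imJ • x, a.imK • x], fun i => ?_, ?_⟩
      · fin_cases i <;> simp [hx]
      · conv_lhs => rw [eq_sum_imUnit ha]
        simp [Fin.sum_univ_three, TensorProduct.add_tmul, TensorProduct.smul_tmul]
    | zero => exact ⟨0, by simp, by simp⟩
    | add s t _ _ hs ht =>
      obtain ⟨x, hx, rfl⟩ := hs
      obtain ⟨y, hy, rfl⟩ := ht
      exact ⟨x + y, fun i => by simp [hx, hy], by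
        simp [TensorProduct.tmul_add, Finset.sum_add_distrib]⟩
    | smul r t _ ht =>
      obtain ⟨x, hx, rfl⟩ := ht
      exact ⟨r • x, fun i => by simp [hx], by simp [Finset.smul_sum]⟩
  obtain ⟨x, hx, hxt⟩ := ht
  -- The scalar `2 cᵢ` compensates for the `½` in `hᵢ ⊗ I₃ ↦ ad hᵢ / 2`.
  refine ⟨ofDer ⟨v₂, h2⟩ + ∑ i, h i (x i + (2 * c i) • idMat), ?_⟩
  rw [map_add, map_sum, toTits_ofDer]
  simp only [toTits_h]
  refine Prod.ext ?_ (Prod.ext ?_ ?_)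
  · refine Eq.trans ?_ hc.symm
    rw [Prod.fst_add, Prod.fst_sum, zero_add]
    refine Finset.sum_congr rfl fun i _ => ?_
    show (1 / 6 * tr (x i + (2 * c i) • idMat)) • quatComm (imUnit i) = c i • quatComm (imUnit i)
    rw [map_add, hx, map_smul, tr_idMat, smul_eq_mul]
    congr 1; ring
  · simp [Prod.fst_sum, Prod.snd_sum]
  · refine Eq.trans ?_ hxt.symm
    rw [Prod.snd_add, Prod.snd_add, Prod.snd_sum, Prod.snd_sum, zero_add]
    refine Finset.sum_congr rfl fun i _ => ?_
    show imUnit i ⊗ₜ[ℝ] tl (x i + (2 * c i) • idMat) = imUnit i ⊗ₜ[ℝ] x i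
    rw [map_add, map_smul, tl_idMat, smul_zero, add_zero, tl_of_tr_eq_zero (hx i)]

theorem range_toTits : LinearMap.range toTits = titsSpace := by
  ext v
  exact ⟨fun ⟨X, hX⟩ => hX ▸ toTits_mem X, exists_of_mem_titsSpace⟩

end TKK


/-! ### Adjoint matrices and the algebra they span -/

section AdjointMatrix

variable {ι L : Type*} [Fintype ι] [DecidableEq ι] [LieRing L] [LieAlgebra ℝ L]

/-- The matrices of the adjoint action in a basis. -/
noncomputable def adMatrix (b : Module.Basis ι ℝ L) : L →ₗ⁅ℝ⁆ Matrix ι ι ℝ :=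
  (AlgEquiv.toLieEquiv (LinearMap.toMatrixAlgEquiv b)).toLieHom.comp (LieAlgebra.ad ℝ L)

theorem adMatrix_apply (b : Module.Basis ι ℝ L) (x : L) (i k : ι) :
    adMatrix b x i k = b.repr ⁅x, b k⁆ i :=
  LinearMap.toMatrixAlgEquiv_apply b (LieAlgebra.ad ℝ L x) i k

theorem lie_eq_sum_adMatrix (b : Module.Basis ι ℝ L) (x : L) (k : ι) :
    ⁅x, b k⁆ = ∑ i, adMatrix b x i k • b i := by
  simp only [adMatrix_apply]
  exact (b.sum_repr _).symm

theorem eq_adMatrix (b : Module.Basis ι ℝ L) {x : L} {N : Matrix ι ι ℝ}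
    (hN : ∀ k, ⁅x, b k⁆ = ∑ i, N i k • b i) : N = adMatrix b x := by
  ext i k
  rw [adMatrix_apply, hN, map_sum, Finsupp.finsetSum_apply]
  simp [Finsupp.single_apply]

/-- The structure constants survive any linear map. Applied to the adjoint representation and to the
56-dimensional one, this gives both commutation tables with the same coefficients. -/
theorem map_lie_eq_sum_adMatrix {V : Type*} [AddCommGroup V] [Module ℝ V] (b : Module.Basis ι ℝ L)
    (f : L →ₗ[ℝ] V) (A B : ι) : f ⁅b A, b B⁆ = ∑ C, adMatrix b (b A) C B • f (b C) := by
  rw [lie_eq_sum_adMatrix, map_sum]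
  simp only [map_smul]

theorem adMatrix_injective (b : Module.Basis ι ℝ L)
    (hL : ∀ x : L, (∀ y : L, ⁅x, y⁆ = 0) → x = 0) : Function.Injective (adMatrix b) := by
  rw [injective_iff_map_eq_zero]
  intro x hx
  refine hL x fun y => ?_
  have h1 : LieAlgebra.ad ℝ L x = 0 :=
    (map_eq_zero_iff _ (LinearMap.toMatrixAlgEquiv b).injective).1 hx
  exact congrArg (fun f : Module.End ℝ L => f y) h1

theorem isSimple_of_equiv {L' : Type*} [LieRing L'] [LieAlgebra ℝ L'] (e : L ≃ₗ⁅ℝ⁆ L')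
    [LieAlgebra.IsSimple ℝ L] : LieAlgebra.IsSimple ℝ L' where
  eq_bot_or_eq_top I := by
    have hm (x : L) : x ∈ LieIdeal.comap e.toLieHom I ↔ e x ∈ I := LieIdeal.mem_comap
    rcases LieAlgebra.IsSimple.eq_bot_or_eq_top (R := ℝ) (LieIdeal.comap e.toLieHom I) with h | h
    · left
      rw [LieSubmodule.eq_bot_iff]
      intro y hy
      obtain ⟨x, rfl⟩ := e.surjective y
      have h1 := (hm x).2 hy
      rw [h, LieSubmodule.mem_bot] at h1
      rw [h1]
      exact map_zero e.toLieHom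
    · right
      rw [eq_top_iff]
      intro y _
      obtain ⟨x, rfl⟩ := e.surjective y
      exact (hm x).1 (h ▸ LieSubmodule.mem_top x)
  non_abelian h := by
    refine LieAlgebra.IsSimple.non_abelian (R := ℝ) (L := L) ⟨fun x y => ?_⟩
    apply e.injective
    refine (LieHom.map_lie e.toLieHom x y).trans ((h.trivial _ _).trans ?_)
    exact (map_zero e.toLieHom).symm

end AdjointMatrix

namespace TKK

variable (j : Module.Basis (Fin 26) ℝ traceless) (D : Module.Basis (Fin 52) ℝ (Der Albert))

/-- The elements `2 hᵢ ⊗ I₃`, `D_I` and `hᵢ ⊗ j_a`, which correspond to the `Ψ_A`. -/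
noncomputable def psi : Idx133 → TKK
  | .inl L => h L ((2 : ℝ) • idMat)
  | .inr (.inl I) => ofDer (D I)
  | .inr (.inr (i, a)) => h i (j a : Albert)

theorem toTits_psi (A : Idx133) : toTits (psi j D A) = Psi j D A := by
  rcases A with L | I | ⟨i, a⟩
  · simp only [psi, Psi, toTits_h, map_smul, tl_idMat, smul_zero, TensorProduct.tmul_zero,
      tr_idMat, Prod.smul_mk, smul_smul]
    rw [show (2 * (1 / 6 * 3) : ℝ) = 1 by norm_num, one_smul]
  · exact toTits_ofDer _
  · have ha : tr (j a : Albert) = 0 := (j a).2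
    simp only [psi, Psi, toTits_h, ha, mul_zero, zero_smul, tl_of_tr_eq_zero ha]

theorem finrank_eq : Module.finrank ℝ TKK = 133 := by
  have : Module.finrank ℝ (Der Albert × (Fin 3 → Albert)) = 133 := by
    rw [Module.finrank_prod, finrank_der, Module.finrank_pi_fintype]
    simp [Albert.finrank_eq]
  exact this

theorem span_psi : ⊤ ≤ Submodule.span ℝ (Set.range (psi j D)) := by
  intro X _
  have hm (A : Idx133) : psi j D A ∈ Submodule.span ℝ (Set.range (psi j D)) :=
    Submodule.subset_span ⟨A, rfl⟩
  rw [eq_sum X]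
  refine Submodule.add_mem _ ?_ (Submodule.sum_mem _ fun i _ => ?_)
  · rw [← D.sum_repr X.1, map_sum]
    refine Submodule.sum_mem _ fun I _ => ?_
    rw [map_smul]
    exact Submodule.smul_mem _ _ (hm (.inr (.inl I)))
  · have e : X.2 i = tl (X.2 i) + (1 / 6 * tr (X.2 i)) • (2 : ℝ) • idMat := by
      rw [tl_apply]; module
    have e' : tl (X.2 i) = ((⟨tl (X.2 i), tr_tl _⟩ : traceless) : Albert) := rfl
    rw [e, map_add, map_smul]
    refine Submodule.add_mem _ ?_ (Submodule.smul_mem _ _ (hm (.inl i)))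
    rw [e', ← j.sum_repr ⟨tl (X.2 i), tr_tl _⟩, AddSubmonoidClass.coe_finsetSum, map_sum]
    refine Submodule.sum_mem _ fun a _ => ?_
    rw [Submodule.coe_smul, map_smul]
    exact Submodule.smul_mem _ _ (hm (.inr (.inr (i, a))))

/-- The basis of the Lie algebra attached to bases of `𝔍'` and `D(𝔍)`. -/
noncomputable def psiBasis : Module.Basis Idx133 ℝ TKK :=
  basisOfTopLeSpanOfCardEqFinrank (psi j D) (span_psi j D) (by rw [finrank_eq]; simp)

theorem psiBasis_apply (A : Idx133) : psiBasis j D A = psi j D A := by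
  simp [psiBasis]

theorem linearIndependent_Psi : LinearIndependent ℝ (Psi j D) := by
  have e : Psi j D = toTits ∘ psiBasis j D := by
    funext A; rw [Function.comp_apply, psiBasis_apply, toTits_psi]
  rw [e]
  exact (psiBasis j D).linearIndependent.map' toTits (LinearMap.ker_eq_bot.2 toTits_injective)

theorem span_Psi : Submodule.span ℝ (Set.range (Psi j D)) = titsSpace := by
  have e : Psi j D = toTits ∘ psiBasis j D := by
    funext A; rw [Function.comp_apply, psiBasis_apply, toTits_psi]
  rw [e, Set.range_comp, Submodule.span_image, (psiBasis j D).span_eq, Submodule.map_top,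
    range_toTits]

/-- Injectivity of `toTits` turns the defining relation into one in the basis `psiBasis`, where the
coefficients of a bracket are unique. -/
theorem isAdjointFamily_iff (M : Idx133 → Matrix Idx133 Idx133 ℝ) :
    IsAdjointFamily j D M ↔ M = fun A => adMatrix (psiBasis j D) (psiBasis j D A) := by
  have key (M : Idx133 → Matrix Idx133 Idx133 ℝ) (A B : Idx133) :
      titsBracket (Psi j D A) (Psi j D B) = ∑ C, M A C B • Psi j D C ↔
      ⁅psiBasis j D A, psiBasis j D B⁆ = ∑ C, M A C B • psiBasis j D C := by
    rw [← toTits_injective.eq_iff, map_sum, ← titsBracket_toTits]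
    simp only [map_smul, psiBasis_apply, toTits_psi]
  constructor
  · intro hM
    funext A
    exact eq_adMatrix _ fun B => (key M A B).1 (hM A B)
  · intro hM A B
    refine (key M A B).2 ((lie_eq_sum_adMatrix _ _ _).trans ?_)
    rw [hM]

theorem adMatrix_psiBasis_injective : Function.Injective (adMatrix (psiBasis j D)) := by
  exact adMatrix_injective _ fun X hX => eq_zero_of_lie_eq_zero hX

/-- The Lie algebra spanned by the adjoint matrices. -/
noncomputable def adjointAlgebra : LieSubalgebra ℝ (Matrix Idx133 Idx133 ℝ) :=
  (adMatrix (psiBasis j D)).range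

/-- The adjoint representation is an isomorphism onto its image. -/
noncomputable def equivAdjointAlgebra : TKK ≃ₗ⁅ℝ⁆ adjointAlgebra j D :=
  LieEquiv.ofInjective (adMatrix (psiBasis j D)) (adMatrix_psiBasis_injective j D)

theorem linearIndependent_adMatrix :
    LinearIndependent ℝ fun A => adMatrix (psiBasis j D) (psiBasis j D A) :=
  (psiBasis j D).linearIndependent.map' (adMatrix (psiBasis j D)).toLinearMap
    (LinearMap.ker_eq_bot.2 (adMatrix_psiBasis_injective j D))

theorem adjointAlgebra_toSubmodule : (adjointAlgebra j D).toSubmodule =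
    Submodule.span ℝ (Set.range fun A => adMatrix (psiBasis j D) (psiBasis j D A)) := by
  have e : (fun A => adMatrix (psiBasis j D) (psiBasis j D A)) =
    (adMatrix (psiBasis j D)).toLinearMap ∘ psiBasis j D := rfl
  rw [e, Set.range_comp, Submodule.span_image, (psiBasis j D).span_eq, Submodule.map_top]
  rfl

theorem finrank_adjointAlgebra : Module.finrank ℝ (adjointAlgebra j D) = 133 := by
  rw [← (equivAdjointAlgebra j D).toLinearEquiv.finrank_eq, finrank_eq]

theorem isSimple_adjointAlgebra : LieAlgebra.IsSimple ℝ (adjointAlgebra j D) :=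
  isSimple_of_equiv (equivAdjointAlgebra j D)

theorem killingForm_adjointAlgebra_neg (x : adjointAlgebra j D) (hx : x ≠ 0) :
    killingForm ℝ (adjointAlgebra j D) x x < 0 := by
  obtain ⟨X, rfl⟩ := (equivAdjointAlgebra j D).surjective x
  refine (LieAlgebra.killingForm_of_equiv_apply (equivAdjointAlgebra j D) X X).trans_lt
    (killingForm_neg X ?_)
  rintro rfl
  exact hx (map_zero (equivAdjointAlgebra j D).toLieHom)

theorem titsBracket_mem {X Z : TitsAmbient} (hX : X ∈ titsSpace) (hZ : Z ∈ titsSpace) :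
    titsBracket X Z ∈ titsSpace := by
  obtain ⟨X, rfl⟩ := exists_of_mem_titsSpace hX
  obtain ⟨Z, rfl⟩ := exists_of_mem_titsSpace hZ
  rw [titsBracket_toTits]
  exact toTits_mem _

theorem titsBracket_self {X : TitsAmbient} (hX : X ∈ titsSpace) : titsBracket X X = 0 := by
  obtain ⟨X, rfl⟩ := exists_of_mem_titsSpace hX
  rw [titsBracket_toTits, lie_self, map_zero]

theorem titsBracket_jacobi {X Z W : TitsAmbient} (hX : X ∈ titsSpace) (hZ : Z ∈ titsSpace)
    (hW : W ∈ titsSpace) : titsBracket X (titsBracket Z W) + titsBracket Z (titsBracket W X)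
      + titsBracket W (titsBracket X Z) = 0 := by
  obtain ⟨X, rfl⟩ := exists_of_mem_titsSpace hX
  obtain ⟨Z, rfl⟩ := exists_of_mem_titsSpace hZ
  obtain ⟨W, rfl⟩ := exists_of_mem_titsSpace hW
  simp only [titsBracket_toTits, ← map_add]
  rw [lie_jacobi, map_zero]

end TKK


/-! ### The 56-dimensional representation -/

namespace Yokota

/-- The real form inside the complexified Jordan algebra. -/
noncomputable def incl : Albert →ₗ[ℝ] AlbertC := TensorProduct.mk ℝ ℂ Albert 1

theorem incl_apply (x : Albert) : incl x = 1 ⊗ₜ[ℝ] x := rfl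

theorem tmul_eq (c : ℂ) (x : Albert) : c ⊗ₜ[ℝ] x = c • incl x := by
  rw [incl_apply, TensorProduct.smul_tmul', smul_eq_mul, mul_one]

theorem incl_smul (r : ℝ) (x : Albert) : incl (r • x) = (r : ℂ) • incl x := by
  rw [map_smul]; exact (RCLike.real_smul_eq_coe_smul (K := ℂ) r (incl x))

theorem baseChange_incl (f : Module.End ℝ Albert) (x : Albert) :
    f.baseChange ℂ (incl x) = incl (f x) := rfl

theorem freudC_incl (x y : Albert) : freudC (incl x) (incl y) = incl (freud x y) := by
  simp [freudC, incl_apply]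

theorem innC_incl (x y : Albert) : innC (incl x) (incl y) = (inn x y : ℂ) := by
  simp [innC, incl_apply]

theorem hom_ext_albertC {V : Type*} [AddCommGroup V] [Module ℂ V] {f g : AlbertC →ₗ[ℂ] V}
    (h : ∀ x, f (incl x) = g (incl x)) : f = g := by
  ext x
  exact h x

/-- Complex linearity reduces every operator identity on `V₅₆` to vectors with one nonzero
component, taken real in the two copies of `𝔍` and equal to 1 in the two copies of `ℂ`. -/
theorem hom_ext {V : Type*} [AddCommGroup V] [Module ℂ V] {f g : V56 →ₗ[ℂ] V}
    (h1 : ∀ x, f ((incl x, 0), (0, 0)) = g ((incl x, 0), (0, 0)))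
    (h2 : f ((0, 1), (0, 0)) = g ((0, 1), (0, 0)))
    (h3 : ∀ y, f ((0, 0), (incl y, 0)) = g ((0, 0), (incl y, 0)))
    (h4 : f ((0, 0), (0, 1)) = g ((0, 0), (0, 1))) : f = g := by
  apply LinearMap.prod_ext <;> apply LinearMap.prod_ext
  · exact hom_ext_albertC h1
  · exact LinearMap.ext_ring h2
  · exact hom_ext_albertC h3
  · exact LinearMap.ext_ring h4

/-- The block diagonal operator with blocks `f, c, g, -c`. -/
noncomputable def diagOp (f g : Module.End ℝ Albert) (c : ℝ) : Module.End ℂ V56 :=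
  LinearMap.prodMap (LinearMap.prodMap (f.baseChange ℂ) ((c : ℂ) • LinearMap.id))
    (LinearMap.prodMap (g.baseChange ℂ) (-(c : ℂ) • LinearMap.id))

theorem diagOp_apply (f g : Module.End ℝ Albert) (c : ℝ) (v : V56) :
    diagOp f g c v = ((f.baseChange ℂ v.1.1, (c : ℂ) * v.1.2),
      (g.baseChange ℂ v.2.1, -(c : ℂ) * v.2.2)) := rfl

/-- The action of a derivation of `𝔍`. -/
noncomputable def derOp : Der Albert →ₗ[ℝ] Module.End ℂ V56 where
  toFun δ := diagOp (δ : Module.End ℝ Albert) (δ : Module.End ℝ Albert) 0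
  map_add' δ ε := by
    apply hom_ext <;> intros <;> simp [diagOp_apply]
  map_smul' c δ := by
    apply hom_ext <;> intros <;> simp [diagOp_apply]

/-- The action of `a ∈ 𝔍` as an infinitesimal structure transformation. -/
noncomputable def mulOp : Albert →ₗ[ℝ] Module.End ℂ V56 where
  -- The shift by `tr a / 2` absorbs the trace term of `mul_freud` in the commutators with `raise`
  -- and `lower`.
  toFun a := diagOp (LinearMap.mulLeft ℝ a - (1 / 2 * tr a) • 1)
    (-LinearMap.mulLeft ℝ a + (1 / 2 * tr a) • 1) (1 / 2 * tr a)
  map_add' a b := by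
    apply hom_ext <;> intros <;>
      simp only [diagOp_apply, baseChange_incl, LinearMap.add_apply, map_zero, mul_zero, mul_one,
        Prod.mk_add_mk, add_zero, map_add, LinearMap.sub_apply, LinearMap.mulLeft_apply,
        LinearMap.smul_apply, Module.End.one_apply, add_mul, LinearMap.neg_apply, map_sub, map_smul,
        map_neg] <;>
      refine Prod.ext (Prod.ext ?_ ?_) (Prod.ext ?_ ?_) <;> (try rfl) <;>
      (try push_cast) <;> (first | module | ring)
  map_smul' c a := by
    apply hom_ext <;> intros <;>
      simp only [diagOp_apply, baseChange_incl, LinearMap.add_apply, map_zero, mul_zero, mul_one,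
        Prod.smul_mk, smul_zero, map_add, LinearMap.sub_apply, LinearMap.mulLeft_apply,
        LinearMap.smul_apply, Module.End.one_apply, smul_mul_assoc, LinearMap.neg_apply, map_sub,
        map_smul, map_neg, RingHom.id_apply, smul_eq_mul, Complex.real_smul] <;>
      refine Prod.ext (Prod.ext ?_ ?_) (Prod.ext ?_ ?_) <;> (try rfl) <;>
      (try push_cast) <;> (first | module | ring)

/-- The raising operator `x ↦ μ₂ z / 2`, `μ₁ ↦ ⟨z, y⟩ / 2`, `y ↦ z ▷ x`. -/
noncomputable def raise : AlbertC →ₗ[ℂ] Module.End ℂ V56 :=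
  LinearMap.mk₂ ℂ (fun z v => (((v.2.2 / 2) • z, 1 / 2 * innC z v.2.1), (freudC z v.1.1, 0)))
    (fun z z' v => by simp [mul_add])
    (fun c z v => by simp [smul_smul, mul_comm, mul_left_comm])
    (fun z v v' => by simp [add_div, add_smul, mul_add])
    (fun c z v => by simp [smul_smul, mul_comm, mul_left_comm, mul_div_assoc])

/-- The lowering operator `x ↦ w ▷ y`, `y ↦ μ₁ w / 2`, `μ₂ ↦ ⟨w, x⟩ / 2`. -/
noncomputable def lower : AlbertC →ₗ[ℂ] Module.End ℂ V56 :=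
  LinearMap.mk₂ ℂ (fun w v => ((freudC w v.2.1, 0), ((v.1.2 / 2) • w, 1 / 2 * innC w v.1.1)))
    (fun z z' v => by simp [mul_add])
    (fun c z v => by simp [smul_smul, mul_comm, mul_left_comm])
    (fun z v v' => by simp [add_div, add_smul, mul_add])
    (fun c z v => by simp [smul_smul, mul_comm, mul_left_comm, mul_div_assoc])

theorem derOp_apply (δ : Der Albert) (v : V56) : derOp δ v =
    (((δ : Module.End ℝ Albert).baseChange ℂ v.1.1, 0),
      ((δ : Module.End ℝ Albert).baseChange ℂ v.2.1, 0)) := by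
  refine (diagOp_apply _ _ _ v).trans ?_
  simp

theorem mulOp_apply (a : Albert) (v : V56) : mulOp a v =
    (((LinearMap.mulLeft ℝ a).baseChange ℂ v.1.1 - (1 / 2 * tr a : ℂ) • v.1.1,
      (1 / 2 * tr a : ℂ) * v.1.2),
     (-(LinearMap.mulLeft ℝ a).baseChange ℂ v.2.1 + (1 / 2 * tr a : ℂ) • v.2.1,
      -(1 / 2 * tr a : ℂ) * v.2.2)) := by
  refine (diagOp_apply _ _ _ v).trans ?_
  have h1 (r : ℝ) (u : AlbertC) : (r • (1 : Module.End ℝ Albert)).baseChange ℂ u = (r : ℂ) • u := by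
    rw [LinearMap.baseChange_smul, Module.End.one_eq_id, LinearMap.baseChange_id]
    exact RCLike.real_smul_eq_coe_smul (K := ℂ) r u
  rw [LinearMap.baseChange_sub, LinearMap.baseChange_add, LinearMap.baseChange_neg]
  simp only [LinearMap.sub_apply, LinearMap.add_apply, LinearMap.neg_apply, h1]
  push_cast
  rfl

theorem raise_apply (z : AlbertC) (v : V56) : raise z v =
    (((v.2.2 / 2) • z, 1 / 2 * innC z v.2.1), (freudC z v.1.1, 0)) := rfl

theorem lower_apply (w : AlbertC) (v : V56) : lower w v =
    ((freudC w v.2.1, 0), ((v.1.2 / 2) • w, 1 / 2 * innC w v.1.1)) := rfl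

theorem derOp_mul_derOp_sub (δ ε : Der Albert) :
    derOp δ * derOp ε - derOp ε * derOp δ = derOp ⁅δ, ε⁆ := by
  apply hom_ext <;> intros <;> 
    simp only [LinearMap.sub_apply, Module.End.mul_apply, derOp_apply, baseChange_incl, map_zero,
      Prod.mk_sub_mk, sub_zero, ← map_sub] <;> rfl

theorem derOp_mul_mulOp_sub (δ : Der Albert) (a : Albert) :
    derOp δ * mulOp a - mulOp a * derOp δ = mulOp ((δ : Module.End ℝ Albert) a) := by
  apply hom_ext <;> intros <;>
    simp only [LinearMap.sub_apply, Module.End.mul_apply, derOp_apply, mulOp_apply,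
      LinearMap.mulLeft_apply, baseChange_incl, map_zero, map_sub, map_add, map_neg, map_smul,
      Prod.mk_sub_mk, sub_zero, tr_der, smul_zero, mul_zero, neg_zero, add_zero,
      Complex.ofReal_zero, zero_smul, der_mul, zero_mul] <;>
    refine Prod.ext (Prod.ext ?_ ?_) (Prod.ext ?_ ?_) <;> (try rfl) <;> module

theorem derOp_mul_raise_sub (δ : Der Albert) (z : Albert) :
    derOp δ * raise (incl z) - raise (incl z) * derOp δ =
      raise (incl ((δ : Module.End ℝ Albert) z)) := by
  apply hom_ext <;> intros <;>
    simp only [LinearMap.sub_apply, Module.End.mul_apply, derOp_apply, raise_apply,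
      freudC_incl, innC_incl, baseChange_incl, map_zero, map_smul, zero_div, zero_smul, der_freud,
      Prod.mk_sub_mk, sub_zero, map_add, smul_zero, mul_zero, inn_der, zero_sub] <;>
    refine Prod.ext (Prod.ext ?_ ?_) (Prod.ext ?_ ?_) <;> (try rfl) <;>
    (try push_cast) <;> (first | module | ring)

theorem derOp_mul_lower_sub (δ : Der Albert) (z : Albert) :
    derOp δ * lower (incl z) - lower (incl z) * derOp δ =
      lower (incl ((δ : Module.End ℝ Albert) z)) := by
  apply hom_ext <;> intros <;>
    simp only [LinearMap.sub_apply, Module.End.mul_apply, derOp_apply, lower_apply,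
      freudC_incl, innC_incl, baseChange_incl, map_zero, map_smul, zero_div, zero_smul, der_freud,
      Prod.mk_sub_mk, sub_zero, map_add, smul_zero, mul_zero, inn_der, zero_sub] <;>
    refine Prod.ext (Prod.ext ?_ ?_) (Prod.ext ?_ ?_) <;> (try rfl) <;>
    (try push_cast) <;> (first | module | ring)

theorem mulOp_mul_mulOp_sub (a b : Albert) :
    mulOp a * mulOp b - mulOp b * mulOp a = derOp (innerDer a b) := by
  apply hom_ext <;> intros <;>
    simp only [LinearMap.sub_apply, Module.End.mul_apply, derOp_apply, mulOp_apply,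
      LinearMap.mulLeft_apply, baseChange_incl, map_zero, map_sub, map_add, map_neg, map_smul,
      Prod.mk_sub_mk, sub_zero, innerDer_apply, smul_zero, mul_zero, neg_zero, add_zero] <;>
    refine Prod.ext (Prod.ext ?_ ?_) (Prod.ext ?_ ?_) <;> (try rfl) <;> (first | module | ring)

/-- On the first copy of `𝔍` this is `mul_freud`; on the second copy it is associativity of the
trace form. -/
theorem mulOp_mul_raise_sub (a z : Albert) :
    mulOp a * raise (incl z) - raise (incl z) * mulOp a = raise (incl (a * z)) := by
  have hf (x : Albert) := congrArg incl (mul_freud a z x)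
  simp only [map_add, incl_smul] at hf
  apply hom_ext <;> intros <;>
    simp only [LinearMap.sub_apply, Module.End.mul_apply, raise_apply, mulOp_apply,
      LinearMap.mulLeft_apply, baseChange_incl, map_zero, map_sub, map_add, map_neg, map_smul,
      Prod.mk_sub_mk, sub_zero, smul_zero, mul_zero, neg_zero, add_zero, zero_div, zero_smul,
      freudC_incl, innC_incl, zero_sub, smul_eq_mul, mul_one] <;>
    refine Prod.ext (Prod.ext ?_ ?_) (Prod.ext ?_ ?_) <;> (try rfl)
  · rename_i x
    linear_combination (norm := module) -hf x
  · rename_i y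
    rw [← inn_mul, mul_comm z a]
    ring
  · module

theorem mulOp_mul_lower_sub (a z : Albert) :
    mulOp a * lower (incl z) - lower (incl z) * mulOp a = -lower (incl (a * z)) := by
  have hf (x : Albert) := congrArg incl (mul_freud a z x)
  simp only [map_add, incl_smul] at hf
  apply hom_ext <;> intros <;>
    simp only [LinearMap.sub_apply, Module.End.mul_apply, lower_apply, mulOp_apply,
      LinearMap.mulLeft_apply, baseChange_incl, map_zero, map_sub, map_add, map_neg, map_smul,
      Prod.mk_sub_mk, sub_zero, smul_zero, mul_zero, neg_zero, add_zero, zero_div, zero_smul,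
      freudC_incl, innC_incl, zero_sub, smul_eq_mul, mul_one, LinearMap.neg_apply, Prod.neg_mk] <;>
    refine Prod.ext (Prod.ext ?_ ?_) (Prod.ext ?_ ?_) <;> (try rfl)
  · rename_i y
    rw [← inn_mul, mul_comm z a]
    ring
  · module
  · rename_i x
    linear_combination (norm := module) hf x

/-- The only nonzero components of the products involve `z ▷ w` and `⟨z, w ▷ x⟩`, both symmetric in
`z` and `w` since the cubic form is. -/
theorem raise_mul_raise_sub (z w : Albert) :
    raise (incl z) * raise (incl w) - raise (incl w) * raise (incl z) = 0 := by
  apply hom_ext <;> intros <;>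
    simp only [LinearMap.sub_apply, Module.End.mul_apply, raise_apply,
      freudC_incl, innC_incl, map_zero, map_smul, zero_div, zero_smul,
      Prod.mk_sub_mk, sub_zero, smul_zero, mul_zero, smul_eq_mul, LinearMap.zero_apply,
      freud_comm w z, inn_comm w z, sub_self] <;>
    refine Prod.ext (Prod.ext ?_ ?_) (Prod.ext ?_ ?_) <;> try rfl
  rename_i x
  rw [← inn_freud_right w, freud_comm w, inn_freud_right z, inn_comm, inn_freud_right, sub_self]
  rfl

theorem lower_mul_lower_sub (z w : Albert) :
    lower (incl z) * lower (incl w) - lower (incl w) * lower (incl z) = 0 := by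
  apply hom_ext <;> intros <;>
    simp only [LinearMap.sub_apply, Module.End.mul_apply, lower_apply,
      freudC_incl, innC_incl, map_zero, map_smul, zero_div, zero_smul,
      Prod.mk_sub_mk, sub_zero, smul_zero, mul_zero, smul_eq_mul, LinearMap.zero_apply,
      freud_comm w z, inn_comm w z, sub_self] <;>
    refine Prod.ext (Prod.ext ?_ ?_) (Prod.ext ?_ ?_) <;> try rfl
  rename_i x
  rw [← inn_freud_right w, freud_comm w, inn_freud_right z, inn_comm, inn_freud_right, sub_self]
  rfl

/-- On the first copy of `𝔍` the left side is `¼ ⟨w, x⟩ z - w ▷ (z ▷ x)`, which `freud_freud`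
evaluates to half of `[L_z, L_w] + L_{z ∘ w} - ½ tr (z ∘ w)`. -/
theorem raise_mul_lower_sub (z w : Albert) :
    raise (incl z) * lower (incl w) - lower (incl w) * raise (incl z) =
      (1 / 2 : ℂ) • (mulOp (z * w) + derOp (innerDer z w)) := by
  have hf (w z x : Albert) := congrArg incl (freud_freud w z x)
  simp only [map_add, map_sub, incl_smul] at hf
  apply hom_ext <;> intros <;>
    simp only [LinearMap.sub_apply, Module.End.mul_apply, lower_apply, raise_apply, mulOp_apply,
      LinearMap.mulLeft_apply, baseChange_incl, map_zero, map_sub, map_add, map_neg, map_smul,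
      Prod.mk_sub_mk, sub_zero, smul_zero, mul_zero, neg_zero, add_zero, zero_div, zero_smul,
      freudC_incl, innC_incl, zero_sub, smul_eq_mul, mul_one, LinearMap.add_apply, Prod.mk_add_mk,
      LinearMap.smul_apply, Prod.smul_mk, derOp_apply, innerDer_apply, hf, inn_apply] <;>
    refine Prod.ext (Prod.ext ?_ ?_) (Prod.ext ?_ ?_) <;> (try rfl)
  · push_cast
    rw [mul_comm w z]
    module
  · push_cast
    module
  · rw [mul_comm w z]; ring

/-- The 56-dimensional representation. -/
noncomputable def rep : TKK →ₗ[ℝ] Module.End ℂ V56 where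
  toFun X := derOp X.1 - Complex.I • mulOp (X.2 0)
    + Complex.I • (raise (incl (X.2 1)) + lower (incl (X.2 1)))
    + (raise (incl (X.2 2)) - lower (incl (X.2 2)))
  map_add' X Y := by
    simp only [TKK.add_fst, TKK.add_snd, map_add]; module
  map_smul' c X := by
    have hs (f : AlbertC →ₗ[ℂ] Module.End ℂ V56) (x : Albert) :
        f (incl (c • x)) = (c : ℂ) • f (incl x) := by rw [incl_smul, map_smul]
    have hr (f : Module.End ℂ V56) : c • f = (c : ℂ) • f :=
      RCLike.real_smul_eq_coe_smul (K := ℂ) c f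
    simp only [TKK.smul_fst, TKK.smul_snd, map_smul derOp, map_smul mulOp, hs, RingHom.id_apply,
      hr]
    module

theorem rep_apply (X : TKK) : rep X = derOp X.1 - Complex.I • mulOp (X.2 0)
    + Complex.I • (raise (incl (X.2 1)) + lower (incl (X.2 1)))
    + (raise (incl (X.2 2)) - lower (incl (X.2 2))) := rfl

open TKK

theorem rep_ofDer (δ : Der Albert) : rep (ofDer δ) = derOp δ := by
  simp [rep_apply]

theorem rep_h_zero (a : Albert) : rep (h 0 a) = -Complex.I • mulOp a := by
  simp [rep_apply, h_snd]
  module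

theorem rep_h_one (p : Albert) :
    rep (h 1 p) = Complex.I • (raise (incl p) + lower (incl p)) := by
  simp [rep_apply, h_snd]

theorem rep_h_two (q : Albert) : rep (h 2 q) = raise (incl q) - lower (incl q) := by
  simp [rep_apply, h_snd]

theorem rep_lie_derOp (δ : Der Albert) (X : TKK) :
    rep ⁅ofDer δ, X⁆ = rep (ofDer δ) * rep X - rep X * rep (ofDer δ) := by
  have h2 := derOp_mul_mulOp_sub δ (X.2 0)
  have h3 := derOp_mul_raise_sub δ (X.2 1)
  have h4 := derOp_mul_raise_sub δ (X.2 2)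
  have h5 := derOp_mul_lower_sub δ (X.2 1)
  have h6 := derOp_mul_lower_sub δ (X.2 2)
  have h1 := derOp_mul_derOp_sub δ X.1
  rw [rep_ofDer, rep_apply, rep_apply]
  simp only [lie_fst, lie_snd, ofDer_fst, ofDer_snd, map_zero, LinearMap.zero_apply, zero_mul,
    Finset.sum_const_zero, sub_zero, add_zero, app, map_zero, ← h1, ← h2, ← h3, ← h4, ← h5, ← h6,
    mul_add, mul_sub, add_mul, sub_mul, smul_mul_assoc, mul_smul_comm]
  module

theorem rep_lie_h_self (i : Fin 3) (x y : Albert) :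
    rep ⁅h i x, h i y⁆ = rep (h i x) * rep (h i y) - rep (h i y) * rep (h i x) := by
  have hI : Complex.I * Complex.I = -1 := Complex.I_mul_I
  rw [lie_h_h_self, map_neg, rep_ofDer]
  have h1 := raise_mul_raise_sub x y
  have h2 := lower_mul_lower_sub x y
  have h3 := raise_mul_lower_sub x y
  have h4 := raise_mul_lower_sub y x
  rw [mul_comm y x, innerDer_skew, map_neg] at h4
  have hc : i = 0 ∨ i = 1 ∨ i = 2 := by decide +revert
  rcases hc with rfl | rfl | rfl
  · rw [rep_h_zero, rep_h_zero, ← mulOp_mul_mulOp_sub]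
    simp only [smul_mul_assoc, mul_smul_comm, smul_smul, neg_mul_neg, hI]
    module
  · rw [rep_h_one, rep_h_one]
    simp only [smul_mul_assoc, mul_smul_comm, smul_smul, smul_add, hI, mul_add, add_mul]
    linear_combination (norm := module) h1 + h2 + h3 - h4
  · rw [rep_h_two, rep_h_two]
    simp only [mul_sub, sub_mul]
    linear_combination (norm := module) -h1 - h2 + h3 - h4

theorem rep_lie_h_zero_one (x y : Albert) :
    rep ⁅h 0 x, h 1 y⁆ = rep (h 0 x) * rep (h 1 y) - rep (h 1 y) * rep (h 0 x) := by
  have hI : Complex.I * Complex.I = -1 := Complex.I_mul_I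
  have e : ⁅h 0 x, h 1 y⁆ = h 2 (x * y) := lie_h_h_add1 0 x y
  have h1 := mulOp_mul_raise_sub x y
  have h2 := mulOp_mul_lower_sub x y
  rw [e, rep_h_zero, rep_h_one, rep_h_two]
  simp only [smul_mul_assoc, mul_smul_comm, smul_smul, smul_add, neg_mul, mul_neg, hI, mul_add, add_mul,
    neg_neg]
  linear_combination (norm := module) -h1 - h2

theorem rep_lie_h_zero_two (x y : Albert) :
    rep ⁅h 0 x, h 2 y⁆ = rep (h 0 x) * rep (h 2 y) - rep (h 2 y) * rep (h 0 x) := by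
  have e : ⁅h 0 x, h 2 y⁆ = -h 1 (x * y) := lie_h_h_add2 0 x y
  have h1 := mulOp_mul_raise_sub x y
  have h2 := mulOp_mul_lower_sub x y
  rw [e, map_neg, rep_h_zero, rep_h_one, rep_h_two]
  simp only [smul_mul_assoc, mul_smul_comm, mul_sub, sub_mul]
  linear_combination (norm := module) Complex.I • h1 - Complex.I • h2

theorem rep_lie_h_one_two (x y : Albert) :
    rep ⁅h 1 x, h 2 y⁆ = rep (h 1 x) * rep (h 2 y) - rep (h 2 y) * rep (h 1 x) := by
  have e : ⁅h 1 x, h 2 y⁆ = h 0 (x * y) := lie_h_h_add1 1 x y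
  have h1 := raise_mul_raise_sub x y
  have h2 := lower_mul_lower_sub x y
  have h3 := raise_mul_lower_sub x y
  have h4 := raise_mul_lower_sub y x
  rw [mul_comm y x, innerDer_skew, map_neg] at h4
  rw [e, rep_h_zero, rep_h_one, rep_h_two]
  simp only [smul_mul_assoc, mul_smul_comm, mul_sub, sub_mul, mul_add, add_mul]
  linear_combination (norm := module) Complex.I • (h3 + h4 - h1 + h2)

theorem rep_lie_symm {X Y : TKK} (hXY : rep ⁅X, Y⁆ = rep X * rep Y - rep Y * rep X) :
    rep ⁅Y, X⁆ = rep Y * rep X - rep X * rep Y := by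
  rw [← lie_skew, map_neg, hXY, neg_sub]

theorem rep_lie_h (i k : Fin 3) (x y : Albert) :
    rep ⁅h i x, h k y⁆ = rep (h i x) * rep (h k y) - rep (h k y) * rep (h i x) := by
  have hc : ∀ i : Fin 3, i = 0 ∨ i = 1 ∨ i = 2 := by decide
  rcases hc i with rfl | rfl | rfl <;> rcases hc k with rfl | rfl | rfl
  · exact rep_lie_h_self 0 x y
  · exact rep_lie_h_zero_one x y
  · exact rep_lie_h_zero_two x y
  · exact rep_lie_symm (rep_lie_h_zero_one y x)
  · exact rep_lie_h_self 1 x y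
  · exact rep_lie_h_one_two x y
  · exact rep_lie_symm (rep_lie_h_zero_two y x)
  · exact rep_lie_symm (rep_lie_h_one_two y x)
  · exact rep_lie_h_self 2 x y

/-- Bilinearity reduces the claim to derivations and elements `hᵢ ⊗ x`, where the commutator table
of `derOp`, `mulOp`, `raise` and `lower` applies. -/
theorem rep_lie (X Y : TKK) : rep ⁅X, Y⁆ = rep X * rep Y - rep Y * rep X := by
  induction X using TKK.induction with
  | hadd X X' h1 h2 => rw [add_lie, map_add, h1, h2, map_add, add_mul, mul_add]; abel
  | hder δ => exact rep_lie_derOp δ Y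
  | hh i x =>
    induction Y using TKK.induction with
    | hadd Y Y' h1 h2 => rw [lie_add, map_add, h1, h2, map_add, add_mul, mul_add]; abel
    | hder δ => exact rep_lie_symm (rep_lie_derOp δ _)
    | hh k y => exact rep_lie_h i k x y

end Yokota


/-! ### Yokota's action, faithfulness and irreducibility -/

namespace Yokota

open TKK

theorem baseChange_mulRight (a : Albert) (x : AlbertC) :
    (LinearMap.mulRight ℝ a).baseChange ℂ x = (LinearMap.mulLeft ℝ a).baseChange ℂ x := by
  congr 2
  ext1 y
  exact mul_comm y a

theorem sqrt_three_mul (τ : ℝ) : √(3 * τ) = 3 * √(τ / 3) := by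
  rw [show 3 * τ = 3 ^ 2 * (τ / 3) by ring, Real.sqrt_mul (by norm_num),
    Real.sqrt_sq (by norm_num)]

/-- The parameters `s` and `ν` merge into `a = s + √(τ/3) ν I₃`. Since `tr a = 3 √(τ/3) ν`, the
shift in `mulOp a` turns the scalar part into `-½ √(τ/3) ν` on the first copy of `𝔍`, and the first
copy of `ℂ` gets `½ √(3τ) ν`; multiplying by `-i` gives the stated constants. -/
theorem yokota_eq_rep (τ : ℝ) (δ : Der Albert) (s : traceless) (ν : ℝ) (p q : Albert) :
    yokota τ δ s ν p q =
      rep (ofDer δ + h 0 ((s : Albert) + (√(τ / 3) * ν) • idMat) + h 1 p + h 2 q) := by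
  have hs : tr (s : Albert) = 0 := s.2
  have hd : ((√(3 * τ) : ℝ) : ℂ) = 3 * ((√(τ / 3) : ℝ) : ℂ) := by
    rw [sqrt_three_mul]; push_cast; rfl
  have hid (x : AlbertC) : (LinearMap.mulLeft ℝ idMat).baseChange ℂ x = x := by
    have : LinearMap.mulLeft ℝ idMat = LinearMap.id := by ext1 y; exact idMat_mul y
    rw [this, LinearMap.baseChange_id]; rfl
  have hsm (f : Module.End ℂ V56) : (√(τ / 3) * ν) • f =
      (((√(τ / 3) : ℝ) : ℂ) * (ν : ℂ)) • f := by
    rw [← Complex.ofReal_mul]; exact RCLike.real_smul_eq_coe_smul (K := ℂ) _ f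
  apply LinearMap.ext
  intro v
  rw [map_add, map_add, map_add, rep_ofDer, rep_h_zero, rep_h_one, rep_h_two, map_add, map_smul,
    hsm]
  simp only [LinearMap.add_apply, LinearMap.sub_apply, LinearMap.smul_apply, derOp_apply,
    mulOp_apply, raise_apply, lower_apply, hs, tr_idMat, hid]
  simp only [yokota, LinearMap.coe_mk, AddHom.coe_mk, tmul_eq, one_smul, phi, phiT,
    LinearMap.sub_apply, LinearMap.smul_apply, LinearMap.neg_apply, baseChange_mulRight, hd,
    map_add, map_neg, LinearMap.add_apply, map_smul, smul_eq_mul]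
  refine Prod.ext (Prod.ext ?_ ?_) (Prod.ext ?_ ?_) <;>
    simp only [Prod.fst_add, Prod.snd_add, Prod.fst_sub, Prod.snd_sub, Prod.smul_fst,
      Prod.smul_snd, smul_eq_mul, Complex.ofReal_zero, mul_zero, zero_smul, zero_mul, neg_zero,
      Complex.ofReal_ofNat]
  · module
  · ring
  · module
  · ring

theorem jAll_last (τ : ℝ) (j : Module.Basis (Fin 26) ℝ traceless) :
    jAll τ j (Fin.last 26) = √(τ / 3) • idMat := Fin.snoc_last _ _

theorem jAll_castSucc (τ : ℝ) (j : Module.Basis (Fin 26) ℝ traceless) (a : Fin 26) :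
    jAll τ j a.castSucc = (j a : Albert) := Fin.snoc_castSucc _ _ _

/-- The constant `k_A` turns `j₂₇ = √(τ/3) I₃` into `2 I₃`, and `hᵢ ⊗ 2 I₃` is the element
corresponding to `ad hᵢ`. -/
theorem smul_YOp (τ : ℝ) (hτ : 0 < τ) (j : Module.Basis (Fin 26) ℝ traceless)
    (D : Module.Basis (Fin 52) ℝ (Der Albert)) (A : Idx133) :
    (Sum.elim (fun _ => 2 * √(3 / τ)) (fun _ => 1) A : ℝ) • YOp τ j D A =
      rep (psiBasis j D A) := by
  have hk : 2 * √(3 / τ) * √(τ / 3) = 2 := by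
    rw [mul_assoc, ← Real.sqrt_mul (by positivity), show 3 / τ * (τ / 3) = 1 by field_simp,
      Real.sqrt_one, mul_one]
  have hc : ∀ i : Fin 3, i = 0 ∨ i = 1 ∨ i = 2 := by decide
  have hz : ((0 : traceless) : Albert) = 0 := rfl
  rw [psiBasis_apply]
  rcases A with L | I | ⟨i, a⟩
  · have hY : YOp τ j D (.inl L) = rep (h L (√(τ / 3) • idMat)) := by
      rcases hc L with rfl | rfl | rfl <;>
        simp only [YOp, yokota_eq_rep, jAll_last] <;> simp [hz]
    show (2 * √(3 / τ)) • _ = rep (h L ((2 : ℝ) • idMat))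
    rw [hY, ← map_smul, ← map_smul, smul_smul, hk]
  · simp [YOp, psi, yokota_eq_rep, hz]
  · rcases hc i with rfl | rfl | rfl <;> simp [YOp, psi, yokota_eq_rep, hz]

theorem exists_eq_incl (x : AlbertC) : ∃ a b : Albert, x = incl a + Complex.I • incl b := by
  induction x using TensorProduct.induction_on with
  | zero => exact ⟨0, 0, by simp⟩
  | tmul c x =>
    refine ⟨c.re • x, c.im • x, ?_⟩
    rw [incl_smul, incl_smul, smul_smul, ← add_smul, tmul_eq, mul_comm, Complex.re_add_im]
  | add x y hx hy =>
    obtain ⟨a, b, rfl⟩ := hx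
    obtain ⟨c, d, rfl⟩ := hy
    exact ⟨a + c, b + d, by simp only [map_add]; module⟩

/-- The real part of an element of `𝔍_ℂ`. -/
noncomputable def reC : AlbertC →ₗ[ℝ] Albert :=
  (TensorProduct.lid ℝ Albert).toLinearMap ∘ₗ Complex.reLm.rTensor Albert

theorem reC_smul_incl (c : ℂ) (x : Albert) : reC (c • incl x) = c.re • x := by
  rw [← tmul_eq]; simp [reC]

theorem eq_zero_of_incl_add {a b : Albert} (hab : incl a + Complex.I • incl b = 0) :
    a = 0 ∧ b = 0 := by
  have e1 := congrArg reC hab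
  have e2 := congrArg reC (congrArg (Complex.I • ·) hab)
  simp only [smul_add, smul_smul, smul_zero] at e2
  rw [map_add, map_zero, ← one_smul ℂ (incl a), reC_smul_incl, reC_smul_incl] at e1
  rw [map_add, map_zero, reC_smul_incl, reC_smul_incl] at e2
  simp at e1 e2
  exact ⟨e1, e2⟩

theorem exists_innC_ne_zero {y : AlbertC} (hy : y ≠ 0) : ∃ z, innC (incl z) y ≠ 0 := by
  by_contra! hz
  obtain ⟨a, b, rfl⟩ := exists_eq_incl y
  apply hy
  have key (z : Albert) : inn z a = 0 ∧ inn z b = 0 := by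
    have e := hz z
    rw [map_add, map_smul, innC_incl, innC_incl, smul_eq_mul] at e
    have e1 := congrArg Complex.re e
    have e2 := congrArg Complex.im e
    simp at e1 e2
    exact ⟨e1, e2⟩
  have ha : a = 0 := inn_self_eq_zero (key a).1
  have hb : b = 0 := inn_self_eq_zero (key b).2
  simp [ha, hb]

/-- From this formula `I₃ ▷ ·` is `-½` on traceless elements and fixes `I₃`. It is therefore
invertible, as the irreducibility argument needs. -/
theorem freudC_idMat (x : AlbertC) :
    freudC (incl idMat) x = (1 / 2 : ℂ) • (innC (incl idMat) x • incl idMat - x) := by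
  have e : freudC (incl idMat) = (1 / 2 : ℂ) • ((innC (incl idMat)).smulRight (incl idMat)
      - LinearMap.id) := by
    apply hom_ext_albertC
    intro y
    simp only [freudC_incl, LinearMap.smul_apply, LinearMap.sub_apply, LinearMap.smulRight_apply,
      innC_incl, LinearMap.id_apply, inn_idMat_left]
    rw [← incl_smul, ← map_sub, show (1 / 2 : ℂ) = ((1 / 2 : ℝ) : ℂ) by push_cast; rfl,
      ← incl_smul]
    congr 1
    rw [freud_apply, idMat_mul, tr_idMat]
    module
  rw [e]; rfl

theorem innC_idMat_idMat : innC (incl idMat) (incl idMat) = 3 := by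
  rw [innC_incl, inn_idMat_left, tr_idMat]; norm_num

theorem freudC_idMat_eq_zero {x : AlbertC} (hx : freudC (incl idMat) x = 0) : x = 0 := by
  rw [freudC_idMat, smul_eq_zero_iff_right (by norm_num), sub_eq_zero] at hx
  have e := congrArg (innC (incl idMat)) hx
  rw [map_smul, innC_idMat_idMat, smul_eq_mul] at e
  have e0 : innC (incl idMat) x = 0 := by linear_combination (1 / 2 : ℂ) * e
  rw [← hx, e0, zero_smul]

theorem exists_freudC_idMat_eq (x : AlbertC) : ∃ y, freudC (incl idMat) y = x := by
  refine ⟨innC (incl idMat) x • incl idMat - (2 : ℂ) • x, ?_⟩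
  rw [freudC_idMat, map_sub, map_smul, map_smul, innC_idMat_idMat, smul_eq_mul, smul_eq_mul]
  module

/-- The scalar vectors detect the trace of the `h₁`-component and the combination `q + i p` of the
other two. The block `δ - i L_s` applied to real elements then yields `δ` and `s` as real and
imaginary parts. -/
theorem rep_injective : Function.Injective rep := by
  rw [injective_iff_map_eq_zero]
  intro X hX
  have hv (v : V56) : rep X v = 0 := by rw [hX]; rfl
  have h1 := congrArg (fun u : V56 => u.1.1) (hv ((0, 0), (0, 1)))
  have h2 := congrArg (fun u : V56 => u.1.2) (hv ((0, 1), (0, 0)))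
  have h3 (x : Albert) := congrArg (fun u : V56 => u.1.1) (hv ((incl x, 0), (0, 0)))
  simp [rep_apply, derOp_apply, mulOp_apply, raise_apply, lower_apply, baseChange_incl,
    freudC_incl, innC_incl] at h1 h2 h3
  have h4 := fun x => eq_zero_of_incl_add (a := X.1.1 x) (b := -(X.2 0 * x)) (by
    have e := h3 x
    rw [h2, Complex.ofReal_zero, mul_zero, zero_smul, sub_zero] at e
    rw [← e, map_neg]; module)
  have h5 := eq_zero_of_incl_add (a := X.2 2) (b := X.2 1) (by
    linear_combination (norm := module) (2 : ℂ) • h1)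
  have h6 := (h4 idMat).2
  rw [mul_idMat, neg_eq_zero] at h6
  have hc : ∀ i : Fin 3, i = 0 ∨ i = 1 ∨ i = 2 := by decide
  refine TKK.ext' (der_ext fun x => (h4 x).1) fun i => ?_
  rcases hc i with rfl | rfl | rfl
  exacts [h6, h5.2, h5.1]

/-- An invariant subspace is stable under `mulOp`, `raise` and `lower` separately. The operator
`mulOp I₃` has the distinct eigenvalues `-1/2, 3/2, 1/2, -3/2` on the four summands, so the
components of every vector of `W` lie in `W`. Raising carries a nonzero component to the first copy
of `ℂ`, and lowering from there recovers all of `V₅₆`. -/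
theorem irreducible (W : Submodule ℂ V56) (hW : ∀ X, ∀ v ∈ W, rep X v ∈ W) : W = ⊥ ∨ W = ⊤ := by
  have hM (a : Albert) (v : V56) (hv : v ∈ W) : mulOp a v ∈ W := by
    have e := W.smul_mem Complex.I (hW (h 0 a) v hv)
    rw [rep_h_zero, LinearMap.smul_apply, smul_smul] at e
    simpa using e
  have hRL (z : Albert) (v : V56) (hv : v ∈ W) :
      raise (incl z) v ∈ W ∧ lower (incl z) v ∈ W := by
    have e1 := W.smul_mem (-Complex.I) (hW (h 1 z) v hv)
    have e2 := hW (h 2 z) v hv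
    rw [rep_h_one, LinearMap.smul_apply, smul_smul, LinearMap.add_apply,
      show -Complex.I * Complex.I = 1 by simp, one_smul] at e1
    rw [rep_h_two, LinearMap.sub_apply] at e2
    constructor
    · have e3 := W.smul_mem (1 / 2 : ℂ) (W.add_mem e1 e2)
      convert e3 using 1; module
    · have e3 := W.smul_mem (1 / 2 : ℂ) (W.sub_mem e1 e2)
      convert e3 using 1; module
  have hR (z : Albert) (v : V56) (hv : v ∈ W) := (hRL z v hv).1
  have hL (z : Albert) (v : V56) (hv : v ∈ W) := (hRL z v hv).2
  have hid (x : AlbertC) : (LinearMap.mulLeft ℝ idMat).baseChange ℂ x = x := by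
    have : LinearMap.mulLeft ℝ idMat = LinearMap.id := by ext1 y; exact idMat_mul y
    rw [this, LinearMap.baseChange_id]; rfl
  have hT (v : V56) : mulOp idMat v = ((-(1 / 2 : ℂ) • v.1.1, (3 / 2 : ℂ) * v.1.2),
      ((1 / 2 : ℂ) • v.2.1, -(3 / 2 : ℂ) * v.2.2)) := by
    rw [mulOp_apply, hid, hid, tr_idMat]
    refine Prod.ext (Prod.ext ?_ ?_) (Prod.ext ?_ ?_) <;> simp only [Complex.ofReal_ofNat]
    · module
    · ring
    · module
    · ring
  have hTc (c : ℂ) (v : V56) (hv : v ∈ W) : (((-(1 / 2 : ℂ) - c) • v.1.1, (3 / 2 - c) * v.1.2),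
      ((1 / 2 - c) • v.2.1, (-(3 / 2 : ℂ) - c) * v.2.2)) ∈ W := by
    have e := W.sub_mem (hM idMat v hv) (W.smul_mem c hv)
    rw [hT] at e
    convert e using 1
    refine Prod.ext (Prod.ext ?_ ?_) (Prod.ext ?_ ?_) <;> 
      simp only [Prod.fst_sub, Prod.snd_sub, Prod.smul_fst, Prod.smul_snd, smul_eq_mul]
    · module
    · ring
    · module
    · ring
  -- The product of `mulOp I₃ - c` over the three other eigenvalues, divided by its value on the
  -- chosen summand, is the projection; the same pattern gives `c2`, `c3` and `c4`.
  have c1 (v : V56) (hv : v ∈ W) : ((v.1.1, 0), (0, 0)) ∈ W := by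
    have e := W.smul_mem (1 / 2 : ℂ) (hTc (3 / 2) _ (hTc (1 / 2) _ (hTc (-(3 / 2)) v hv)))
    convert e using 1
    simp [smul_smul]
    norm_num
  have c2 (v : V56) (hv : v ∈ W) : ((0, v.1.2), (0, 0)) ∈ W := by
    have e := W.smul_mem (1 / 6 : ℂ) (hTc (-(1 / 2)) _ (hTc (1 / 2) _ (hTc (-(3 / 2)) v hv)))
    convert e using 1
    simp [smul_smul]
    norm_num
    ring
  have c3 (v : V56) (hv : v ∈ W) : ((0, 0), (v.2.1, 0)) ∈ W := by
    have e := W.smul_mem (-1 / 2 : ℂ) (hTc (-(1 / 2)) _ (hTc (3 / 2) _ (hTc (-(3 / 2)) v hv)))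
    convert e using 1
    simp [smul_smul]
    norm_num
  have c4 (v : V56) (hv : v ∈ W) : ((0, 0), (0, v.2.2)) ∈ W := by
    have e := W.smul_mem (-1 / 6 : ℂ) (hTc (-(1 / 2)) _ (hTc (3 / 2) _ (hTc (1 / 2) v hv)))
    convert e using 1
    simp [smul_smul]
    norm_num
    ring
  rw [or_iff_not_imp_left]
  intro hne
  -- Raising moves along second `ℂ`, first `𝔍`, second `𝔍`, first `ℂ`; with suitable `z` no step
  -- annihilates a given nonzero component.
  have m1 : ∃ μ : ℂ, μ ≠ 0 ∧ ((0, μ), (0, 0)) ∈ W := by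
    have hy (y : AlbertC) (hy : y ≠ 0) (hv : ((0, 0), (y, 0)) ∈ W) :
        ∃ μ : ℂ, μ ≠ 0 ∧ ((0, μ), (0, 0)) ∈ W := by
      obtain ⟨z, hz⟩ := exists_innC_ne_zero hy
      exact ⟨_, mul_ne_zero (by norm_num : (1 / 2 : ℂ) ≠ 0) hz, c2 _ (hR z _ hv)⟩
    have hx (x : AlbertC) (hx : x ≠ 0) (hv : ((x, 0), (0, 0)) ∈ W) :
        ∃ μ : ℂ, μ ≠ 0 ∧ ((0, μ), (0, 0)) ∈ W :=
      hy _ (fun h0 => hx (freudC_idMat_eq_zero h0)) (c3 _ (hR idMat _ hv))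
    obtain ⟨v, hv, hv0⟩ := (Submodule.ne_bot_iff W).1 hne
    by_cases h1 : v.1.1 = 0
    · by_cases h2 : v.1.2 = 0
      · by_cases h3 : v.2.1 = 0
        · have h4 : v.2.2 ≠ 0 := fun h4 =>
            hv0 (Prod.ext (Prod.ext h1 h2) (Prod.ext h3 h4))
          refine hx _ ?_ (c1 _ (hR idMat _ (c4 v hv)))
          intro h0
          have h5 := congrArg (innC (incl idMat)) h0
          rw [raise_apply] at h5
          simp [innC_idMat_idMat, h4] at h5
        · exact hy _ h3 (c3 v hv)
      · exact ⟨_, h2, c2 v hv⟩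
    · exact hx _ h1 (c1 v hv)
  obtain ⟨μ, hμ0, hμ⟩ := m1
  have a2 (ν : ℂ) : ((0, ν), (0, 0)) ∈ W := by
    have e := W.smul_mem (ν / μ) hμ
    convert e using 1
    simp [hμ0]
  have a3 (y : AlbertC) : ((0, 0), (y, 0)) ∈ W := by
    have hr (z : Albert) : ((0, 0), (incl z, 0)) ∈ W := by
      have e := hL z _ (a2 2)
      rw [lower_apply] at e
      convert e using 1
      simp
    obtain ⟨a, b, rfl⟩ := exists_eq_incl y
    have e := W.add_mem (hr a) (W.smul_mem Complex.I (hr b))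
    convert e using 1
    simp
  have a1 (x : AlbertC) : ((x, 0), (0, 0)) ∈ W := by
    obtain ⟨y, rfl⟩ := exists_freudC_idMat_eq x
    exact c1 _ (hL idMat _ (a3 y))
  have a4 (ν : ℂ) : ((0, 0), (0, ν)) ∈ W := by
    -- The factor `2/3` inverts `½ ⟨I₃, I₃⟩ = 3/2`.
    have e := W.smul_mem (2 / 3 * ν) (c4 _ (hL idMat _ (a1 (incl idMat))))
    rw [lower_apply] at e
    convert e using 1
    simp [innC_idMat_idMat]
    ring
  rw [eq_top_iff]
  intro v _
  have e := W.add_mem (W.add_mem (a1 v.1.1) (a2 v.1.2)) (W.add_mem (a3 v.2.1) (a4 v.2.2))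
  convert e using 1
  refine Prod.ext (Prod.ext ?_ ?_) (Prod.ext ?_ ?_) <;> simp

end Yokota


/-! ### Coordinates on the Jordan algebra and on `V₅₆` -/

namespace Yokota

open TKK

section Coordinates

/-- The normalization `⟨j_a, j_b⟩ = τ δ_{ab}`. -/
abbrev Normalized (τ : ℝ) (j : Module.Basis (Fin 26) ℝ traceless) : Prop :=
  ∀ a b, inn (j a : Albert) (j b : Albert) = if a = b then τ else 0

variable {τ : ℝ} {j : Module.Basis (Fin 26) ℝ traceless}

theorem inn_jAll (hτ : 0 < τ) (hj : Normalized τ j)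
    (μ ν : Fin 27) : inn (jAll τ j μ) (jAll τ j ν) = if μ = ν then τ else 0 := by
  have ht (a : Fin 26) : tr (j a : Albert) = 0 := (j a).2
  induction μ using Fin.lastCases with
  | last =>
    induction ν using Fin.lastCases with
    | last =>
      simp only [jAll_last, map_smul, LinearMap.smul_apply, inn_idMat_left, tr_idMat, smul_eq_mul,
        if_true]
      rw [← mul_assoc, Real.mul_self_sqrt (by positivity)]
      ring
    | cast b =>
      rw [jAll_last, jAll_castSucc, map_smul, LinearMap.smul_apply, inn_idMat_left, ht, smul_zero,
        if_neg (Fin.castSucc_lt_last b).ne']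
  | cast a =>
    induction ν using Fin.lastCases with
    | last =>
      rw [jAll_last, jAll_castSucc, map_smul, inn_idMat_right, ht, smul_zero,
        if_neg (Fin.castSucc_lt_last a).ne]
    | cast b => simp only [jAll_castSucc, hj, Fin.castSucc_inj]

theorem jDual_jAll (hτ : 0 < τ) (hj : Normalized τ j)
    (μ ν : Fin 27) : jDual τ j μ (jAll τ j ν) = if μ = ν then 1 else 0 := by
  rw [jDual, inn_jAll hτ hj]
  split_ifs <;> simp [hτ.ne']

theorem eq_zero_of_inn_jAll (hτ : 0 < τ) (y : Albert) (hy : ∀ μ, inn (jAll τ j μ) y = 0) : y = 0 := by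
  have h1 : (inn.flip y) ∘ₗ traceless.subtype = 0 := by
    apply j.ext
    intro a
    have e := hy a.castSucc
    rwa [jAll_castSucc] at e
  have h2 : inn idMat y = 0 := by
    have e := hy (Fin.last 26)
    rw [jAll_last, map_smul, LinearMap.smul_apply, smul_eq_mul] at e
    exact (mul_eq_zero.1 e).resolve_left (Real.sqrt_pos.2 (by positivity)).ne'
  have h3 : inn (tl y) y = 0 := congrArg (fun f : traceless →ₗ[ℝ] ℝ => f ⟨tl y, tr_tl y⟩) h1
  apply inn_self_eq_zero
  rw [tl_apply, map_sub, map_smul, LinearMap.sub_apply, LinearMap.smul_apply, h2, smul_zero,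
    sub_zero] at h3
  exact h3

theorem sum_jDual_smul (hτ : 0 < τ) (hj : Normalized τ j)
    (x : Albert) : x = ∑ μ, jDual τ j μ x • jAll τ j μ := by
  rw [← sub_eq_zero]
  apply eq_zero_of_inn_jAll (j := j) hτ
  intro μ
  simp only [map_sub, map_sum, map_smul, inn_jAll hτ hj, smul_eq_mul, mul_ite, mul_zero,
    Finset.sum_ite_eq, Finset.mem_univ, if_true]
  rw [jDual]
  field_simp
  ring

end Coordinates

open scoped Matrix

section Matrices

variable (j : Module.Basis (Fin 26) ℝ traceless)

/-- The matrix of an endomorphism of `𝔍` in the basis `j_μ`, with complex entries. -/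
noncomputable def matC (f : Module.End ℝ Albert) : Matrix (Fin 27) (Fin 27) ℂ :=
  Matrix.of fun μ ν => (jDual 2 j μ (f (jAll 2 j ν)) : ℂ)

/-- The coordinates of an element of `𝔍` in the basis `j_μ`. -/
noncomputable def coordC (x : Albert) : Fin 27 → ℂ := fun μ => (jDual 2 j μ x : ℂ)

/-- The element of `𝔍_ℂ` with given coordinates. -/
noncomputable def toAlbertC : (Fin 27 → ℂ) →ₗ[ℂ] AlbertC where
  toFun v := ∑ μ, v μ ⊗ₜ[ℝ] jAll 2 j μ
  map_add' v w := by simp only [Pi.add_apply, TensorProduct.add_tmul, Finset.sum_add_distrib]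
  map_smul' c v := by
    simp only [Pi.smul_apply, Finset.smul_sum, TensorProduct.smul_tmul', RingHom.id_apply]

theorem toAlbertC_apply (v : Fin 27 → ℂ) : toAlbertC j v = ∑ μ, v μ • incl (jAll 2 j μ) := by
  show ∑ μ, v μ ⊗ₜ[ℝ] jAll 2 j μ = _
  exact Finset.sum_congr rfl fun μ _ => tmul_eq (v μ) (jAll 2 j μ)

variable {j}

theorem jDual_sum_smul (μ : Fin 27) (c : Fin 27 → ℝ) (x : Fin 27 → Albert) :
    jDual 2 j μ (∑ ν, c ν • x ν) = ∑ ν, c ν * jDual 2 j μ (x ν) := by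
  simp only [jDual, map_sum, map_smul, smul_eq_mul, Finset.mul_sum]
  exact Finset.sum_congr rfl fun _ _ => by ring

/-- The 2 is the common length `⟨j_μ, j_μ⟩`. Scaling the two scalar coordinates by `√2` splits it
evenly, so that in `block56` the row and the column of each off-diagonal block are transposes of
each other. -/
theorem innC_toAlbertC (z : Albert) (v : Fin 27 → ℂ) :
    innC (incl z) (toAlbertC j v) = 2 * (coordC j z ⬝ᵥ v) := by
  rw [toAlbertC_apply, map_sum, dotProduct, Finset.mul_sum]
  refine Finset.sum_congr rfl fun μ _ => ?_
  rw [map_smul, innC_incl, coordC, jDual, inn_comm, smul_eq_mul]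
  push_cast
  ring

theorem matC_transpose {f g : Module.End ℝ Albert} (hfg : ∀ x y, inn (f x) y = inn x (g y)) :
    (matC j f).transpose = matC j g := by
  ext μ ν
  simp only [matC, Matrix.transpose_apply, Matrix.of_apply, jDual]
  rw [← hfg, inn_comm]

theorem incl_eq_toAlbertC (hj : Normalized 2 j) (x : Albert) : incl x = toAlbertC j (coordC j x) := by
  rw [toAlbertC_apply]
  conv_lhs => rw [sum_jDual_smul two_pos hj x]
  rw [map_sum]
  exact Finset.sum_congr rfl fun _ _ => incl_smul _ _

theorem toAlbertC_matC (hj : Normalized 2 j) (f : Module.End ℝ Albert) (v : Fin 27 → ℂ) :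
    toAlbertC j (matC j f *ᵥ v) = f.baseChange ℂ (toAlbertC j v) := by
  have h1 (ν : Fin 27) : incl (f (jAll 2 j ν)) = ∑ μ, matC j f μ ν • incl (jAll 2 j μ) := by
    rw [incl_eq_toAlbertC hj, toAlbertC_apply]; rfl
  simp only [toAlbertC_apply, map_sum, map_smul, baseChange_incl, h1, Finset.smul_sum,
    Matrix.mulVec, dotProduct, Finset.sum_smul]
  rw [Finset.sum_comm]
  refine Finset.sum_congr rfl fun _ _ => Finset.sum_congr rfl fun _ _ => ?_
  rw [smul_smul, mul_comm]

theorem toAlbertC_bijective (hj : Normalized 2 j) : Function.Bijective (toAlbertC j) := by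
  constructor
  · rw [injective_iff_map_eq_zero]
    intro v hv
    funext μ
    have e := innC_toAlbertC (j := j) (jAll 2 j μ) v
    have hc : coordC j (jAll 2 j μ) = Pi.single μ 1 := by
      funext ν
      rw [coordC, jDual_jAll two_pos hj, Pi.single_apply]
      split_ifs <;> simp
    rw [hv, map_zero, hc, single_dotProduct, one_mul] at e
    simpa using e.symm
  · intro x
    obtain ⟨a, b, rfl⟩ := exists_eq_incl x
    exact ⟨coordC j a + Complex.I • coordC j b, by
      rw [map_add, map_smul, ← incl_eq_toAlbertC hj, ← incl_eq_toAlbertC hj]⟩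

theorem matC_mul (hj : Normalized 2 j) (f g : Module.End ℝ Albert) : matC j (f * g) = matC j f * matC j g := by
  ext μ ν
  rw [Matrix.mul_apply]
  simp only [matC, Matrix.of_apply, Module.End.mul_apply, ← Complex.ofReal_mul,
    ← Complex.ofReal_sum]
  congr 1
  conv_lhs => rw [sum_jDual_smul two_pos hj (g (jAll 2 j ν)), map_sum]
  simp only [map_smul]
  rw [jDual_sum_smul]
  exact Finset.sum_congr rfl fun _ _ => mul_comm _ _

theorem trace_matC (hj : Normalized 2 j) (f : Module.End ℝ Albert) :
    (matC j f).trace = (LinearMap.trace ℝ Albert f : ℂ) := by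
  have e : LinearMap.trace ℝ Albert f = ∑ μ, jDual 2 j μ (f (jAll 2 j μ)) := by
    let b := basisOfTopLeSpanOfCardEqFinrank (R := ℝ) (jAll 2 j) (fun x _ => by
      rw [sum_jDual_smul two_pos hj x]
      exact Submodule.sum_mem _ fun μ _ => Submodule.smul_mem _ _ (Submodule.subset_span ⟨μ, rfl⟩))
      (by rw [Albert.finrank_eq]; rfl)
    have hb (μ) : b μ = jAll 2 j μ := by simp [b]
    have e := trace_eq_sum_of_orthonormal inn b two_ne_zero
      (fun μ ν => by rw [hb, hb]; exact inn_jAll two_pos hj μ ν) f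
    simp only [hb] at e
    exact e
  rw [e, Matrix.trace]
  push_cast
  rfl

theorem toV56_eq (u : Idx56 → ℂ) : toV56 j u =
    ((toAlbertC j (fun μ => u (.inl (.inl μ))), csqrt 2 * u (.inl (.inr ()))),
     (toAlbertC j (fun μ => u (.inr (.inl μ))), csqrt 2 * u (.inr (.inr ())))) := rfl

theorem csqrt_two_mul_self : csqrt 2 * csqrt 2 = 2 := by
  rw [csqrt, ← Complex.ofReal_mul, Real.mul_self_sqrt (by norm_num)]; norm_num

theorem csqrt_two_ne_zero : csqrt 2 ≠ 0 := fun h0 => by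
  have e := csqrt_two_mul_self
  rw [h0, mul_zero] at e
  norm_num at e

variable (j) in
/-- Coordinates on `V₅₆`. -/
noncomputable def toV56Lin : (Idx56 → ℂ) →ₗ[ℂ] V56 where
  toFun := toV56 j
  map_add' u v := by
    simp only [toV56_eq]
    refine Prod.ext (Prod.ext ?_ ?_) (Prod.ext ?_ ?_)
    · exact map_add (toAlbertC j) _ _
    · exact mul_add _ _ _
    · exact map_add (toAlbertC j) _ _
    · exact mul_add _ _ _
  map_smul' c u := by
    simp only [toV56_eq]
    refine Prod.ext (Prod.ext ?_ ?_) (Prod.ext ?_ ?_)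
    · exact map_smul (toAlbertC j) c _
    · exact mul_left_comm _ _ _
    · exact map_smul (toAlbertC j) c _
    · exact mul_left_comm _ _ _

theorem toV56_bijective (hj : Normalized 2 j) : Function.Bijective (toV56 j) := by
  have hb := toAlbertC_bijective hj
  constructor
  · intro u v huv
    simp only [toV56_eq, Prod.mk.injEq, hb.1.eq_iff, mul_right_inj' csqrt_two_ne_zero] at huv
    obtain ⟨⟨h1, h2⟩, h3, h4⟩ := huv
    funext i
    rcases i with (μ | i) | (μ | i)
    · exact congrFun h1 μ
    · exact h2
    · exact congrFun h3 μ
    · exact h4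
  · rintro ⟨⟨x, μ⟩, ⟨y, ν⟩⟩
    obtain ⟨a, rfl⟩ := hb.2 x
    obtain ⟨b, rfl⟩ := hb.2 y
    refine ⟨Sum.elim (Sum.elim a fun _ => μ / csqrt 2) (Sum.elim b fun _ => ν / csqrt 2), ?_⟩
    rw [toV56_eq]
    simp [mul_div_cancel₀, csqrt_two_ne_zero]

theorem toV56_block56 (P Q R S : Matrix (Fin 27) (Fin 27) ℂ) (v w : Fin 27 → ℂ) (c d : ℂ)
    (x y : Fin 27 → ℂ) (μ ν : ℂ) (u : Idx56 → ℂ)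
    (hu : u = Sum.elim (Sum.elim x fun _ => μ) (Sum.elim y fun _ => ν)) :
    toV56 j (block56 P Q R S v w c d *ᵥ u) =
      ((toAlbertC j (P *ᵥ x) + toAlbertC j (Q *ᵥ y) + ν • toAlbertC j v,
        csqrt 2 * (c * μ + v ⬝ᵥ y)),
       (toAlbertC j (R *ᵥ x) + μ • toAlbertC j w + toAlbertC j (S *ᵥ y),
        csqrt 2 * (w ⬝ᵥ x + d * ν))) := by
  subst hu
  rw [toV56_eq]
  simp only [← map_add, ← map_smul]
  refine Prod.ext (Prod.ext ?_ ?_) (Prod.ext ?_ ?_)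
  · show toAlbertC j _ = toAlbertC j _
    congr 1
    funext κ
    simp [block56, Matrix.mulVec, dotProduct, mul_comm]
    ring
  · show csqrt 2 * _ = csqrt 2 * _
    congr 1
    simp [block56, Matrix.mulVec, dotProduct]
  · show toAlbertC j _ = toAlbertC j _
    congr 1
    funext κ
    simp [block56, Matrix.mulVec, dotProduct, mul_comm]
  · show csqrt 2 * _ = csqrt 2 * _
    congr 1
    simp [block56, Matrix.mulVec, dotProduct]

end Matrices

end Yokota


/-! ### Explicit matrices -/

namespace Yokota

open TKK
open scoped Matrix

section Operators

variable (j : Module.Basis (Fin 26) ℝ traceless)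

/-- The matrix of a derivation of `𝔍` on `V₅₆`. -/
noncomputable def derMat (δ : Der Albert) : Matrix Idx56 Idx56 ℂ :=
  block56 (matC j (δ : Module.End ℝ Albert)) 0 0 (matC j (δ : Module.End ℝ Albert)) 0 0 0 0

/-- The matrix of `hᵢ ⊗ x` on `V₅₆`. -/
noncomputable def hMat (i : Fin 3) (x : Albert) : Matrix Idx56 Idx56 ℂ :=
  ![block56 (-Complex.I • matC j (LinearMap.mulLeft ℝ x - (1 / 2 * tr x) • 1)) 0 0
      (Complex.I • matC j (LinearMap.mulLeft ℝ x - (1 / 2 * tr x) • 1)) 0 0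
      (-Complex.I * (1 / 2 * tr x)) (Complex.I * (1 / 2 * tr x)),
    block56 0 (Complex.I • matC j (freud x)) (Complex.I • matC j (freud x)) 0
      ((Complex.I * csqrt 2 / 2) • coordC j x) ((Complex.I * csqrt 2 / 2) • coordC j x) 0 0,
    block56 0 (-matC j (freud x)) (matC j (freud x)) 0
      ((csqrt 2 / 2) • coordC j x) (-(csqrt 2 / 2) • coordC j x) 0 0] i

theorem eq_elim (u : Idx56 → ℂ) : u = Sum.elim
    (Sum.elim (fun μ => u (.inl (.inl μ))) fun _ => u (.inl (.inr ())))
    (Sum.elim (fun μ => u (.inr (.inl μ))) fun _ => u (.inr (.inr ()))) := by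
  funext i
  rcases i with (μ | i) | (μ | i) <;> rfl

theorem freudC_incl_eq (z : Albert) (x : AlbertC) :
    freudC (incl z) x = (freud z).baseChange ℂ x := by
  have e : freudC (incl z) = (freud z).baseChange ℂ :=
    hom_ext_albertC fun y => freudC_incl z y
  rw [e]

theorem baseChange_sub_smul_one (x : Albert) (v : AlbertC) :
    (LinearMap.mulLeft ℝ x - (1 / 2 * tr x) • 1 : Module.End ℝ Albert).baseChange ℂ v =
      (LinearMap.mulLeft ℝ x).baseChange ℂ v - (1 / 2 * tr x : ℂ) • v := by
  have h1 (r : ℝ) (u : AlbertC) : (r • (1 : Module.End ℝ Albert)).baseChange ℂ u = (r : ℂ) • u := by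
    rw [LinearMap.baseChange_smul, Module.End.one_eq_id, LinearMap.baseChange_id]
    exact RCLike.real_smul_eq_coe_smul (K := ℂ) r u
  rw [LinearMap.baseChange_sub, LinearMap.sub_apply, h1]
  push_cast
  rfl

variable {j}

theorem rep_ofDer_toV56 (hj : Normalized 2 j) (δ : Der Albert) (u : Idx56 → ℂ) :
    rep (ofDer δ) (toV56 j u) = toV56 j (derMat j δ *ᵥ u) := by
  rw [derMat, toV56_block56 _ _ _ _ _ _ _ _ _ _ _ _ u (eq_elim u), toV56_eq, rep_ofDer,
    derOp_apply]
  simp [toAlbertC_matC hj]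

theorem rep_h_toV56 (hj : Normalized 2 j) (i : Fin 3) (x : Albert) (u : Idx56 → ℂ) :
    rep (h i x) (toV56 j u) = toV56 j (hMat j i x *ᵥ u) := by
  have hc : i = 0 ∨ i = 1 ∨ i = 2 := by decide +revert
  have h2 := csqrt_two_mul_self
  rcases hc with rfl | rfl | rfl
  · show _ = toV56 j (block56 _ _ _ _ _ _ _ _ *ᵥ u)
    rw [toV56_block56 _ _ _ _ _ _ _ _ _ _ _ _ u (eq_elim u), toV56_eq, rep_h_zero,
      LinearMap.smul_apply, mulOp_apply]
    simp only [Matrix.smul_mulVec, map_smul, toAlbertC_matC hj, baseChange_sub_smul_one]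
    refine Prod.ext (Prod.ext ?_ ?_) (Prod.ext ?_ ?_) <;> simp
    · ring
    · module
    · ring
  · show _ = toV56 j (block56 _ _ _ _ _ _ _ _ *ᵥ u)
    rw [toV56_block56 _ _ _ _ _ _ _ _ _ _ _ _ u (eq_elim u), toV56_eq, rep_h_one,
      LinearMap.smul_apply, LinearMap.add_apply, raise_apply, lower_apply]
    simp only [Matrix.smul_mulVec, map_smul, toAlbertC_matC hj, innC_toAlbertC,
      ← incl_eq_toAlbertC hj, freudC_incl_eq, smul_dotProduct]
    refine Prod.ext (Prod.ext ?_ ?_) (Prod.ext ?_ ?_) <;> simp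
    · module
    · linear_combination (-Complex.I / 2 * (coordC j x ⬝ᵥ fun μ => u (.inr (.inl μ)))) * h2
    · module
    · linear_combination (-Complex.I / 2 * (coordC j x ⬝ᵥ fun μ => u (.inl (.inl μ)))) * h2
  · show _ = toV56 j (block56 _ _ _ _ _ _ _ _ *ᵥ u)
    rw [toV56_block56 _ _ _ _ _ _ _ _ _ _ _ _ u (eq_elim u), toV56_eq, rep_h_two,
      LinearMap.sub_apply, raise_apply, lower_apply]
    simp only [Matrix.smul_mulVec, Matrix.neg_mulVec, map_neg, map_smul, toAlbertC_matC hj,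
      innC_toAlbertC, ← incl_eq_toAlbertC hj, freudC_incl_eq, smul_dotProduct]
    refine Prod.ext (Prod.ext ?_ ?_) (Prod.ext ?_ ?_) <;> simp
    · module
    · linear_combination (-1 / 2 * (coordC j x ⬝ᵥ fun μ => u (.inr (.inl μ)))) * h2
    · module
    · linear_combination (-1 / 2 * (coordC j x ⬝ᵥ fun μ => u (.inl (.inl μ)))) * h2

theorem trace_block56_mul (P Q R S P' Q' R' S' : Matrix (Fin 27) (Fin 27) ℂ)
    (v w v' w' : Fin 27 → ℂ) (c d c' d' : ℂ) :
    (block56 P Q R S v w c d * block56 P' Q' R' S' v' w' c' d').trace =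
      (P * P').trace + (Q * R').trace + (R * Q').trace + (S * S').trace
        + 2 * (v ⬝ᵥ w') + 2 * (w ⬝ᵥ v') + c * c' + d * d' := by
  simp only [block56, Matrix.fromBlocks_multiply]
  simp [Matrix.trace, Matrix.mul_apply, dotProduct, Finset.sum_add_distrib]
  ring

theorem matC_smul_one (hj : Normalized 2 j) (r : ℝ) : matC j (r • 1) = (r : ℂ) • 1 := by
  ext μ ν
  have e : jDual 2 j μ (r • jAll 2 j ν) = r * jDual 2 j μ (jAll 2 j ν) := by
    simp only [jDual, map_smul, smul_eq_mul]; ring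
  simp only [matC, Matrix.of_apply, LinearMap.smul_apply, Module.End.one_apply, e,
    jDual_jAll two_pos hj, Matrix.smul_apply, Matrix.one_apply, smul_eq_mul]
  split_ifs <;> simp

theorem coordC_jAll (hj : Normalized 2 j) (μ : Fin 27) : coordC j (jAll 2 j μ) = eVec μ := by
  funext ν
  rw [coordC, jDual_jAll two_pos hj, eVec, Pi.single_apply]
  split_ifs <;> simp

/-- `I₃ ▷ ·` is `-½` on traceless elements and 1 on `I₃`, that is `-½ Ĩ`. -/
theorem matC_freud_idMat (hj : Normalized 2 j) :
    matC j (freud (jAll 2 j (Fin.last 26))) = -(csqrt (2 / 3) / 2) • ITilde := by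
  ext μ ν
  have h1 : freud (jAll 2 j (Fin.last 26)) (jAll 2 j ν) =
      (-(√(2 / 3) / 2) * if ν = Fin.last 26 then -2 else 1) • jAll 2 j ν := by
    rw [jAll_last, map_smul, LinearMap.smul_apply, freud_apply, idMat_mul, tr_idMat]
    induction ν using Fin.lastCases with
    | last =>
      rw [jAll_last, map_smul, tr_idMat, if_pos rfl, smul_eq_mul]
      module
    | cast a =>
      rw [jAll_castSucc, if_neg (Fin.castSucc_lt_last a).ne, show tr (j a : Albert) = 0 from (j a).2]
      module
  have e (r : ℝ) : jDual 2 j μ (r • jAll 2 j ν) = r * jDual 2 j μ (jAll 2 j ν) := by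
    simp only [jDual, map_smul, smul_eq_mul]; ring
  simp only [matC, Matrix.of_apply, h1, e, jDual_jAll two_pos hj, Matrix.smul_apply, ITilde,
    Matrix.diagonal_apply, smul_eq_mul, csqrt]
  by_cases hμ : μ = ν
  · subst hμ
    split_ifs <;> push_cast <;> ring
  · simp [hμ]

theorem smul_block56 (r : ℂ) (P Q R S : Matrix (Fin 27) (Fin 27) ℂ) (v w : Fin 27 → ℂ) (c d : ℂ) :
    r • block56 P Q R S v w c d =
      block56 (r • P) (r • Q) (r • R) (r • S) (r • v) (r • w) (r * c) (r * d) := by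
  simp only [block56, Matrix.fromBlocks_smul, Matrix.replicateCol_smul, Matrix.replicateRow_smul,
    smul_zero]
  rfl

theorem CMat_eq (D : Module.Basis (Fin 52) ℝ (Der Albert)) (I : Fin 52) :
    CMat j D I = matC j (D I : Module.End ℝ Albert) := rfl

theorem CtMat_eq (α : Fin 27) :
    CtMat j α = -Complex.I • matC j (LinearMap.mulLeft ℝ (jAll 2 j α)) := by
  ext μ ν
  simp only [CtMat, matC, Matrix.of_apply, Matrix.smul_apply, LinearMap.mulLeft_apply, smul_eq_mul,
    mul_comm (jAll 2 j ν)]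

theorem AMat_eq (α : Fin 27) : AMat j α = matC j (freud (jAll 2 j α)) := rfl

theorem matC_der_transpose (δ : Der Albert) : (matC j (δ : Module.End ℝ Albert)).transpose =
    -matC j (δ : Module.End ℝ Albert) := by
  rw [matC_transpose (g := -(δ : Module.End ℝ Albert))
    (fun x y => by rw [inn_der, LinearMap.neg_apply, map_neg])]
  ext μ ν
  simp [matC, jDual]

theorem matC_mulLeft_transpose (x : Albert) :
    (matC j (LinearMap.mulLeft ℝ x)).transpose = matC j (LinearMap.mulLeft ℝ x) :=
  matC_transpose fun y z => by
    rw [LinearMap.mulLeft_apply, LinearMap.mulLeft_apply, mul_comm x y, inn_mul]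

theorem Y_inr_inl (D : Module.Basis (Fin 52) ℝ (Der Albert)) (I : Fin 52) :
    Y j D (.inr (.inl I)) = derMat j (D I) := by
  simp only [Y, derMat, CMat_eq, matC_der_transpose, neg_neg]

theorem Y_inr_inr (hj : Normalized 2 j) (D : Module.Basis (Fin 52) ℝ (Der Albert)) (i : Fin 3)
    (a : Fin 26) : Y j D (.inr (.inr (i, a))) = hMat j i (j a : Albert) := by
  have hc : i = 0 ∨ i = 1 ∨ i = 2 := by decide +revert
  have ht : tr (j a : Albert) = 0 := (j a).2
  have hco : coordC j (j a : Albert) = eVec a.castSucc := by rw [← coordC_jAll hj, jAll_castSucc]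
  rcases hc with rfl | rfl | rfl
  · show block56 _ _ _ _ _ _ _ _ = block56 _ _ _ _ _ _ _ _
    simp only [CtMat_eq, Matrix.transpose_smul, matC_mulLeft_transpose, jAll_castSucc, ht]
    simp
  · show _ • block56 _ _ _ _ _ _ _ _ = block56 _ _ _ _ _ _ _ _
    simp only [smul_block56, AMat_eq, jAll_castSucc, hco, smul_smul, smul_zero, mul_zero]
    congr 2 <;> ring
  · show _ • block56 _ _ _ _ _ _ _ _ = block56 _ _ _ _ _ _ _ _
    simp only [smul_block56, AMat_eq, jAll_castSucc, hco, smul_smul, smul_zero, mul_zero]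
    congr 2 <;> norm_num <;> ring_nf

theorem Y_inl (hj : Normalized 2 j) (D : Module.Basis (Fin 52) ℝ (Der Albert)) (L : Fin 3) :
    Y j D (.inl L) = hMat j L (jAll 2 j (Fin.last 26)) := by
  have hc : L = 0 ∨ L = 1 ∨ L = 2 := by decide +revert
  have hco := coordC_jAll hj (Fin.last 26)
  rcases hc with rfl | rfl | rfl
  · show block56 _ _ _ _ _ _ _ _ = block56 _ _ _ _ _ _ _ _
    have ht : tr (jAll 2 j (Fin.last 26)) = √(2 / 3) * 3 := by
      rw [jAll_last, map_smul, tr_idMat, smul_eq_mul]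
    have e : LinearMap.mulLeft ℝ (jAll 2 j (Fin.last 26)) -
        (1 / 2 * tr (jAll 2 j (Fin.last 26))) • (1 : Module.End ℝ Albert) =
        (-(1 / 2) * √(2 / 3)) • (1 : Module.End ℝ Albert) := by
      ext1 x
      simp only [LinearMap.sub_apply, LinearMap.mulLeft_apply, LinearMap.smul_apply,
        Module.End.one_apply, ht]
      rw [jAll_last, smul_mul_assoc, idMat_mul]
      module
    have h6 : √(2 / 3) * √6 = 2 := by
      rw [← Real.sqrt_mul (by norm_num), show (2 / 3 * 6 : ℝ) = 2 ^ 2 by norm_num,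
        Real.sqrt_sq (by norm_num)]
    have h32 : √(3 / 2) = 3 / 2 * √(2 / 3) := by
      rw [show (3 / 2 : ℝ) = (3 / 2) ^ 2 * (2 / 3) by norm_num, Real.sqrt_mul (by norm_num),
        Real.sqrt_sq (by norm_num)]
      norm_num
    have h6' : ((√6 : ℝ) : ℂ)⁻¹ = 1 / 2 * (√(2 / 3) : ℝ) := by
      rw [← Complex.ofReal_inv, eq_div_of_mul_eq (by positivity) h6]
      push_cast
      ring
    rw [e, matC_smul_one hj, ht, csqrt, csqrt, h32, div_eq_mul_inv, h6', smul_smul, smul_smul]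
    push_cast
    congr 2 <;> ring
  · show _ • block56 _ _ _ _ _ _ _ _ = block56 _ _ _ _ _ _ _ _
    simp only [smul_block56, hco, smul_smul, smul_zero, mul_zero, matC_freud_idMat hj]
    congr 2 <;> ring
  · show _ • block56 _ _ _ _ _ _ _ _ = block56 _ _ _ _ _ _ _ _
    simp only [smul_block56, hco, smul_smul, smul_zero, mul_zero, matC_freud_idMat hj]
    congr 2 <;> norm_num <;> ring_nf

end Operators

end Yokota


/-! ### The matrix representation and the trace form -/

namespace Yokota

open TKK
open scoped Matrix

section Representation

variable {j : Module.Basis (Fin 26) ℝ traceless}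

theorem YOp_toV56 (hj : Normalized 2 j) (D : Module.Basis (Fin 52) ℝ (Der Albert)) (A : Idx133)
    (u : Idx56 → ℂ) : YOp 2 j D A (toV56 j u) = toV56 j (Y j D A *ᵥ u) := by
  have hc : ∀ i : Fin 3, i = 0 ∨ i = 1 ∨ i = 2 := by decide
  have hz : ((0 : traceless) : Albert) = 0 := rfl
  rcases A with L | I | ⟨i, a⟩
  · rw [Y_inl hj, ← rep_h_toV56 hj]
    congr 1
    rcases hc L with rfl | rfl | rfl <;>
      simp only [YOp, yokota_eq_rep, jAll_last] <;> simp [hz]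
  · rw [Y_inr_inl, ← rep_ofDer_toV56 hj]
    congr 1
    simp [YOp, yokota_eq_rep, hz]
  · rw [Y_inr_inr hj, ← rep_h_toV56 hj]
    congr 1
    rcases hc i with rfl | rfl | rfl <;> simp [YOp, yokota_eq_rep, hz]

/-- Coordinates on `V₅₆`, as a linear equivalence. -/
noncomputable def equivV56 (hj : Normalized 2 j) : (Idx56 → ℂ) ≃ₗ[ℂ] V56 :=
  LinearEquiv.ofBijective (toV56Lin j) (toV56_bijective hj)

theorem equivV56_apply (hj : Normalized 2 j) (u : Idx56 → ℂ) : equivV56 hj u = toV56 j u := rfl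

theorem mat_ext (hj : Normalized 2 j) {N N' : Matrix Idx56 Idx56 ℂ}
    (h : ∀ u, toV56 j (N *ᵥ u) = toV56 j (N' *ᵥ u)) : N = N' := by
  apply Matrix.toLin'.injective
  apply LinearMap.ext
  intro u
  exact (toV56_bijective hj).1 (h u)

/-- The matrix of an endomorphism of `V₅₆`. -/
noncomputable def matV56 (hj : Normalized 2 j) (f : Module.End ℂ V56) : Matrix Idx56 Idx56 ℂ :=
  LinearMap.toMatrix' ((equivV56 hj).symm.toLinearMap ∘ₗ f ∘ₗ (equivV56 hj).toLinearMap)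

theorem toV56_matV56 (hj : Normalized 2 j) (f : Module.End ℂ V56) (u : Idx56 → ℂ) :
    toV56 j (matV56 hj f *ᵥ u) = f (toV56 j u) := by
  rw [matV56, LinearMap.toMatrix'_mulVec, ← equivV56_apply hj, ← equivV56_apply hj]
  simp

theorem matV56_eq (hj : Normalized 2 j) {f : Module.End ℂ V56} {N : Matrix Idx56 Idx56 ℂ}
    (h : ∀ u, f (toV56 j u) = toV56 j (N *ᵥ u)) : matV56 hj f = N :=
  mat_ext hj fun u => by rw [toV56_matV56, h]

theorem toV56_add (u v : Idx56 → ℂ) : toV56 j (u + v) = toV56 j u + toV56 j v :=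
  map_add (toV56Lin j) u v

theorem toV56_sub (u v : Idx56 → ℂ) : toV56 j (u - v) = toV56 j u - toV56 j v :=
  map_sub (toV56Lin j) u v

theorem toV56_real_smul (r : ℝ) (u : Idx56 → ℂ) : toV56 j (r • u) = r • toV56 j u := by
  have e := map_smul (toV56Lin j) (r : ℂ) u
  rw [show (r : ℂ) • u = r • u by funext i; simp] at e
  exact e.trans (RCLike.real_smul_eq_coe_smul (K := ℂ) r _).symm

/-- The matrix form of the 56-dimensional representation. -/
noncomputable def repMat (hj : Normalized 2 j) : TKK →ₗ⁅ℝ⁆ Matrix Idx56 Idx56 ℂ where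
  toFun X := matV56 hj (rep X)
  map_add' X Y := matV56_eq hj fun u => by
    rw [Matrix.add_mulVec, toV56_add, toV56_matV56, toV56_matV56, map_add]; rfl
  map_smul' c X := matV56_eq hj fun u => by
    rw [Matrix.smul_mulVec, RingHom.id_apply, toV56_real_smul, toV56_matV56, map_smul]; rfl
  map_lie' {X Y} := matV56_eq hj fun u => by
    rw [Ring.lie_def, Matrix.sub_mulVec, ← Matrix.mulVec_mulVec, ← Matrix.mulVec_mulVec, toV56_sub,
      rep_lie]
    simp only [toV56_matV56]
    rfl

theorem toV56_repMat (hj : Normalized 2 j) (X : TKK) (u : Idx56 → ℂ) :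
    toV56 j (repMat hj X *ᵥ u) = rep X (toV56 j u) := toV56_matV56 hj _ u

theorem repMat_injective (hj : Normalized 2 j) : Function.Injective (repMat hj) := by
  intro X Y hXY
  apply rep_injective
  apply LinearMap.ext
  intro v
  obtain ⟨u, rfl⟩ := (toV56_bijective hj).2 v
  rw [← toV56_repMat hj, ← toV56_repMat hj, hXY]

theorem sqrt_six_eq : √6 = 2 * √(3 / 2) := by
  rw [show (6 : ℝ) = 2 ^ 2 * (3 / 2) by norm_num, Real.sqrt_mul (by norm_num),
    Real.sqrt_sq (by norm_num)]

theorem repMat_psiBasis (hj : Normalized 2 j) (D : Module.Basis (Fin 52) ℝ (Der Albert))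
    (A : Idx133) : repMat hj (psiBasis j D A) =
      (Sum.elim (fun _ => √6) (fun _ => 1) A : ℝ) • Y j D A := by
  apply mat_ext hj
  intro u
  rw [toV56_repMat, ← smul_YOp 2 two_pos, Matrix.smul_mulVec, toV56_real_smul, ← YOp_toV56 hj,
    sqrt_six_eq]
  rfl

theorem linearIndependent_Y (hj : Normalized 2 j) (D : Module.Basis (Fin 52) ℝ (Der Albert)) :
    LinearIndependent ℝ (Y j D) := by
  have h1 := (psiBasis j D).linearIndependent.map' (repMat hj).toLinearMap
    (LinearMap.ker_eq_bot.2 (repMat_injective hj))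
  have h6 : (√6)⁻¹ ≠ 0 := by positivity
  -- Independence is known for the `k_A Y_A`; dividing by the nonzero `k_A` transfers it to the
  -- `Y_A`.
  have h2 := h1.units_smul (w := Sum.elim (fun _ => Units.mk0 _ h6) (fun _ => 1))
  suffices hY : Y j D = (Sum.elim (fun _ => Units.mk0 _ h6) (fun _ => 1) : Idx133 → ℝˣ) •
      ((repMat hj).toLinearMap ∘ psiBasis j D) by
    rw [hY]; exact h2
  funext A
  show _ = (Sum.elim (fun _ => Units.mk0 _ h6) (fun _ => 1) A : ℝˣ) • repMat hj (psiBasis j D A)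
  rw [repMat_psiBasis]
  rcases A with L | A
  · simp [Units.smul_def, smul_smul]
  · simp

theorem irreducible_Y (hj : Normalized 2 j) (D : Module.Basis (Fin 52) ℝ (Der Albert))
    (W : Submodule ℂ (Idx56 → ℂ)) (hW : ∀ A, ∀ v ∈ W, Y j D A *ᵥ v ∈ W) : W = ⊥ ∨ W = ⊤ := by
  have hX (X : TKK) : ∀ v ∈ W, repMat hj X *ᵥ v ∈ W := by
    have hm : X ∈ Submodule.span ℝ (Set.range (psiBasis j D)) :=
      (psiBasis j D).span_eq ▸ Submodule.mem_top
    induction hm using Submodule.span_induction with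
    | zero => intro v _; rw [map_zero, Matrix.zero_mulVec]; exact W.zero_mem
    | mem X hX =>
      obtain ⟨A, rfl⟩ := hX
      intro v hv
      rw [repMat_psiBasis, Matrix.smul_mulVec, RCLike.real_smul_eq_coe_smul (K := ℂ)]
      exact W.smul_mem _ (hW A v hv)
    | smul r X _ hX =>
      intro v hv
      rw [map_smul, Matrix.smul_mulVec, RCLike.real_smul_eq_coe_smul (K := ℂ)]
      exact W.smul_mem _ (hX v hv)
    | add X X' _ _ h1 h2 =>
      intro v hv
      rw [map_add, Matrix.add_mulVec]
      exact W.add_mem (h1 v hv) (h2 v hv)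
  have h1 := irreducible (W.map (equivV56 hj).toLinearMap) (by
    rintro X _ ⟨u, hu, rfl⟩
    exact ⟨_, hX X u hu, toV56_repMat hj X u⟩)
  rcases h1 with h1 | h1
  · left
    exact Submodule.map_eq_bot_iff.1 h1
  · right
    rw [eq_top_iff]
    intro u _
    obtain ⟨v, hv, e⟩ : equivV56 hj u ∈ W.map (equivV56 hj).toLinearMap := h1 ▸ Submodule.mem_top
    rwa [← (equivV56 hj).injective e]

end Representation

section Trace

variable {j : Module.Basis (Fin 26) ℝ traceless}

/-- The formula for `tr (L_x L_y)` requires a traceless factor, so it is applied to the traceless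
part of `y`. -/
theorem trace_mulLeft_sub_mul (x y : Albert) :
    LinearMap.trace ℝ Albert ((LinearMap.mulLeft ℝ x - (1 / 2 * tr x) • 1) *
      (LinearMap.mulLeft ℝ y - (1 / 2 * tr y) • 1)) = 3 * inn x y - 1 / 4 * (tr x * tr y) := by
  have h1 := trace_mulLeft_mul_mulLeft (x := x) (tr_tl y)
  have e : LinearMap.mulLeft ℝ (tl y) = LinearMap.mulLeft ℝ y - (1 / 3 * tr y) • 1 := by
    ext1 z
    rw [LinearMap.mulLeft_apply, tl_apply, sub_mul, smul_mul_assoc, idMat_mul]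
    rfl
  have h9 : LinearMap.trace ℝ Albert (1 : Module.End ℝ Albert) = 27 := by
    rw [Module.End.one_eq_id, LinearMap.trace_id, Albert.finrank_eq]; norm_num
  rw [e, tl_apply, mul_sub, mul_smul_comm, mul_one, map_sub, map_smul, map_sub, map_smul,
    trace_mulLeft, inn_idMat_right, smul_eq_mul, smul_eq_mul] at h1
  simp only [sub_mul, mul_sub, smul_mul_assoc, mul_smul_comm, mul_one, one_mul, map_sub, map_smul,
    trace_mulLeft, h9, smul_eq_mul]
  linear_combination h1

theorem coordC_dotProduct (hj : Normalized 2 j) (x y : Albert) :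
    coordC j x ⬝ᵥ coordC j y = 1 / 2 * (inn x y : ℂ) := by
  have e := innC_toAlbertC (j := j) x (coordC j y)
  rw [← incl_eq_toAlbertC hj, innC_incl] at e
  rw [e]; ring

/-- For `i = 0` the `𝔍`-blocks give `-6 ⟨x, y⟩ + ½ tr x tr y`, and the two scalars cancel the second
term. For `i = 1, 2` the Freudenthal blocks give `-5 ⟨x, y⟩` and the border vectors `-⟨x, y⟩`. -/
theorem trace_hMat_mul (hj : Normalized 2 j) (i k : Fin 3) (x y : Albert) :
    (hMat j i x * hMat j k y).trace = if i = k then -6 * (inn x y : ℂ) else 0 := by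
  have hc : ∀ i : Fin 3, i = 0 ∨ i = 1 ∨ i = 2 := by decide
  have h2 := csqrt_two_mul_self
  have hI := Complex.I_mul_I
  rcases hc i with rfl | rfl | rfl <;> rcases hc k with rfl | rfl | rfl <;>
    refine (trace_block56_mul _ _ _ _ _ _ _ _ _ _ _ _ _ _ _ _).trans ?_ <;>
    simp only [Matrix.smul_mul, Matrix.mul_smul, Matrix.neg_mul, Matrix.mul_neg, Matrix.trace_neg,
      Matrix.trace_smul, ← matC_mul hj, trace_matC hj, trace_mulLeft_sub_mul,
      trace_freud_mul_freud, smul_dotProduct, dotProduct_smul, coordC_dotProduct hj,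
      Matrix.mul_zero, Matrix.zero_mul, Matrix.trace_zero, dotProduct_zero, zero_dotProduct,
      smul_eq_mul, if_true] <;> push_cast
  · linear_combination (6 * (inn x y : ℂ)) * hI
  · ring
  · ring
  · ring
  · linear_combination (6 * (inn x y : ℂ)) * hI + (1 / 2 * Complex.I ^ 2 * (inn x y : ℂ)) * h2
  · ring
  · ring
  · ring
  · linear_combination (-1 / 2 * (inn x y : ℂ)) * h2

theorem trace_derMat_mul_derMat (hj : Normalized 2 j) (δ ε : Der Albert) :
    (derMat j δ * derMat j ε).trace = 2 * (LinearMap.trace ℝ Albert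
      ((δ : Module.End ℝ Albert) ∘ₗ (ε : Module.End ℝ Albert)) : ℂ) := by
  refine (trace_block56_mul _ _ _ _ _ _ _ _ _ _ _ _ _ _ _ _).trans ?_
  simp only [← matC_mul hj, trace_matC hj, Matrix.mul_zero, Matrix.trace_zero, dotProduct_zero,
    Module.End.mul_eq_comp]
  ring

theorem trace_derMat_mul_hMat (δ : Der Albert) (i : Fin 3) (x : Albert) :
    (derMat j δ * hMat j i x).trace = 0 := by
  have hc : i = 0 ∨ i = 1 ∨ i = 2 := by decide +revert
  rcases hc with rfl | rfl | rfl <;>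
    refine (trace_block56_mul _ _ _ _ _ _ _ _ _ _ _ _ _ _ _ _).trans ?_ <;>
    simp [Matrix.trace_neg]

/-- All diagonal values are `-12`: derivations occur in two blocks of trace `-6`, and the other
generators have `-6 ⟨j_μ, j_μ⟩` with `⟨j_μ, j_μ⟩ = 2`. -/
theorem trace_Y_mul_Y (hj : Normalized 2 j) (D : Module.Basis (Fin 52) ℝ (Der Albert))
    (hD : ∀ I K, LinearMap.trace ℝ Albert
      ((D I : Module.End ℝ Albert) ∘ₗ (D K : Module.End ℝ Albert)) = if I = K then -6 else 0)
    (A B : Idx133) :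
    -(1 / 12 : ℂ) * (Y j D A * Y j D B).trace = if A = B then 1 else 0 := by
  have hil (a : Fin 26) : inn (jAll 2 j (Fin.last 26)) (j a : Albert) = 0 := by
    rw [← jAll_castSucc 2, inn_jAll two_pos hj, if_neg (Fin.castSucc_lt_last a).ne']
  rcases A with L | I | ⟨i, a⟩ <;> rcases B with L' | I' | ⟨i', a'⟩ <;>
    simp only [Y_inl hj, Y_inr_inl, Y_inr_inr hj, trace_derMat_mul_hMat, trace_derMat_mul_derMat hj,
      Matrix.trace_mul_comm (hMat _ _ _) (derMat _ _), trace_hMat_mul hj, hD, hj, hil,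
      inn_comm _ (jAll 2 j (Fin.last 26)), inn_jAll two_pos hj, Sum.inl.injEq, Sum.inr.injEq,
      Prod.mk.injEq, reduceCtorEq, if_false, if_true]
  · split_ifs <;> norm_num
  · exact mul_zero _
  · simp
  · exact mul_zero _
  · split_ifs <;> norm_num
  · exact mul_zero _
  · simp
  · exact mul_zero _
  · by_cases h1 : i = i' <;> by_cases h2 : a = a' <;> simp [h1, h2] <;> norm_num

end Trace

end Yokota


/-! ### The cubic form and the components of the matrices -/

namespace Albert

theorem det_eq_inn (x y z : Albert) : det x y z = 1 / 3 * inn (freud x y) z := by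
  rw [inn_freud]; ring

theorem inn_mul_right_comm (x y z : Albert) : inn x (y * z) = inn z (y * x) := by
  rw [← inn_mul, inn_comm, mul_comm x y]

/-- Written as `⅓ ⟨x ▷ y, z⟩`, the form is killed by `δ`, a skew derivation of `▷`, and by `L_s`, a
self-adjoint map satisfying `mul_freud` with vanishing trace term. -/
theorem det_invariant (δ : Der Albert) {s : Albert} (hs : tr s = 0) (x y z : Albert)
    {f : Module.End ℝ Albert} (hf : f = (δ : Module.End ℝ Albert) + LinearMap.mulRight ℝ s) :
    det (f x) y z + det x (f y) z + det x y (f z) = 0 := by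
  have h1 := mul_freud s x y
  have h2 := der_freud δ x y
  have h3 := inn_der δ (freud x y) z
  rw [hs, zero_smul] at h1
  have h4 : inn (freud x y) (z * s) = inn (s * freud x y) z := by
    rw [mul_comm z s, ← inn_mul, mul_comm s]
  have h5 := congrArg (fun u => inn u z) h1
  simp only [map_add, LinearMap.add_apply, map_zero, LinearMap.zero_apply] at h5
  rw [h2, map_add, LinearMap.add_apply] at h3
  simp only [hf, det_eq_inn, LinearMap.add_apply, LinearMap.mulRight_apply, map_add, h4]
  rw [mul_comm x s, mul_comm y s]
  linear_combination 1 / 3 * h5 + 1 / 3 * h3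

theorem eq_freud_of_det {x y w : Albert} (hw : ∀ z, det x y z = 1 / 3 * tr (w * z)) :
    w = freud x y := by
  apply eq_of_inn
  intro z
  have e := hw z
  rw [det_eq_inn, ← inn_apply] at e
  linarith

theorem exists_normalized_bases :
    ∃ (j : Module.Basis (Fin 26) ℝ traceless) (D : Module.Basis (Fin 52) ℝ (Der Albert)),
      (∀ a b, inn (j a : Albert) (j b : Albert) = if a = b then 2 else 0) ∧
      (∀ I K, LinearMap.trace ℝ Albert
        ((D I : Module.End ℝ Albert) ∘ₗ (D K : Module.End ℝ Albert)) = if I = K then -6 else 0) := by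
  obtain ⟨j, hj⟩ := exists_basis_of_posDef (inn.restrict traceless)
    (fun x y => inn_comm (x : Albert) (y : Albert))
    (fun x hx => inn_self_pos fun h0 => hx (Subtype.ext h0)) finrank_traceless two_pos
  obtain ⟨D, hD⟩ := exists_basis_of_posDef derForm derForm_comm derForm_self_pos
    finrank_der (c := 6) (by norm_num)
  refine ⟨j, D, hj, fun I K => ?_⟩
  have e := hD I K
  rw [derForm_apply] at e
  have e' : LinearMap.trace ℝ Albert
    ((D I : Module.End ℝ Albert) ∘ₗ (D K : Module.End ℝ Albert)) = -(if I = K then 6 else 0) := by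
    rw [← e, neg_neg]; rfl
  rw [e']
  split_ifs <;> norm_num

end Albert

namespace Yokota

theorem isAdjointPair_phi (δ : Der Albert) (s : traceless) :
    LinearMap.IsAdjointPair innC innC (phi δ s) (phiT δ s) := by
  have e : innC ∘ₗ phi δ s = innC.compl₂ (phiT δ s) := by
    apply hom_ext_albertC
    intro x
    apply hom_ext_albertC
    intro y
    simp only [LinearMap.comp_apply, LinearMap.compl₂_apply, phi, phiT, LinearMap.sub_apply,
      LinearMap.smul_apply, LinearMap.neg_apply, baseChange_incl, map_sub, map_neg, map_smul,
      innC_incl, LinearMap.mulRight_apply, inn_der, inn_mul, mul_comm y]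
    push_cast
    rfl
  intro x y
  exact congrArg (fun f : AlbertC →ₗ[ℂ] AlbertC →ₗ[ℂ] ℂ => f x y) e

section Components

variable {j : Module.Basis (Fin 26) ℝ traceless}

theorem freud_of_traceless (a : traceless) (x : Albert) :
    freud (a : Albert) x = (a : Albert) * x - (1 / 2 : ℝ) • tr x • (a : Albert)
      - (1 / 2 : ℝ) • inn x (a : Albert) • idMat := by
  rw [freud_apply, show tr (a : Albert) = 0 from a.2, inn_apply, mul_comm x]
  module

theorem AMat_apply (α β γ : Fin 27) : AMat j α β γ =
    ((1 / 2 * tr (freud (jAll 2 j α) (jAll 2 j γ) * jAll 2 j β) : ℝ) : ℂ) := by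
  rw [AMat, Matrix.of_apply, jDual, inn_comm, inn_apply, one_div]

theorem AMat_eq_det (α β γ : Fin 27) : AMat j α β γ =
    ((3 / 2 * det (jAll 2 j α) (jAll 2 j γ) (jAll 2 j β) : ℝ) : ℂ) := by
  rw [AMat_apply, ← inn_apply, inn_freud]
  congr 1; ring

theorem AMat_comm_right (α β γ : Fin 27) : AMat j α β γ = AMat j α γ β := by
  rw [AMat_eq_det, AMat_eq_det, det_comm23]

theorem AMat_comm_left (α β γ : Fin 27) : AMat j α β γ = AMat j β α γ := by
  rw [AMat_eq_det, AMat_eq_det, det_comm23, det_comm12, det_comm23]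

theorem CtMat_apply (α β γ : Fin 27) : CtMat j α β γ =
    -Complex.I * ((1 / 2 * inn (jAll 2 j β) (jAll 2 j γ * jAll 2 j α) : ℝ) : ℂ) := by
  rw [CtMat, Matrix.of_apply, jDual, one_div]

theorem AMat_castSucc (a b c : Fin 26) : AMat j c.castSucc a.castSucc b.castSucc =
    ((1 / 2 * tr ((j c : Albert) * (j b : Albert) * (j a : Albert)) : ℝ) : ℂ) := by
  have hb : tr (j b : Albert) = 0 := (j b).2
  have ha : tr (j a : Albert) = 0 := (j a).2
  rw [AMat_apply]
  simp only [jAll_castSucc]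
  rw [freud_of_traceless, hb, zero_smul, smul_zero, sub_zero, sub_mul, smul_mul_assoc,
    smul_mul_assoc, idMat_mul, map_sub, map_smul, map_smul, ha]
  simp

theorem AMat_castSucc_eq_CtMat (a b c : Fin 26) : AMat j c.castSucc a.castSucc b.castSucc =
    Complex.I * CtMat j c.castSucc a.castSucc b.castSucc := by
  rw [AMat_castSucc, CtMat_apply, ← mul_assoc, mul_neg, Complex.I_mul_I, neg_neg, one_mul]
  simp only [jAll_castSucc, inn_apply]
  rw [mul_comm (j b : Albert), mul_comm (j a : Albert)]

/-- The trilinear form `⟨x, y ∘ z⟩` is totally symmetric, so these symmetries hold with the index 27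
included. -/
theorem CtMat_comm_right (α β γ : Fin 27) : CtMat j α β γ = CtMat j α γ β := by
  rw [CtMat_apply, CtMat_apply, mul_comm (jAll 2 j γ), inn_mul_right_comm,
    mul_comm (jAll 2 j α)]

theorem CtMat_comm_left (α β γ : Fin 27) : CtMat j α β γ = CtMat j β α γ := by
  rw [CtMat_apply, CtMat_apply, inn_mul_right_comm]

theorem CtMat_comm_outer (α β γ : Fin 27) : CtMat j α β γ = CtMat j γ β α := by
  rw [CtMat_apply, CtMat_apply, mul_comm (jAll 2 j γ)]

theorem AMat_last (hj : Normalized 2 j) (μ ν : Fin 27) :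
    AMat j (Fin.last 26) μ ν = -(csqrt (2 / 3) / 2) * ITilde μ ν := by
  rw [AMat_eq, matC_freud_idMat hj]; rfl

theorem CtMat_last (hj : Normalized 2 j) (μ ν : Fin 27) : CtMat j (Fin.last 26) μ ν =
    if μ = ν then -Complex.I * csqrt (2 / 3) else 0 := by
  rw [CtMat_apply, jAll_last, mul_smul_comm, mul_idMat, map_smul, inn_jAll two_pos hj, csqrt]
  split_ifs
  · rw [smul_eq_mul]; push_cast; ring
  · simp

end Components

end Yokota

end E7Rep

theorem mainTheorem4 :
    -- normalized bases of `𝔍'` and of `D(𝔍)` exist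
    (∃ (j : Module.Basis (Fin 26) ℝ traceless) (D : Module.Basis (Fin 52) ℝ (Der Albert)),
      (∀ a b, inn (j a : Albert) (j b : Albert) = if a = b then 2 else 0) ∧
      (∀ I K, LinearMap.trace ℝ Albert
        ((D I : Module.End ℝ Albert) ∘ₗ (D K : Module.End ℝ Albert)) = if I = K then -6 else 0)) ∧
    -- the cubic form `Det` is symmetric, determines the Freudenthal product, and is invariant
    -- under `E₆`
    (∀ x y z : Albert, det x y z = det y x z ∧ det x y z = det x z y ∧
      det x y z = 1 / 3 * tr (freud x y * z)) ∧
    (∀ x y w : Albert, (∀ z, det x y z = 1 / 3 * tr (w * z)) → w = freud x y) ∧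
    (∀ (δ : Der Albert) (s : traceless) (f : Module.End ℝ Albert),
      f = (δ : Module.End ℝ Albert) + LinearMap.mulRight ℝ (s : Albert) →
      ∀ x y z, det (f x) y z + det x (f y) z + det x y (f z) = 0) ∧
    (∀ (δ : Der Albert) (s : traceless),
      LinearMap.IsAdjointPair innC innC (phi δ s) (phiT δ s)) ∧
    -- the Tits product is a Lie bracket on `D(ℍ) ⊕ D(𝔍) ⊕ (ℍ' ⊗ 𝔍')`
    (∀ X ∈ titsSpace, ∀ Z ∈ titsSpace, titsBracket X Z ∈ titsSpace) ∧
    (∀ X ∈ titsSpace, titsBracket X X = 0) ∧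
    (∀ X ∈ titsSpace, ∀ Z ∈ titsSpace, ∀ W ∈ titsSpace,
      titsBracket X (titsBracket Z W) + titsBracket Z (titsBracket W X)
        + titsBracket W (titsBracket X Z) = 0) ∧
    -- for every normalization `τ`, the adjoint matrices and the Yokota operators on
    -- `V₅₆ = (𝔍 ⊕ ℂ)²` have the same commutation relations
    (∀ (τ : ℝ), 0 < τ → ∀ (j : Module.Basis (Fin 26) ℝ traceless)
        (D : Module.Basis (Fin 52) ℝ (Der Albert)),
      (∀ a b, inn (j a : Albert) (j b : Albert) = if a = b then τ else 0) →
      (∀ μ ν, jDual τ j μ (jAll τ j ν) = if μ = ν then 1 else 0) ∧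
      (∀ x, x = ∑ μ, jDual τ j μ x • jAll τ j μ) ∧
      LinearIndependent ℝ (Psi j D) ∧
      Submodule.span ℝ (Set.range (Psi j D)) = titsSpace ∧
      ∃ M : Idx133 → Matrix Idx133 Idx133 ℝ,
        IsAdjointFamily j D M ∧
        (∀ A B, M A * M B - M B * M A = ∑ C, M A C B • M C) ∧
        ∀ k : Idx133 → ℝ, k = Sum.elim (fun _ => 2 * √(3 / τ)) (fun _ => 1) →
          ∀ A B, (k A • YOp τ j D A) ∘ₗ (k B • YOp τ j D B)
              - (k B • YOp τ j D B) ∘ₗ (k A • YOp τ j D A)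
            = ∑ C, M A C B • k C • YOp τ j D C) ∧
    -- the explicit matrices, `τ = 2`
    (∀ (j : Module.Basis (Fin 26) ℝ traceless) (D : Module.Basis (Fin 52) ℝ (Der Albert)),
      (∀ a b, inn (j a : Albert) (j b : Albert) = if a = b then 2 else 0) →
      -- they are the matrices of the Yokota operators
      Function.Bijective (toV56 j) ∧
      (∀ A v, YOp 2 j D A (toV56 j v) = toV56 j (Matrix.mulVec (Y j D A) v)) ∧
      -- they satisfy the commutation relations of the adjoint matrices and give a faithful
      -- irreducible representation of the compact Lie algebra spanned by the latter
      (∀ (M : Idx133 → Matrix Idx133 Idx133 ℝ) (k : Idx133 → ℝ), IsAdjointFamily j D M →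
        k = Sum.elim (fun _ => √6) (fun _ => 1) →
        (∀ A B, ⁅M A, M B⁆ = ∑ C, M A C B • M C) ∧
        (∀ A B, ⁅k A • Y j D A, k B • Y j D B⁆ = ∑ C, M A C B • k C • Y j D C) ∧
        LinearIndependent ℝ M ∧ LinearIndependent ℝ (Y j D) ∧
        ∃ 𝔪 : LieSubalgebra ℝ (Matrix Idx133 Idx133 ℝ),
          𝔪.toSubmodule = Submodule.span ℝ (Set.range M) ∧
          Module.finrank ℝ 𝔪 = 133 ∧
          LieAlgebra.IsSimple ℝ 𝔪 ∧
          (∀ x : 𝔪, x ≠ 0 → killingForm ℝ 𝔪 x x < 0) ∧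
          ∃ ρ : 𝔪 →ₗ⁅ℝ⁆ Matrix Idx56 Idx56 ℂ, Function.Injective ρ ∧
            ∀ A (h : M A ∈ 𝔪), ρ ⟨M A, h⟩ = k A • Y j D A) ∧
      (∀ W : Submodule ℂ (Idx56 → ℂ),
        (∀ A, ∀ v ∈ W, Matrix.mulVec (Y j D A) v ∈ W) → W = ⊥ ∨ W = ⊤) ∧
      -- they are orthonormal
      ((∀ I K, LinearMap.trace ℝ Albert
          ((D I : Module.End ℝ Albert) ∘ₗ (D K : Module.End ℝ Albert)) =
            if I = K then -6 else 0) →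
        ∀ A B, -(1 / 12 : ℂ) * Matrix.trace (Y j D A * Y j D B) = if A = B then 1 else 0) ∧
      -- the matrices `A_α` are given by the cubic form and totally symmetric
      (∀ a x, freud (j a : Albert) x = (j a : Albert) * x - (1 / 2 : ℝ) • tr x • (j a : Albert)
        - (1 / 2 : ℝ) • inn x (j a : Albert) • idMat) ∧
      (∀ α β γ, AMat j α β γ = ((1 / 2 * tr (freud (jAll 2 j α) (jAll 2 j γ) * jAll 2 j β) : ℝ) : ℂ)
        ∧ AMat j α β γ = ((3 / 2 * det (jAll 2 j α) (jAll 2 j γ) (jAll 2 j β) : ℝ) : ℂ)) ∧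
      (∀ α β γ, AMat j α β γ = AMat j α γ β ∧ AMat j α β γ = AMat j β α γ) ∧
      -- the matrices `C̃_c` without the 27th row and column are totally symmetric
      (∀ a b c : Fin 26,
        AMat j c.castSucc a.castSucc b.castSucc =
          ((1 / 2 * tr ((j c : Albert) * (j b : Albert) * (j a : Albert)) : ℝ) : ℂ) ∧
        AMat j c.castSucc a.castSucc b.castSucc =
          Complex.I * CtMat j c.castSucc a.castSucc b.castSucc ∧
        CtMat j c.castSucc a.castSucc b.castSucc = CtMat j c.castSucc b.castSucc a.castSucc ∧
        CtMat j c.castSucc a.castSucc b.castSucc = CtMat j a.castSucc c.castSucc b.castSucc) ∧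
      (∀ (a b : Fin 26) (μ : Fin 27),
        CtMat j a.castSucc μ b.castSucc = CtMat j b.castSucc μ a.castSucc) ∧
      -- the remaining components
      (∀ a : Fin 26,
        AMat j a.castSucc (Fin.last 26) (Fin.last 26) = 0 ∧
        AMat j (Fin.last 26) a.castSucc (Fin.last 26) = 0 ∧
        CtMat j a.castSucc (Fin.last 26) (Fin.last 26) = 0 ∧
        CtMat j (Fin.last 26) a.castSucc (Fin.last 26) = 0) ∧
      (∀ (a b : Fin 26) (r : ℂ), r = (if a = b then -(1 / 2) * csqrt (2 / 3) else 0) →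
        AMat j a.castSucc b.castSucc (Fin.last 26) = r ∧
        AMat j (Fin.last 26) a.castSucc b.castSucc = r ∧
        -(Complex.I / 2) * CtMat j a.castSucc b.castSucc (Fin.last 26) = r ∧
        -(Complex.I / 2) * CtMat j (Fin.last 26) b.castSucc a.castSucc = r) ∧
      AMat j (Fin.last 26) (Fin.last 26) (Fin.last 26) = csqrt (2 / 3) ∧
      Complex.I * CtMat j (Fin.last 26) (Fin.last 26) (Fin.last 26) = csqrt (2 / 3)) := by
  refine ⟨exists_normalized_bases,
    fun x y z => ⟨det_comm12 x y z, det_comm23 x y z, det_eq_inn x y z⟩,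
    fun x y w hw => eq_freud_of_det hw,
    fun δ s f hf x y z => det_invariant δ s.2 x y z hf,
    Yokota.isAdjointPair_phi,
    fun X hX Z hZ => TKK.titsBracket_mem hX hZ,
    fun X hX => TKK.titsBracket_self hX,
    fun X hX Z hZ W hW => TKK.titsBracket_jacobi hX hZ hW, ?_, ?_⟩
  · intro τ hτ j D hj
    refine ⟨Yokota.jDual_jAll hτ hj, Yokota.sum_jDual_smul hτ hj, TKK.linearIndependent_Psi j D,
      TKK.span_Psi j D, fun A => adMatrix (TKK.psiBasis j D) (TKK.psiBasis j D A),
      (TKK.isAdjointFamily_iff j D _).2 rfl, fun A B => ?_, ?_⟩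
    · rw [← Ring.lie_def, ← LieHom.map_lie]
      exact map_lie_eq_sum_adMatrix _ (adMatrix (TKK.psiBasis j D)).toLinearMap A B
    · rintro k rfl A B
      simp only [Yokota.smul_YOp τ hτ]
      -- The rescaled Yokota operators are the images of the basis that defines `M`, hence they have
      -- the same structure constants.
      exact (Yokota.rep_lie _ _).symm.trans (map_lie_eq_sum_adMatrix _ Yokota.rep A B)
  · intro j D hj
    refine ⟨Yokota.toV56_bijective hj, Yokota.YOp_toV56 hj D, ?_, Yokota.irreducible_Y hj D,
      Yokota.trace_Y_mul_Y hj D, fun a x => Yokota.freud_of_traceless (j a) x,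
      fun α β γ => ⟨Yokota.AMat_apply α β γ, Yokota.AMat_eq_det α β γ⟩,
      fun α β γ => ⟨Yokota.AMat_comm_right α β γ, Yokota.AMat_comm_left α β γ⟩,
      fun a b c => ⟨Yokota.AMat_castSucc a b c, Yokota.AMat_castSucc_eq_CtMat a b c,
        Yokota.CtMat_comm_right _ _ _, Yokota.CtMat_comm_left _ _ _⟩,
      fun a b μ => Yokota.CtMat_comm_outer _ _ _, fun a => ?_, ?_, ?_, ?_⟩
    · rintro M k hM rfl
      -- The adjoint family is unique, so the given `M` may be replaced by the matrices of `ad`.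
      obtain rfl := (TKK.isAdjointFamily_iff j D M).1 hM
      refine ⟨fun A B => ?_, fun A B => ?_, TKK.linearIndependent_adMatrix j D,
        Yokota.linearIndependent_Y hj D, TKK.adjointAlgebra j D,
        TKK.adjointAlgebra_toSubmodule j D, TKK.finrank_adjointAlgebra j D,
        TKK.isSimple_adjointAlgebra j D, TKK.killingForm_adjointAlgebra_neg j D,
        (Yokota.repMat hj).comp (TKK.equivAdjointAlgebra j D).symm.toLieHom, ?_, fun A hA => ?_⟩
      · rw [← LieHom.map_lie]
        exact map_lie_eq_sum_adMatrix _ (adMatrix (TKK.psiBasis j D)).toLinearMap A B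
      · simp only [← Yokota.repMat_psiBasis hj]
        rw [← LieHom.map_lie]
        exact map_lie_eq_sum_adMatrix _ (Yokota.repMat hj).toLinearMap A B
      · exact (Yokota.repMat_injective hj).comp (TKK.equivAdjointAlgebra j D).symm.injective
      · rw [← Yokota.repMat_psiBasis hj]
        exact congrArg (Yokota.repMat hj) ((TKK.equivAdjointAlgebra j D).symm_apply_apply _)
    -- By symmetry every component with an index 27 reduces to a component of `A₂₇` or `C̃₂₇`, which
    -- are a multiple of `Ĩ` and a scalar matrix.
    · have ha : a.castSucc ≠ Fin.last 26 := (Fin.castSucc_lt_last a).ne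
      have h1 : AMat j (Fin.last 26) a.castSucc (Fin.last 26) = 0 := by
        rw [Yokota.AMat_last hj, ITilde, Matrix.diagonal_apply_ne _ ha, mul_zero]
      have h2 : CtMat j (Fin.last 26) a.castSucc (Fin.last 26) = 0 := by
        rw [Yokota.CtMat_last hj, if_neg ha]
      exact ⟨(Yokota.AMat_comm_left _ _ _).trans h1, h1,
        (Yokota.CtMat_comm_left _ _ _).trans h2, h2⟩
    · rintro a b r rfl
      have ha : a.castSucc ≠ Fin.last 26 := (Fin.castSucc_lt_last a).ne
      have h1 : AMat j (Fin.last 26) a.castSucc b.castSucc =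
          if a = b then -(1 / 2) * csqrt (2 / 3) else 0 := by
        rw [Yokota.AMat_last hj, ITilde, Matrix.diagonal_apply, if_neg ha]
        simp only [Fin.castSucc_inj]
        split_ifs <;> ring
      have h2 : -(Complex.I / 2) * CtMat j (Fin.last 26) b.castSucc a.castSucc =
          if a = b then -(1 / 2) * csqrt (2 / 3) else 0 := by
        rw [Yokota.CtMat_last hj]
        simp only [Fin.castSucc_inj, eq_comm (a := b)]
        split_ifs
        · linear_combination (1 / 2 * csqrt (2 / 3)) * Complex.I_mul_I
        · ring
      refine ⟨?_, h1, ?_, h2⟩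
      · rw [Yokota.AMat_comm_right, Yokota.AMat_comm_left, h1]
      · rw [Yokota.CtMat_comm_outer, h2]
    · rw [Yokota.AMat_last hj, ITilde, Matrix.diagonal_apply_eq, if_pos rfl]
      ring
    · rw [Yokota.CtMat_last hj, if_pos rfl]
      linear_combination -csqrt (2 / 3) * Complex.I_mul_I
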